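/- For each $n\ge 1$ let $d^{(n)}=(d_1,\dots,d_n)$ be a sequence of positive integers, let $F_n(x)=\frac1n\#\{v\in[n]: d_v\le x\}$ and $\mathcal H_n=\sum_{v\in[n]}d_v$. Let $D_n$ have distribution function $F_n$ and let $B_n$ have law $\mathbb P(B_n=k)=\frac{k+1}{\mathcal H_n}\#\{v\in[n]: d_v=k+1\}$, $k\ge 0$. Assume: (1) $\min_{v}d_v\ge 2$, and there are $\tau\in(2,3)$, $\gamma\in(0,1)$, $C>0$, $\alpha>1/2$ such that for all $n\ge1$ and all $x\in[1,n^\alpha)$, $$x^{-(\tau-1)}e^{-C(\log x)^\gamma}\le 1-F_n(x)\le x^{-(\tau-1)}e^{C(\log x)^\gamma};$$ (2) there are probability laws $p_D,p_B$ on $\mathbb N$, not depending on $n$, and $\kappa>0$ such that for all $n\ge 1$ the total variation distances between the law of $D_n$ and $p_D$, and between the law of $B_n$ and $p_B$, are at most $n^{-\kappa}$. Consider the configuration model: give vertex $v\in[n]$ $d_v$ half-edges (and one more half-edge to vertex $n$ if $\mathcal H_n$ is odd), and match the half-edges uniformly at random, each matched pair forming an edge. Given the resulting multigraph, assign to its edges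 $e$ i.i.d. lengths $L_e\ge 0$ with distribution function $F_L$, and let $u,v$ be independent uniform vertices of $[n]$, independent of everything else. Put $F_L^{(-1)}(x)=\inf\{y\in\mathbb R: F_L(y)\ge x\}$ and assume $$\sum_{k=1}^\infty F_L^{(-1)}\big(e^{-e^k}\big)=\infty.$$ Let $d_L(u,v)$ be the minimum of $\sum_{e\in\pi}L_e$ over all paths $\pi$ from $u$ to $v$ ($\infty$ if there is none; $0$ if $u=v$), and let the hopcount $d_H(u,v)$ be the number of edges of a path attaining this minimum (the smallest such number if several paths attain it; $\infty$ if there is no path). Write $$N_n=2\sum_{i=1}^{\lfloor \log\log n/|\log(\tau-2)|\rfloor}F_L^{(-1)}\Big(\exp\big(-(\tau-2)^{-i}\big)\Big).$$ Then, as $n\to\infty$, $d_L(u,v)/N_n\to 1$ in probability; and for every $\varepsilon>0$, with probability tending to $1$, $$d_H(u,v)\ge(1-\varepsilon)\,\frac{2\log\log n}{|\log(\tau-2)|};$$ and, for every $\varepsilon>0$, with probability tending to $1$ there is a path from $u$ to $v$ of total length at most $(1+\varepsilon)N_n$ that has at most $(1+\varepsilon)\,2\log\log n/|\log(\tau-2)|$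 edges. -/

import Mathlib

open MeasureTheory ProbabilityTheory Filter Topology
open scoped ENNReal

noncomputable section

namespace ConfigModel

/-! ### Degree sequences and the assumptions on them -/

/-- The empirical distribution function `F_n(x) = n⁻¹ #{v : d_v ≤ x}` of the degrees. -/
def empiricalCDF {n : ℕ} (d : Fin n → ℕ) (x : ℝ) : ℝ :=
  ((Finset.univ.filter fun v => (d v : ℝ) ≤ x).card : ℝ) / n

/-- `P(D_n = k)`, where `D_n` is the degree of a uniformly chosen vertex. -/
def degreeMass {n : ℕ} (d : Fin n → ℕ) (k : ℕ) : ℝ :=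
  ((Finset.univ.filter fun v => d v = k).card : ℝ) / n

/-- `P(B_n = k)`, where `B_n` is the size-biased version of `D_n`, minus one. -/
def sizeBiasedMass {n : ℕ} (d : Fin n → ℕ) (k : ℕ) : ℝ :=
  ((k : ℝ) + 1) / ((∑ v, d v : ℕ) : ℝ) * ((Finset.univ.filter fun v => d v = k + 1).card : ℝ)

/-- Total variation distance of two probability mass functions on `ℕ`. -/
def tvDist (p q : ℕ → ℝ) : ℝ := (1 / 2) * ∑' k, |p k - q k|

/-- Power-law tails with exponent `τ` for the array of degree sequences `d n = (d_1, …, d_n)`,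
together with minimal degree at least two. -/
def PowerLawTail (d : ∀ n : ℕ, Fin n → ℕ) (τ : ℝ) : Prop :=
  2 < τ ∧ τ < 3 ∧
  (∃ γ C α : ℝ, 0 < γ ∧ γ < 1 ∧ 0 < C ∧ 1 / 2 < α ∧
    ∀ n : ℕ, 1 ≤ n → ∀ x : ℝ, 1 ≤ x → x < (n : ℝ) ^ α →
      1 / x ^ (τ - 1) * Real.exp (-C * Real.log x ^ γ) ≤ 1 - empiricalCDF (d n) x ∧
      1 - empiricalCDF (d n) x ≤ 1 / x ^ (τ - 1) * Real.exp (C * Real.log x ^ γ)) ∧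
  ∀ n : ℕ, ∀ v : Fin n, 2 ≤ d n v

/-- The laws of `D_n` and `B_n` are polynomially close, in total variation, to laws that do not
depend on `n`. -/
def LimitingDistributions (d : ∀ n : ℕ, Fin n → ℕ) : Prop :=
  ∃ (pD pB : PMF ℕ) (κ : ℝ), 0 < κ ∧ ∀ n : ℕ, 1 ≤ n →
    max (tvDist (degreeMass (d n)) fun k => (pD k).toReal)
        (tvDist (sizeBiasedMass (d n)) fun k => (pB k).toReal) ≤ (n : ℝ) ^ (-κ)

/-! ### The weighted configuration model -/

/-- If the total degree is odd, one half-edge is added to the last vertex. -/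
def evenDegrees {n : ℕ} (d : Fin n → ℕ) (v : Fin n) : ℕ :=
  if Odd (∑ w, d w) ∧ (v : ℕ) + 1 = n then d v + 1 else d v

/-- The half-edges: `⟨v, j⟩` is the `j`-th half-edge of the vertex `v`. -/
abbrev HalfEdge {n : ℕ} (d : Fin n → ℕ) : Type := Σ v : Fin n, Fin (d v)

/-- Perfect matchings of `H`, as involutions without fixed points. -/
def Pairing (H : Type) : Type := {σ : Equiv.Perm H // ∀ h, σ (σ h) = h ∧ σ h ≠ h}

instance (H : Type) : MeasurableSpace (Pairing H) := ⊤

/-- Sample points: a matching of the half-edges, a length for each unordered pair of half-edges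
(only the lengths of the matched pairs, which are the edges of the graph, are ever used), and two
vertices. -/
abbrev Sample {n : ℕ} (d : Fin n → ℕ) : Type :=
  Pairing (HalfEdge d) × (Sym2 (HalfEdge d) → ℝ) × (Fin n × Fin n)

/-- The matching is uniform, the edge lengths are i.i.d. with law `ν`, the two vertices are
independent and uniform, and the three components are independent. -/
def sampleMeasure {n : ℕ} (d : Fin n → ℕ) (ν : Measure ℝ) : Measure (Sample d) :=
  (uniformOn Set.univ).prod ((Measure.pi fun _ => ν).prod (uniformOn Set.univ))

/-- `IsWalk σ u l v`: leaving successively through the half-edges in `l`, and arriving each time at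
the vertex of the matched half-edge, one gets from `u` to `v`. -/
def IsWalk {n : ℕ} {d : Fin n → ℕ} (σ : Pairing (HalfEdge d)) :
    Fin n → List (HalfEdge d) → Fin n → Prop
  | u, [], v => u = v
  | u, h :: l, v => h.1 = u ∧ IsWalk σ (σ.1 h).1 l v

/-- A path is a walk that visits no vertex twice. -/
def IsPath {n : ℕ} {d : Fin n → ℕ} (σ : Pairing (HalfEdge d))
    (u : Fin n) (l : List (HalfEdge d)) (v : Fin n) : Prop :=
  IsWalk σ u l v ∧ (u :: l.map fun h => (σ.1 h).1).Nodup

/-- The total length `∑_{e ∈ π} L_e` of the edges of a path. -/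
def pathWeight {n : ℕ} {d : Fin n → ℕ} (σ : Pairing (HalfEdge d))
    (L : Sym2 (HalfEdge d) → ℝ) (l : List (HalfEdge d)) : ℝ :=
  (l.map fun h => L s(h, σ.1 h)).sum

/-- The weighted distance `d_L(u, v)`; it is `⊤` if `u` and `v` are not connected. -/
def weightedDist {n : ℕ} {d : Fin n → ℕ} (σ : Pairing (HalfEdge d))
    (L : Sym2 (HalfEdge d) → ℝ) (u v : Fin n) : EReal :=
  ⨅ (l : List (HalfEdge d)) (_ : IsPath σ u l v), (pathWeight σ L l : EReal)

/-- The hopcount `d_H(u, v)`: the number of edges of a path realising `d_L(u, v)`, the smallest such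
number if there are several such paths, and `⊤` if there is none. -/
def hopcount {n : ℕ} {d : Fin n → ℕ} (σ : Pairing (HalfEdge d))
    (L : Sym2 (HalfEdge d) → ℝ) (u v : Fin n) : ℕ∞ :=
  ⨅ (l : List (HalfEdge d)) (_ : IsPath σ u l v)
    (_ : (pathWeight σ L l : EReal) = weightedDist σ L u v), (l.length : ℕ∞)

/-! ### The normalising sums -/

/-- The generalised inverse `F^{(-1)}(x) = inf {y : F(y) ≥ x}`. -/
def genInv (F : ℝ → ℝ) (x : ℝ) : ℝ := sInf {y : ℝ | x ≤ F y}

/-- `log log n / |log (τ - 2)|`. -/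
def logLogRatio (τ : ℝ) (n : ℕ) : ℝ := Real.log (Real.log n) / |Real.log (τ - 2)|

/-- `2 ∑_{i=1}^{⌊log log n / |log (τ-2)|⌋} F_L^{(-1)}(exp (-(1/(τ-2))^i))`, where `F_L` is the
distribution function of `ν`. -/
def normalizer (ν : Measure ℝ) (τ : ℝ) (n : ℕ) : ℝ :=
  2 * ∑ i ∈ Finset.Icc 1 ⌊logLogRatio τ n⌋₊,
    genInv (cdf ν) (Real.exp (-(1 / (τ - 2)) ^ i))

end ConfigModel

end

noncomputable section

namespace ConfigModel

/-! ### Uniform matchings and cylinders -/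

section Matching

set_option linter.unusedSectionVars false

variable {H : Type}

/-! Put s = τ - 2. A half-edge leads to a vertex of degree above y with probability about y^(-s), so
a vertex of degree y typically has a neighbour of degree about y^(1/s) and none of much larger
degree. Degrees along the best route therefore grow doubly exponentially and reach a power of n
after about log log n/|log s| steps. Both bounds explore the matching pair by pair: given the pairs
already known, the partner of a new half-edge is uniform among the remaining ones (`AvgLE.reveal`).
Lengths are handled for a fixed matching (`lengthProb`).

Lower bounds (`DegreeBounds.eventually_long`). Let β > 1/s and b_j = exp(Kβ^j) with K large. A
first-moment recursion shows that self-avoiding paths from u rarely meet a vertex of degree above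
b_j at step j (`avg_exits_le`). The paths that never do so use at most b_0⋯b_i edges at step i + 1,
so a union bound makes all those edges at least as long as a quantile of the form
F^(-1)(exp(-K'β^(i+1))). The same holds from v. For k about (1-ε) log log n/|log s| such paths reach
only n^(o(1)) vertices in 2k steps, so v is not among them. Hence each path from u to v has more
than 2k edges, and its first k and last k edges pay disjoint sums of quantiles (`long_of_isPath`).

Upper bounds (`DegreeBounds.eventually_short`). Let β < 1/s and Y_i = M^(β^i). A bounded number R of
steps from u, each of bounded length, finds a vertex of degree above M. A vertex of degree Y_i has
about Y_i^(1-qβ) edges to the next layer, where s < q < 1/β, so one of them is very likely shorter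
than F^(-1)(Y_i^(-ω₀)), where 2ω₀ = 1 - qβ. A union bound over all climbs keeps the failure
probability small (`avg_climbFail_le`). The climbs from u and v stop at degree n^α₁ with α₁ > 1/2,
where any two vertices are joined by an edge of bounded length.

Sums. Both bounds give sums of h(t) = F^(-1)(exp(-e^t)) along progressions whose step is close to
|log s|. As h is antitone, comparison with its integral changes them by a factor close to 1
(`sum_le_mul_sum_of_antitone`). Additive constants are negligible because the normalising sum
diverges, and this is the role of the divergence hypothesis.

Degrees. The tail bounds hold only below n^α; above that, the closeness to n-independent laws takes
over (`exists_sum_degree_tail_le`). -/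

instance [Finite H] : Finite (Pairing H) := by unfold Pairing; infer_instance

instance [Finite H] : Fintype (Pairing H) := Fintype.ofFinite _

variable [Fintype H] [DecidableEq H]

/-- The matchings that agree with `σ₀` on `S`. -/
def cyl (σ₀ : Pairing H) (S : Finset H) : Finset (Pairing H) :=
  Finset.univ.filter fun σ => ∀ h ∈ S, σ.1 h = σ₀.1 h

/-- The set `S` is a union of pairs of `σ₀`. -/
def ClosedUnder (σ₀ : Pairing H) (S : Finset H) : Prop := ∀ h ∈ S, σ₀.1 h ∈ S

/-- The average of `F` over the cylinder is at most `c`. -/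
def AvgLE (σ₀ : Pairing H) (S : Finset H) (F : Pairing H → ℝ) (c : ℝ) : Prop :=
  ∑ σ ∈ cyl σ₀ S, F σ ≤ c * (cyl σ₀ S).card

lemma mem_cyl {σ₀ σ : Pairing H} {S : Finset H} :
    σ ∈ cyl σ₀ S ↔ ∀ h ∈ S, σ.1 h = σ₀.1 h := by simp [cyl]

lemma Pairing.invol (σ : Pairing H) (h : H) : σ.1 (σ.1 h) = h := (σ.2 h).1
lemma Pairing.ne (σ : Pairing H) (h : H) : σ.1 h ≠ h := (σ.2 h).2

lemma AvgLE.mono {σ₀ : Pairing H} {S : Finset H} {F G : Pairing H → ℝ} {c c' : ℝ}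
    (hG : AvgLE σ₀ S G c) (hFG : ∀ σ ∈ cyl σ₀ S, F σ ≤ G σ) (hc : c ≤ c') : AvgLE σ₀ S F c' :=
  (Finset.sum_le_sum hFG).trans (hG.trans (by gcongr))

lemma AvgLE.add {σ₀ : Pairing H} {S : Finset H} {F G : Pairing H → ℝ} {c c' : ℝ}
    (hF : AvgLE σ₀ S F c) (hG : AvgLE σ₀ S G c') : AvgLE σ₀ S (fun σ => F σ + G σ) (c + c') := by
  unfold AvgLE at *
  rw [Finset.sum_add_distrib, add_mul]; exact add_le_add hF hG

lemma AvgLE.sum {ι : Type*} (s : Finset ι) {σ₀ : Pairing H} {S : Finset H}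
    {F : ι → Pairing H → ℝ} {c : ι → ℝ} (hF : ∀ i ∈ s, AvgLE σ₀ S (F i) (c i)) :
    AvgLE σ₀ S (fun σ => ∑ i ∈ s, F i σ) (∑ i ∈ s, c i) := by
  unfold AvgLE at *
  rw [Finset.sum_comm, Finset.sum_mul]; exact Finset.sum_le_sum hF

lemma AvgLE.const_of_le {σ₀ : Pairing H} {S : Finset H} {F : Pairing H → ℝ} {c : ℝ}
    (h : ∀ σ ∈ cyl σ₀ S, F σ ≤ c) : AvgLE σ₀ S F c := by
  unfold AvgLE
  calc _ ≤ ∑ σ ∈ cyl σ₀ S, c := Finset.sum_le_sum h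
    _ = _ := by simp [mul_comm]

/-- Conjugation of a matching by a transposition. -/
def Pairing.conj (σ : Pairing H) (a b : H) : Pairing H :=
  ⟨Equiv.swap a b * σ.1 * Equiv.swap a b, fun h => by
    simp only [Equiv.Perm.mul_apply, Equiv.swap_apply_self, σ.invol, true_and]
    intro hh
    have := congrArg (Equiv.swap a b) hh
    rw [Equiv.swap_apply_self] at this
    exact σ.ne _ this⟩

lemma Pairing.conj_apply (σ : Pairing H) (a b h : H) :
    (σ.conj a b).1 h = Equiv.swap a b (σ.1 (Equiv.swap a b h)) := rfl

lemma Pairing.conj_conj (σ : Pairing H) (a b : H) : (σ.conj a b).conj a b = σ := by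
  apply Subtype.ext; ext h; simp [Pairing.conj]

lemma closedUnder_of_mem {σ₀ σ : Pairing H} {S : Finset H} (hS : ClosedUnder σ₀ S)
    (hσ : σ ∈ cyl σ₀ S) : ClosedUnder σ S := fun h hh => by
  rw [mem_cyl.1 hσ h hh]; exact hS h hh

lemma cyl_eq_of_mem {σ₀ σ : Pairing H} {S : Finset H} (hσ : σ ∈ cyl σ₀ S) :
    cyl σ S = cyl σ₀ S := by
  ext ρ; simp only [mem_cyl] at *
  exact ⟨fun h x hx => (h x hx).trans (hσ x hx), fun h x hx => (h x hx).trans (hσ x hx).symm⟩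

lemma apply_not_mem {σ₀ σ : Pairing H} {S : Finset H} (hS : ClosedUnder σ₀ S)
    (hσ : σ ∈ cyl σ₀ S) {h : H} (hh : h ∉ S) : σ.1 h ∉ insert h S := by
  rw [Finset.mem_insert, not_or]
  refine ⟨σ.ne h, fun hm => hh ?_⟩
  have := closedUnder_of_mem hS hσ _ hm
  rwa [σ.invol] at this

/-- Conjugation by the transposition of `k` and `k'` carries one fibre injectively into the other.
It does not disturb the pairs in `S`: since `S` is closed, neither `k` nor `k'` is the partner of an
element of `S`. -/
lemma card_fiber_eq {σ₀ : Pairing H} {S : Finset H} (hS : ClosedUnder σ₀ S) {h k k' : H}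
    (hk : k ∉ insert h S) (hk' : k' ∉ insert h S) :
    ((cyl σ₀ S).filter fun σ => σ.1 h = k).card = ((cyl σ₀ S).filter fun σ => σ.1 h = k').card := by
  have key : ∀ a b : H, a ∉ insert h S → b ∉ insert h S → ∀ σ ∈ (cyl σ₀ S).filter fun σ => σ.1 h = a,
      σ.conj a b ∈ (cyl σ₀ S).filter fun σ => σ.1 h = b := by
    intro a b ha hb σ hσ
    simp only [Finset.mem_insert, not_or] at ha hb
    rw [Finset.mem_filter, mem_cyl] at hσ ⊢
    constructor
    · intro x hx
      have h1 : x ≠ a := fun e => ha.2 (e ▸ hx)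
      have h2 : x ≠ b := fun e => hb.2 (e ▸ hx)
      have h3 : σ₀.1 x ≠ a := fun e => ha.2 (e ▸ hS x hx)
      have h4 : σ₀.1 x ≠ b := fun e => hb.2 (e ▸ hS x hx)
      rw [Pairing.conj_apply, Equiv.swap_apply_of_ne_of_ne h1 h2, hσ.1 x hx,
        Equiv.swap_apply_of_ne_of_ne h3 h4]
    · rw [Pairing.conj_apply, Equiv.swap_apply_of_ne_of_ne (Ne.symm ha.1) (Ne.symm hb.1), hσ.2,
        Equiv.swap_apply_left]
  have key' : ∀ a b : H, a ∉ insert h S → b ∉ insert h S →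
      ((cyl σ₀ S).filter fun σ => σ.1 h = a).card ≤ ((cyl σ₀ S).filter fun σ => σ.1 h = b).card := by
    intro a b ha hb
    refine Finset.card_le_card_of_injOn (fun σ => σ.conj a b) (key a b ha hb) ?_
    intro σ _ ρ _ hh
    have := congrArg (fun σ => Pairing.conj σ a b) hh
    simpa only [Pairing.conj_conj] using this
  exact le_antisymm (key' k k' hk hk') (key' k' k hk' hk)

/-- Learning one more pair leads from a cylinder over a closed set to another one, so explorations
can be treated by induction. -/
lemma cyl_fiber {σ₀ σ₁ : Pairing H} {S : Finset H} {h k : H} (hS : ClosedUnder σ₀ S)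
    (hσ : σ₁ ∈ cyl σ₀ S) (hk : σ₁.1 h = k) :
    (cyl σ₀ S).filter (fun σ => σ.1 h = k) = cyl σ₁ (insert h (insert k S)) ∧
      ClosedUnder σ₁ (insert h (insert k S)) := by
  have hk' : σ₁.1 k = h := by rw [← hk, σ₁.invol]
  refine ⟨?_, ?_⟩
  · ext σ
    rw [Finset.mem_filter, ← cyl_eq_of_mem hσ, mem_cyl, mem_cyl]
    constructor
    · rintro ⟨h1, h2⟩ x hx
      simp only [Finset.mem_insert] at hx
      rcases hx with rfl | rfl | hx
      · rw [h2, hk]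
      · rw [hk', ← h2, σ.invol]
      · exact h1 x hx
    · intro h1
      exact ⟨fun x hx => h1 x (by simp [hx]), by rw [h1 h (by simp), hk]⟩
  · intro x hx
    simp only [Finset.mem_insert] at hx ⊢
    rcases hx with rfl | rfl | hx
    · right; left; exact hk
    · left; exact hk'
    · right; right; exact closedUnder_of_mem hS hσ x hx

lemma sum_cyl_eq {σ₀ : Pairing H} {S : Finset H} (hS : ClosedUnder σ₀ S) {h : H} (hh : h ∉ S)
    (F : Pairing H → ℝ) :
    ∑ σ ∈ cyl σ₀ S, F σ =
      ∑ k ∈ (insert h S)ᶜ, ∑ σ ∈ (cyl σ₀ S).filter fun σ => σ.1 h = k, F σ := by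
  rw [Finset.sum_fiberwise_of_maps_to]
  intro σ hσ
  rw [Finset.mem_compl]; exact apply_not_mem hS hσ hh

/-- All fibres have the same size, and there are as many of them as half-edges outside `S` other
than `h`. -/
lemma card_fiber_mul {σ₀ : Pairing H} {S : Finset H} (hS : ClosedUnder σ₀ S) {h k : H} (hh : h ∉ S)
    (hk : k ∉ insert h S) :
    ((Fintype.card H : ℝ) - S.card - 1) * ((cyl σ₀ S).filter fun σ => σ.1 h = k).card
      = (cyl σ₀ S).card := by
  have h1 := sum_cyl_eq hS hh (fun _ => (1 : ℝ))
  simp only [Finset.sum_const, nsmul_eq_mul, mul_one] at h1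
  rw [h1, Finset.sum_congr rfl (fun k' hk' => by
    rw [card_fiber_eq hS (Finset.mem_compl.1 hk') hk]), Finset.sum_const, nsmul_eq_mul,
    Finset.card_compl, Finset.card_insert_of_notMem hh, Nat.cast_sub, Nat.cast_add, Nat.cast_one]
  · ring
  · rw [← Finset.card_insert_of_notMem hh]; exact Finset.card_le_univ _

/-- Revealing the partner of `h`: it is uniform among the half-edges not yet matched. -/
lemma AvgLE.reveal {σ₀ : Pairing H} {S : Finset H} (hS : ClosedUnder σ₀ S) {h : H} (hh : h ∉ S)
    {F : Pairing H → ℝ} (g : H → ℝ)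
    (hg : ∀ k ∉ insert h S, ∀ σ₁ ∈ cyl σ₀ S, σ₁.1 h = k →
      ClosedUnder σ₁ (insert h (insert k S)) → AvgLE σ₁ (insert h (insert k S)) F (g k)) :
    AvgLE σ₀ S F ((∑ k ∈ (insert h S)ᶜ, g k) / ((Fintype.card H : ℝ) - S.card - 1)) := by
  unfold AvgLE
  have hpos : 0 < (Fintype.card H : ℝ) - S.card - 1 := by
    have : (insert (σ₀.1 h) (insert h S)).card ≤ Fintype.card H := Finset.card_le_univ _
    rw [Finset.card_insert_of_notMem (apply_not_mem hS (by simp [cyl]) hh),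
      Finset.card_insert_of_notMem hh] at this
    have : (S.card : ℝ) + 1 + 1 ≤ Fintype.card H := by exact_mod_cast this
    linarith
  rw [sum_cyl_eq hS hh, Finset.sum_div, Finset.sum_mul]
  refine Finset.sum_le_sum fun k hk => ?_
  rw [Finset.mem_compl] at hk
  have hc := card_fiber_mul hS hh hk
  rw [← hc, ← mul_assoc, div_mul_cancel₀ _ hpos.ne']
  rcases ((cyl σ₀ S).filter fun σ => σ.1 h = k).eq_empty_or_nonempty with he | ⟨σ₁, hσ₁⟩
  · simp [he]
  · rw [Finset.mem_filter] at hσ₁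
    obtain ⟨e, hcl⟩ := cyl_fiber hS hσ₁.1 hσ₁.2
    rw [e]
    exact hg k hk σ₁ hσ₁.1 hσ₁.2 hcl

/-- A bound on the average over all cylinders in which the partner of `h` is known carries over. -/
lemma AvgLE.refine {σ₀ : Pairing H} {S : Finset H} (hS : ClosedUnder σ₀ S) (h : H)
    {F : Pairing H → ℝ} {c : ℝ}
    (hg : ∀ (σ₁ : Pairing H) (S' : Finset H), ClosedUnder σ₁ S' → S'.card ≤ S.card + 2 → h ∈ S' →
      AvgLE σ₁ S' F c) : AvgLE σ₀ S F c := by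
  by_cases hh : h ∈ S
  · exact hg σ₀ S hS (by omega) hh
  · have hpos : 0 < (Fintype.card H : ℝ) - S.card - 1 := by
      have : (insert (σ₀.1 h) (insert h S)).card ≤ Fintype.card H := Finset.card_le_univ _
      rw [Finset.card_insert_of_notMem (apply_not_mem hS (by simp [cyl]) hh),
        Finset.card_insert_of_notMem hh] at this
      have : (S.card : ℝ) + 1 + 1 ≤ Fintype.card H := by exact_mod_cast this
      linarith
    have := AvgLE.reveal hS hh (F := F) (fun _ => c) (fun k hk σ₁ hσ₁ _ hcl => by
      refine hg σ₁ _ hcl ?_ (by simp)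
      refine (Finset.card_insert_le _ _).trans ?_
      have := Finset.card_insert_le k S
      omega)
    refine this.mono (fun _ _ => le_rfl) (le_of_eq ?_)
    rw [Finset.sum_const, nsmul_eq_mul, Finset.card_compl, Finset.card_insert_of_notMem hh,
      Nat.cast_sub (by rw [← Finset.card_insert_of_notMem hh]; exact Finset.card_le_univ _)]
    push_cast
    rw [← sub_sub]
    field_simp

end Matching

/-! ### Closed edges between two sets of half-edges -/

section Matching

set_option linter.unusedSectionVars false

variable {H : Type} [Fintype H] [DecidableEq H]

lemma card_add_one_lt {σ₀ : Pairing H} {S : Finset H} (hS : ClosedUnder σ₀ S) {h : H} (hh : h ∉ S) :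
    0 < (Fintype.card H : ℝ) - S.card - 1 := by
  have : (insert (σ₀.1 h) (insert h S)).card ≤ Fintype.card H := Finset.card_le_univ _
  rw [Finset.card_insert_of_notMem (apply_not_mem hS (by simp [cyl]) hh),
    Finset.card_insert_of_notMem hh] at this
  have : (S.card : ℝ) + 1 + 1 ≤ Fintype.card H := by exact_mod_cast this
  linarith

/-- The edges from half-edges in `A` to half-edges in `T`. -/
def edgesBetween (A T : Finset H) (σ : Pairing H) : Finset (Sym2 H) :=
  (A.filter fun a => σ.1 a ∈ T).image fun a => s(a, σ.1 a)

/-- Both ends of the revealed edge are removed, so an edge with two ends in `A` is not counted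
again. -/
lemma card_edgesBetween_erase_le (A T : Finset H) (σ : Pairing H) {a : H} (ha : a ∈ A) :
    (edgesBetween ((A.erase a).erase (σ.1 a)) T σ).card + (if σ.1 a ∈ T then 1 else 0)
      ≤ (edgesBetween A T σ).card := by
  have hsub : edgesBetween ((A.erase a).erase (σ.1 a)) T σ ⊆ edgesBetween A T σ := by
    apply Finset.image_subset_image
    apply Finset.filter_subset_filter
    exact (Finset.erase_subset _ _).trans (Finset.erase_subset _ _)
  split_ifs with hT
  · have hnot : s(a, σ.1 a) ∉ edgesBetween ((A.erase a).erase (σ.1 a)) T σ := by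
      intro hm
      simp only [edgesBetween, Finset.mem_image, Finset.mem_filter, Finset.mem_erase] at hm
      obtain ⟨b, ⟨⟨h1, h2, _⟩, _⟩, h3⟩ := hm
      rw [Sym2.eq_iff] at h3
      rcases h3 with h3 | h3
      · exact h2 h3.1
      · exact h1 h3.1
    rw [← Finset.card_insert_of_notMem hnot]
    apply Finset.card_le_card
    rw [Finset.insert_subset_iff]
    refine ⟨?_, hsub⟩
    exact Finset.mem_image.2 ⟨a, Finset.mem_filter.2 ⟨ha, hT⟩, rfl⟩
  · simpa using Finset.card_le_card hsub

/-- If each edge is closed with probability `r`, it is unlikely that all edges between two large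
sets of half-edges are closed. -/
lemma avg_pow_edgesBetween_le {r : ℝ} (hr0 : 0 ≤ r) (hr1 : r ≤ 1) (T : Finset H) (t : ℕ) :
    ∀ (m : ℕ) (σ₀ : Pairing H) (S A : Finset H), ClosedUnder σ₀ S → Disjoint A S →
      2 * m ≤ A.card → t + S.card + 2 * m ≤ T.card →
      AvgLE σ₀ S (fun σ => r ^ (edgesBetween A T σ).card)
        ((1 - (1 - r) * t / Fintype.card H) ^ m) := by
  intro m
  induction m with
  | zero =>
    intro σ₀ S A _ _ _ _
    exact AvgLE.const_of_le fun σ _ => by simpa using pow_le_one₀ hr0 hr1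
  | succ m ih =>
    intro σ₀ S A hS hAS hA hT
    obtain ⟨a, ha⟩ : A.Nonempty := Finset.card_pos.1 (by omega)
    have haS : a ∉ S := Finset.disjoint_left.1 hAS ha
    set c : ℝ := 1 - (1 - r) * t / Fintype.card H with hc
    have hpos := card_add_one_lt hS haS
    have hℓ : (0 : ℝ) < Fintype.card H := by
      have : (0 : ℝ) ≤ S.card := Nat.cast_nonneg _
      linarith
    have htℓ : (t : ℝ) ≤ Fintype.card H := by
      exact_mod_cast (by have := Finset.card_le_univ T; omega : t ≤ Fintype.card H)
    have hc0 : 0 ≤ c := by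
      rw [hc, sub_nonneg, div_le_one hℓ]
      nlinarith [Nat.cast_nonneg (α := ℝ) t]
    -- The edge at `a` contributes a factor `r` when it leads to `T`, and the induction hypothesis
    -- for the remaining half-edges contributes `c ^ m`. Each step uses up at most two elements of
    -- `A`, hence the condition `2 * m ≤ A.card`.
    refine (AvgLE.reveal hS haS (fun k => (if k ∈ T then r else 1) * c ^ m) ?_).mono
      (fun _ _ => le_rfl) ?_
    · intro k hk σ₁ hσ₁ hσk hcl
      have hS1 : (insert a (insert k S)).card ≤ S.card + 2 := by
        refine (Finset.card_insert_le _ _).trans ?_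
        have := Finset.card_insert_le k S
        omega
      have hA1 : A.card ≤ ((A.erase a).erase k).card + 2 := by
        have := Finset.pred_card_le_card_erase (s := A) (a := a)
        have := Finset.pred_card_le_card_erase (s := A.erase a) (a := k)
        omega
      have hI := ih σ₁ (insert a (insert k S)) ((A.erase a).erase k) hcl (by
        rw [Finset.disjoint_left]
        intro x hx
        simp only [Finset.mem_erase] at hx
        simp only [Finset.mem_insert, not_or]
        exact ⟨hx.2.1, hx.1, Finset.disjoint_left.1 hAS hx.2.2⟩) (by omega) (by omega)
      unfold AvgLE at hI ⊢
      have h0 : (0 : ℝ) ≤ if k ∈ T then r else 1 := by split_ifs <;> linarith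
      calc _ ≤ ∑ σ ∈ cyl σ₁ (insert a (insert k S)),
            (if k ∈ T then r else 1) * r ^ (edgesBetween ((A.erase a).erase k) T σ).card := by
            refine Finset.sum_le_sum fun σ hσ => ?_
            have hσa : σ.1 a = k := by rw [mem_cyl.1 hσ a (by simp), hσk]
            have := card_edgesBetween_erase_le A T σ ha
            rw [hσa] at this
            split_ifs at this ⊢ with hkT
            · rw [← pow_succ']; exact pow_le_pow_of_le_one hr0 hr1 this
            · rw [one_mul]; exact pow_le_pow_of_le_one hr0 hr1 this
        _ = (if k ∈ T then r else 1) * ∑ σ ∈ cyl σ₁ (insert a (insert k S)),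
            r ^ (edgesBetween ((A.erase a).erase k) T σ).card := by rw [Finset.mul_sum]
        _ ≤ _ := by rw [mul_assoc]; exact mul_le_mul_of_nonneg_left hI h0
    · rw [← Finset.sum_mul, pow_succ', div_eq_mul_inv, mul_right_comm]
      refine mul_le_mul_of_nonneg_right ?_ (pow_nonneg hc0 m)
      rw [← div_eq_mul_inv, div_le_iff₀ hpos]
      have h1 : ∑ k ∈ (insert a S)ᶜ, (if k ∈ T then r else 1) =
          ((insert a S)ᶜ.card : ℝ) - (1 - r) * (((insert a S)ᶜ.filter (· ∈ T)).card : ℝ) := by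
        have : ∀ k : H, (if k ∈ T then r else 1) = 1 - (1 - r) * (if k ∈ T then 1 else 0) := by
          intro k; split_ifs <;> ring
        rw [Finset.sum_congr rfl (fun k _ => this k), Finset.sum_sub_distrib, ← Finset.mul_sum,
          Finset.sum_boole]
        simp
      have h2 : ((insert a S)ᶜ.card : ℝ) = (Fintype.card H : ℝ) - S.card - 1 := by
        rw [Finset.card_compl, Finset.card_insert_of_notMem haS,
          Nat.cast_sub (by rw [← Finset.card_insert_of_notMem haS]; exact Finset.card_le_univ _)]
        push_cast; ring
      -- At most `S.card + 1` elements of `T` are already excluded, which the slack in the size of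
      -- `T` covers.
      have h3 : (t : ℝ) ≤ (((insert a S)ᶜ.filter (· ∈ T)).card : ℝ) := by
        have : T.card ≤ ((insert a S)ᶜ.filter (· ∈ T)).card + (insert a S).card := by
          rw [← Finset.card_union_of_disjoint]
          · apply Finset.card_le_card
            intro x hx
            by_cases hxs : x ∈ insert a S
            · exact Finset.mem_union_right _ hxs
            · exact Finset.mem_union_left _ (Finset.mem_filter.2 ⟨Finset.mem_compl.2 hxs, hx⟩)
          · rw [Finset.disjoint_left]
            intro x hx hx'
            exact (Finset.mem_compl.1 (Finset.mem_filter.1 hx).1) hx'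
        rw [Finset.card_insert_of_notMem haS] at this
        exact_mod_cast (by omega : t ≤ ((insert a S)ᶜ.filter (· ∈ T)).card)
      rw [h1, h2, hc, sub_mul, one_mul]
      have h4 : (1 - r) * t / Fintype.card H * ((Fintype.card H : ℝ) - S.card - 1) ≤
          (1 - r) * t := by
        rw [div_mul_eq_mul_div, div_le_iff₀ hℓ]
        have : (0 : ℝ) ≤ S.card := Nat.cast_nonneg _
        have h5 : 0 ≤ (1 - r) * t := mul_nonneg (by linarith) (Nat.cast_nonneg _)
        nlinarith
      nlinarith

end Matching

/-! ### Edge lengths and the generalised inverse -/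

lemma pi_real_forall_lt {ι : Type*} [Fintype ι] (ν : Measure ℝ) [IsProbabilityMeasure ν]
    (Q : Finset ι) (θ : ℝ) :
    (Measure.pi fun _ : ι => ν).real {L | ∀ e ∈ Q, θ < L e} = (1 - cdf ν θ) ^ Q.card := by
  classical
  have h1 : {L : ι → ℝ | ∀ e ∈ Q, θ < L e} =
      Set.univ.pi fun e => if e ∈ Q then Set.Ioi θ else Set.univ := by
    ext L
    simp only [Set.mem_ofPred_eq, Set.mem_pi, Set.mem_univ, true_implies]
    refine forall_congr' fun e => ?_
    split_ifs with h <;> simp [h]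
  have h2 : 1 - cdf ν θ = ν.real (Set.Ioi θ) := by
    rw [cdf_eq_real, ← Set.compl_Iic, probReal_compl_eq_one_sub measurableSet_Iic]
  rw [h1, measureReal_def, Measure.pi_pi, ENNReal.toReal_prod, h2]
  have : ∀ e : ι, (ν (if e ∈ Q then Set.Ioi θ else Set.univ)).toReal =
      if e ∈ Q then ν.real (Set.Ioi θ) else 1 := by
    intro e; split_ifs <;> simp [measureReal_def]
  simp_rw [this]
  rw [Finset.prod_ite_mem, Finset.univ_inter, Finset.prod_const]

lemma pi_real_eval {ι : Type*} [Fintype ι] (ν : Measure ℝ) [IsProbabilityMeasure ν]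
    (e : ι) {s : Set ℝ} (hs : MeasurableSet s) :
    (Measure.pi fun _ : ι => ν).real {L | L e ∈ s} = ν.real s := by
  rw [measureReal_def, measureReal_def]
  have := (measurePreserving_eval (fun _ : ι => ν) e).measure_preimage hs.nullMeasurableSet
  rw [← this]; rfl

section GenInv

set_option linter.unusedSectionVars false

variable (ν : Measure ℝ) [IsProbabilityMeasure ν]

lemma cdf_eq_zero_of_neg (hν : ∀ᵐ x ∂ν, 0 ≤ x) {y : ℝ} (hy : y < 0) : cdf ν y = 0 := by
  rw [cdf_eq_real, measureReal_def]
  have : ν (Set.Iic y) = 0 := by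
    refine measure_mono_null ?_ (ae_iff.1 hν)
    intro x hx
    simp only [Set.mem_ofPred_eq, not_le]; exact lt_of_le_of_lt hx hy
  simp [this]

lemma genInv_set_subset (hν : ∀ᵐ x ∂ν, 0 ≤ x) {x : ℝ} (hx : 0 < x) :
    ∀ y ∈ {y : ℝ | x ≤ cdf ν y}, 0 ≤ y := by
  intro y hy
  by_contra h
  have := cdf_eq_zero_of_neg ν hν (not_le.1 h)
  simp only [Set.mem_ofPred_eq] at hy; linarith

lemma genInv_set_nonempty {x : ℝ} (hx : x < 1) : {y : ℝ | x ≤ cdf ν y}.Nonempty := by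
  obtain ⟨y, hy⟩ := ((tendsto_cdf_atTop ν).eventually (lt_mem_nhds hx)).exists
  exact ⟨y, hy.le⟩

lemma genInv_nonneg (hν : ∀ᵐ x ∂ν, 0 ≤ x) {x : ℝ} (hx : 0 < x) : 0 ≤ genInv (cdf ν) x :=
  Real.sInf_nonneg (genInv_set_subset ν hν hx)

lemma genInv_mono (hν : ∀ᵐ x ∂ν, 0 ≤ x) {x y : ℝ} (hx : 0 < x) (hxy : x ≤ y) (hy : y < 1) :
    genInv (cdf ν) x ≤ genInv (cdf ν) y :=
  csInf_le_csInf ⟨0, fun z hz => genInv_set_subset ν hν hx z hz⟩ (genInv_set_nonempty ν hy)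
    fun _ hz => hxy.trans hz

/-- Right continuity of the distribution function makes the infimum that defines the quantile a
minimum. -/
lemma le_cdf_genInv (hν : ∀ᵐ x ∂ν, 0 ≤ x) {x : ℝ} (hx : 0 < x) (hx1 : x < 1) :
    x ≤ cdf ν (genInv (cdf ν) x) := by
  have hb : BddBelow {y : ℝ | x ≤ cdf ν y} := ⟨0, fun z hz => genInv_set_subset ν hν hx z hz⟩
  have h1 : ∀ z > genInv (cdf ν) x, x ≤ cdf ν z := by
    intro z hz
    obtain ⟨y, hy, hyz⟩ := (csInf_lt_iff hb (genInv_set_nonempty ν hx1)).1 hz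
    exact le_trans hy (monotone_cdf ν hyz.le)
  have h2 : Tendsto (cdf ν) (𝓝[>] (genInv (cdf ν) x)) (𝓝 (cdf ν (genInv (cdf ν) x))) :=
    ((cdf ν).right_continuous _).tendsto.mono_left (nhdsWithin_mono _ Set.Ioi_subset_Ici_self)
  exact ge_of_tendsto h2 (by filter_upwards [self_mem_nhdsWithin] with z hz using h1 z hz)

/-- The interval has to be open: with an atom at the quantile, the distribution function there may
exceed `x`. Below the quantile it is at most `x`, and the open half-line is an increasing union of
closed ones. -/
lemma real_Iio_genInv_le (hν : ∀ᵐ x ∂ν, 0 ≤ x) {x : ℝ} (hx : 0 < x) :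
    ν.real (Set.Iio (genInv (cdf ν) x)) ≤ x := by
  have hb : BddBelow {y : ℝ | x ≤ cdf ν y} := ⟨0, fun z hz => genInv_set_subset ν hν hx z hz⟩
  have h1 : ∀ y < genInv (cdf ν) x, cdf ν y ≤ x := fun y hy => by
    by_contra h
    exact absurd (csInf_le hb (not_le.1 h).le) (not_le.2 hy)
  set g := genInv (cdf ν) x
  have h2 : Tendsto (fun n : ℕ => ν (Set.Iic (g - 1 / ((n : ℝ) + 1)))) atTop
      (𝓝 (ν (⋃ n : ℕ, Set.Iic (g - 1 / ((n : ℝ) + 1))))) := by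
    apply tendsto_measure_iUnion_atTop
    intro n m hnm
    apply Set.Iic_subset_Iic.2
    have : 1 / ((m : ℝ) + 1) ≤ 1 / ((n : ℝ) + 1) := by gcongr
    linarith
  have h3 : (⋃ n : ℕ, Set.Iic (g - 1 / ((n : ℝ) + 1))) = Set.Iio g := by
    ext y
    simp only [Set.mem_iUnion, Set.mem_Iic, Set.mem_Iio]
    constructor
    · rintro ⟨n, hn⟩
      have : 0 < 1 / ((n : ℝ) + 1) := by positivity
      linarith
    · intro hy
      obtain ⟨n, hn⟩ := exists_nat_one_div_lt (sub_pos.2 hy)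
      exact ⟨n, by linarith⟩
  rw [h3] at h2
  have h4 : ν (Set.Iio g) ≤ ENNReal.ofReal x := by
    refine le_of_tendsto' h2 fun n => ?_
    rw [← ofReal_cdf]
    refine ENNReal.ofReal_le_ofReal (h1 _ ?_)
    have : 0 < 1 / ((n : ℝ) + 1) := by positivity
    linarith
  rw [measureReal_def]
  exact ENNReal.toReal_le_of_le_ofReal hx.le h4

end GenInv

/-! ### Half-edges of the configuration model -/

section Graph

set_option linter.unusedSectionVars false

variable {n : ℕ} {D : Fin n → ℕ}

/-- The half-edges at the vertices of `V`. -/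
def halfEdgesOf (D : Fin n → ℕ) (V : Finset (Fin n)) : Finset (HalfEdge D) :=
  V.sigma fun _ => Finset.univ

lemma mem_halfEdgesOf {V : Finset (Fin n)} {h : HalfEdge D} : h ∈ halfEdgesOf D V ↔ h.1 ∈ V := by
  simp [halfEdgesOf]

lemma card_halfEdgesOf (V : Finset (Fin n)) : (halfEdgesOf D V).card = ∑ v ∈ V, D v := by
  simp [halfEdgesOf]

lemma card_halfEdge : Fintype.card (HalfEdge D) = ∑ v, D v := by
  simp [HalfEdge]

/-- The probability of an event that concerns the edge lengths only. -/
def lengthProb (D : Fin n → ℕ) (ν : Measure ℝ) (E : Set (Sym2 (HalfEdge D) → ℝ)) : ℝ :=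
  (Measure.pi fun _ => ν).real E

variable (ν : Measure ℝ) [IsProbabilityMeasure ν]

lemma lengthProb_mono {E E' : Set (Sym2 (HalfEdge D) → ℝ)} (h : E ⊆ E') :
    lengthProb D ν E ≤ lengthProb D ν E' := measureReal_mono h

lemma lengthProb_nonneg (E : Set (Sym2 (HalfEdge D) → ℝ)) : 0 ≤ lengthProb D ν E :=
  measureReal_nonneg

lemma lengthProb_le_one (E : Set (Sym2 (HalfEdge D) → ℝ)) : lengthProb D ν E ≤ 1 :=
  measureReal_le_one

lemma lengthProb_union_le (E E' : Set (Sym2 (HalfEdge D) → ℝ)) :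
    lengthProb D ν (E ∪ E') ≤ lengthProb D ν E + lengthProb D ν E' := measureReal_union_le _ _

lemma lengthProb_or_le (p q : (Sym2 (HalfEdge D) → ℝ) → Prop) :
    lengthProb D ν {L | p L ∨ q L} ≤ lengthProb D ν {L | p L} + lengthProb D ν {L | q L} :=
  measureReal_union_le _ _

omit [IsProbabilityMeasure ν] in
lemma lengthProb_false : lengthProb D ν {_L | False} = 0 := by simp [lengthProb]

lemma lengthProb_exists_le {ι : Type*} (s : Finset ι) (p : ι → (Sym2 (HalfEdge D) → ℝ) → Prop) :
    lengthProb D ν {L | ∃ i ∈ s, p i L} ≤ ∑ i ∈ s, lengthProb D ν {L | p i L} := by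
  have : {L | ∃ i ∈ s, p i L} = ⋃ i ∈ s, {L | p i L} := by ext; simp
  rw [this]; exact measureReal_biUnion_finset_le _ _

lemma lengthProb_gt (e : Sym2 (HalfEdge D)) (W : ℝ) :
    lengthProb D ν {L | W < L e} = 1 - cdf ν W := by
  have := pi_real_forall_lt ν ({e} : Finset (Sym2 (HalfEdge D))) W
  simpa [lengthProb] using this

lemma lengthProb_lt (e : Sym2 (HalfEdge D)) (θ : ℝ) :
    lengthProb D ν {L | L e < θ} = ν.real (Set.Iio θ) :=
  pi_real_eval ν e (measurableSet_Iio (a := θ))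

/-! ### Climbing to vertices of large degree -/

/-- No edge from `x` to `V` has length at most `θ`. -/
def Stuck (V : Finset (Fin n)) (θ : ℝ) (σ : Pairing (HalfEdge D)) (L : Sym2 (HalfEdge D) → ℝ)
    (x : Fin n) : Prop :=
  ∀ a : HalfEdge D, a.1 = x → (σ.1 a).1 ∈ V → θ < L s(a, σ.1 a)

/-- Given the matching, the edges from `x` to `V` are independently longer than `θ`, so being stuck
has probability at most a power with their number (or more) as exponent; `avg_pow_edgesBetween_le`
averages it. -/
lemma avg_stuck_le {σ₀ : Pairing (HalfEdge D)} {S : Finset (HalfEdge D)} (hS : ClosedUnder σ₀ S)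
    (V : Finset (Fin n)) (θ : ℝ) (x : Fin n) (m t : ℕ) (hm : 2 * m + S.card ≤ D x)
    (ht : t + S.card + 2 * m ≤ ∑ v ∈ V, D v) :
    AvgLE σ₀ S (fun σ => lengthProb D ν {L | Stuck V θ σ L x})
      ((1 - cdf ν θ * t / ((∑ v, D v : ℕ) : ℝ)) ^ m) := by
  have h0 := cdf_nonneg ν θ
  have h1 := cdf_le_one ν θ
  have hA : 2 * m ≤ (halfEdgesOf D {x} \ S).card := by
    have h2 := Finset.le_card_sdiff S (halfEdgesOf D {x})
    rw [card_halfEdgesOf, Finset.sum_singleton] at h2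
    omega
  have := avg_pow_edgesBetween_le (r := 1 - cdf ν θ) (by linarith) (by linarith)
    (halfEdgesOf D V) t m σ₀ S (halfEdgesOf D {x} \ S) hS Finset.sdiff_disjoint hA
    (by rw [card_halfEdgesOf]; exact ht)
  rw [card_halfEdge, sub_sub_cancel] at this
  refine this.mono (fun σ _ => ?_) le_rfl
  rw [← pi_real_forall_lt]
  refine lengthProb_mono ν fun L hL e he => ?_
  simp only [edgesBetween, Finset.mem_image, Finset.mem_filter, Finset.mem_sdiff,
    mem_halfEdgesOf, Finset.mem_singleton] at he
  obtain ⟨a, ⟨⟨ha, _⟩, haV⟩, rfl⟩ := he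
  exact hL a ha haV

/-- Starting from `x` at level `i`, some climb along the vertex sets `V (i + 1), V (i + 2), …`
gets stuck within `m` steps. -/
def ClimbFail (V : ℕ → Finset (Fin n)) (θ : ℕ → ℝ) (σ : Pairing (HalfEdge D))
    (L : Sym2 (HalfEdge D) → ℝ) : ℕ → ℕ → Fin n → Prop
  | 0, _, _ => False
  | m + 1, i, x => Stuck (V (i + 1)) (θ i) σ L x ∨
      ∃ a : HalfEdge D, a.1 = x ∧ (σ.1 a).1 ∈ V (i + 1) ∧ ClimbFail V θ σ L m (i + 1) (σ.1 a).1

lemma exists_climb {V : ℕ → Finset (Fin n)} {θ : ℕ → ℝ} {σ : Pairing (HalfEdge D)}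
    {L : Sym2 (HalfEdge D) → ℝ} : ∀ (m i : ℕ) (x : Fin n), x ∈ V i → ¬ ClimbFail V θ σ L m i x →
      ∃ l w, IsWalk σ x l w ∧ w ∈ V (i + m) ∧ l.length = m ∧
        pathWeight σ L l ≤ ∑ j ∈ Finset.range m, θ (i + j) := by
  intro m
  induction m with
  | zero => intro i x hx _; exact ⟨[], x, rfl, hx, rfl, by simp [pathWeight]⟩
  | succ m ih =>
    intro i x _ hf
    simp only [ClimbFail, not_or, Stuck, not_forall, not_exists, not_and, not_lt] at hf
    obtain ⟨⟨a, ha, haV, haL⟩, h2⟩ := hf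
    obtain ⟨l, w, hl, hw, hlen, hwt⟩ := ih (i + 1) _ haV (h2 a ha haV)
    refine ⟨a :: l, w, ⟨ha, hl⟩, ?_, by simp [hlen], ?_⟩
    · rwa [show i + (m + 1) = i + 1 + m by ring]
    · rw [Finset.sum_range_succ', add_zero]
      simp only [pathWeight, List.map_cons, List.sum_cons] at hwt ⊢
      have : ∑ j ∈ Finset.range m, θ (i + (j + 1)) = ∑ j ∈ Finset.range m, θ (i + 1 + j) :=
        Finset.sum_congr rfl fun j _ => by rw [add_comm j 1, add_assoc]
      linarith

/-- Which edge a climb takes depends on the lengths. To avoid conditioning on them, failure is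
bounded over all edges into the next layer, short or long: at most `z i` edges, each followed by a
failure of average at most `g (i + 1)`. The loss `z i` is affordable because `g` decreases doubly
exponentially. Each step adds one pair to what is known, hence `s + 2 * i`. -/
lemma avg_climbFail_le {V : ℕ → Finset (Fin n)} {θ : ℕ → ℝ} {N s : ℕ} {g ε z : ℕ → ℝ}
    (hg : ∀ i, 0 ≤ g i) (hz : ∀ i < N, ∀ x ∈ V i, (D x : ℝ) ≤ z i)
    (hε : ∀ i < N, ∀ x ∈ V i, ∀ (σ₀ : Pairing (HalfEdge D)) (S : Finset (HalfEdge D)),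
      ClosedUnder σ₀ S → S.card ≤ s + 2 * i →
      AvgLE σ₀ S (fun σ => lengthProb D ν {L | Stuck (V (i + 1)) (θ i) σ L x}) (ε i))
    (hrec : ∀ i < N, ε i + z i * g (i + 1) ≤ g i) :
    ∀ (m i : ℕ) (x : Fin n) (σ₀ : Pairing (HalfEdge D)) (S : Finset (HalfEdge D)), x ∈ V i →
      i + m ≤ N → ClosedUnder σ₀ S → S.card ≤ s + 2 * i →
      AvgLE σ₀ S (fun σ => lengthProb D ν {L | ClimbFail V θ σ L m i x}) (g i) := by
  intro m
  induction m with
  | zero =>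
    intro i x σ₀ S _ _ _ _
    refine AvgLE.const_of_le fun σ _ => ?_
    simp only [ClimbFail]
    rw [lengthProb_false]; exact hg i
  | succ m ih =>
    intro i x σ₀ S hx him hS hs
    have h1 := hε i (by omega) x hx σ₀ S hS (by omega)
    have h2 : ∀ a ∈ halfEdgesOf D {x}, AvgLE σ₀ S (fun σ => lengthProb D ν
        {L | (σ.1 a).1 ∈ V (i + 1) ∧ ClimbFail V θ σ L m (i + 1) (σ.1 a).1}) (g (i + 1)) := by
      intro a _
      -- Once the partner of `a` is known, the next vertex of the climb is deterministic and the
      -- induction hypothesis applies.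
      refine AvgLE.refine hS a fun σ₁ S' hS' hcard ha => ?_
      by_cases hV : (σ₁.1 a).1 ∈ V (i + 1)
      · refine (ih (i + 1) (σ₁.1 a).1 σ₁ S' hV (by omega) hS' (by omega)).mono
          (fun σ hσ => ?_) le_rfl
        rw [mem_cyl.1 hσ a ha]
        exact lengthProb_mono ν fun L hL => hL.2
      · refine AvgLE.const_of_le fun σ hσ => ?_
        rw [mem_cyl.1 hσ a ha]
        refine le_trans (lengthProb_mono ν (E' := {_L | False}) fun L hL => hV hL.1) ?_
        rw [lengthProb_false]; exact hg _
    refine (h1.add (AvgLE.sum (halfEdgesOf D {x}) h2)).mono (fun σ _ => ?_) ?_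
    · refine (lengthProb_or_le ν _ _).trans ?_
      gcongr
      refine le_trans (lengthProb_mono ν ?_) (lengthProb_exists_le ν _ _)
      rintro L ⟨a, ha, h⟩
      exact ⟨a, by simp [mem_halfEdgesOf, ha], h⟩
    · rw [Finset.sum_const, nsmul_eq_mul, card_halfEdgesOf, Finset.sum_singleton]
      refine le_trans ?_ (hrec i (by omega))
      gcongr
      · exact hg _
      · exact hz i (by omega) x hx

/-! ### The first vertex of large degree -/

/-- The next half-edge at the same vertex, in cyclic order. -/
def nextHalfEdge (h : HalfEdge D) : HalfEdge D :=
  ⟨h.1, ⟨(h.2.1 + 1) % D h.1, Nat.mod_lt _ (Fin.pos h.2)⟩⟩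

lemma nextHalfEdge_injective : Function.Injective (nextHalfEdge (D := D)) := by
  rintro ⟨v, i, hi⟩ ⟨w, j, hj⟩ h
  simp only [nextHalfEdge, Sigma.mk.injEq] at h
  obtain ⟨rfl, h⟩ := h
  simp only [heq_eq_eq, Fin.mk.injEq] at h
  have : i = j := by
    have h' : i + 1 ≡ j + 1 [MOD D v] := h
    have := Nat.ModEq.add_right_cancel' 1 h'
    rwa [Nat.ModEq, Nat.mod_eq_of_lt hi, Nat.mod_eq_of_lt hj] at this
  subst this; rfl

lemma nextHalfEdge_ne (hD : ∀ v, 2 ≤ D v) (h : HalfEdge D) : nextHalfEdge h ≠ h := by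
  obtain ⟨v, i, hi⟩ := h
  intro h
  simp only [nextHalfEdge, Sigma.mk.injEq, heq_eq_eq, true_and, Fin.mk.injEq] at h
  have := hD v
  by_cases hc : i + 1 < D v
  · rw [Nat.mod_eq_of_lt hc] at h; omega
  · rw [show i + 1 = D v by omega, Nat.mod_self] at h; omega

/-- The walk that starts with `h` and always leaves through the next half-edge avoids `V` for `m`
steps. -/
def Avoids (V : Finset (Fin n)) (σ : Pairing (HalfEdge D)) : ℕ → HalfEdge D → Prop
  | 0, _ => True
  | m + 1, h => (σ.1 h).1 ∉ V ∧ Avoids V σ m (nextHalfEdge (σ.1 h))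

open Classical in
-- As long as the next half-edge is unmatched, each step enters `V` with probability at least `ρ`.
-- The number `c` bounds the probability that a step arrives where the next half-edge is already in
-- use; this is counted as a failure.
lemma avg_avoids_le (hD : ∀ v, 2 ≤ D v) (V : Finset (Fin n)) (s : ℕ) {ρ c : ℝ} (hρ0 : 0 ≤ ρ)
    (hρ1 : ρ ≤ 1) (hρ : ρ * ((∑ v, D v : ℕ) : ℝ) + s + 1 ≤ ((∑ v ∈ V, D v : ℕ) : ℝ))
    (hc : ((s : ℝ) + 1) ≤ c * (((∑ v, D v : ℕ) : ℝ) - s - 1)) (hc0 : 0 ≤ c) :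
    ∀ (m : ℕ) (h : HalfEdge D) (σ₀ : Pairing (HalfEdge D)) (S : Finset (HalfEdge D)), h ∉ S →
      ClosedUnder σ₀ S → S.card + 2 * m ≤ s →
      AvgLE σ₀ S (fun σ => if Avoids V σ m h then 1 else 0) ((1 - ρ) ^ m + m * c) := by
  intro m
  induction m with
  | zero =>
    intro h σ₀ S _ _ _
    refine AvgLE.const_of_le fun σ _ => ?_
    simp [Avoids]
  | succ m ih =>
    intro h σ₀ S hh hS hs
    have hN := card_add_one_lt hS hh
    set B : ℝ := (1 - ρ) ^ m + m * c with hB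
    have hB0 : 0 ≤ B := by
      have := pow_nonneg (sub_nonneg.2 hρ1) m
      positivity
    -- Three outcomes for the partner `k`: it lies in `V` and avoidance fails; it lies outside `V`
    -- with a fresh next half-edge, which costs `B`; or its next half-edge is already known, which
    -- costs at most 1 more.
    refine (AvgLE.reveal hS hh (fun k => (if k.1 ∈ V then 0 else B) +
      (if nextHalfEdge k ∈ insert h S then 1 else 0)) ?_).mono (fun _ _ => le_rfl) ?_
    · intro k hk σ₁ hσ₁ hσk hcl
      by_cases hkV : k.1 ∈ V
      · refine AvgLE.const_of_le fun σ hσ => ?_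
        have : σ.1 h = k := by rw [mem_cyl.1 hσ h (by simp), hσk]
        rw [if_neg (by simp [Avoids, this, hkV]), if_pos hkV]
        split_ifs <;> simp
      · by_cases hkS : nextHalfEdge k ∈ insert h S
        · refine AvgLE.const_of_le fun σ hσ => ?_
          rw [if_neg hkV, if_pos hkS]
          split_ifs <;> linarith
        · have := ih (nextHalfEdge k) σ₁ (insert h (insert k S)) (by
            simp only [Finset.mem_insert, not_or] at hkS ⊢
            exact ⟨hkS.1, nextHalfEdge_ne hD k, hkS.2⟩) hcl (by
            have h1 := Finset.card_insert_le h (insert k S)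
            have h2 := Finset.card_insert_le k S
            omega)
          refine this.mono (fun σ hσ => ?_) ?_
          · have e : σ.1 h = k := by rw [mem_cyl.1 hσ h (by simp), hσk]
            simp only [Avoids, e]
            split_ifs with h1 h2 <;> simp_all
          · rw [if_neg hkV, if_neg hkS, add_zero]
    · rw [div_le_iff₀ hN, Finset.sum_add_distrib]
      have hsS : (S.card : ℝ) ≤ s := by exact_mod_cast (by omega : S.card ≤ s)
      -- Injectivity of `nextHalfEdge` limits the bad partners to the number of known half-edges.
      have h1 : ∑ k ∈ (insert h S)ᶜ, (if nextHalfEdge k ∈ insert h S then (1 : ℝ) else 0) ≤ s + 1 := by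
        rw [Finset.sum_boole]
        have : ((insert h S)ᶜ.filter fun k => nextHalfEdge k ∈ insert h S).card ≤ (insert h S).card := by
          refine Finset.card_le_card_of_injOn nextHalfEdge ?_ nextHalfEdge_injective.injOn
          intro k hk
          exact (Finset.mem_filter.1 hk).2
        rw [Finset.card_insert_of_notMem hh] at this
        have h3 : (((insert h S)ᶜ.filter fun k => nextHalfEdge k ∈ insert h S).card : ℝ)
          ≤ S.card + 1 := by exact_mod_cast this
        linarith
      have h2 : ∑ k ∈ (insert h S)ᶜ, (if k.1 ∈ V then 0 else B) ≤
          (((∑ v, D v : ℕ) : ℝ) - ((∑ v ∈ V, D v : ℕ) : ℝ)) * B := by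
        rw [Finset.sum_ite, Finset.sum_const_zero, zero_add, Finset.sum_const, nsmul_eq_mul]
        refine mul_le_mul_of_nonneg_right ?_ hB0
        have : ((insert h S)ᶜ.filter fun k => k.1 ∉ V).card + (halfEdgesOf D V).card ≤
            Fintype.card (HalfEdge D) := by
          rw [← Finset.card_union_of_disjoint]
          · exact Finset.card_le_univ _
          · rw [Finset.disjoint_left]
            intro x hx hx'
            exact (Finset.mem_filter.1 hx).2 (mem_halfEdgesOf.1 hx')
        rw [card_halfEdgesOf, card_halfEdge] at this
        have h3 : ((((insert h S)ᶜ.filter fun k => k.1 ∉ V).card : ℝ) + ((∑ v ∈ V, D v : ℕ) : ℝ)) ≤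
          ((∑ v, D v : ℕ) : ℝ) := by exact_mod_cast this
        linarith
      rw [card_halfEdge] at hN ⊢
      set ℓ : ℝ := ((∑ v, D v : ℕ) : ℝ) with hℓ
      have h4 : (ℓ - ((∑ v ∈ V, D v : ℕ) : ℝ)) ≤ (1 - ρ) * (ℓ - S.card - 1) := by
        have : ρ * (S.card + 1) ≥ 0 := by positivity
        nlinarith
      have h5 : (s : ℝ) + 1 ≤ c * (ℓ - S.card - 1) := by
        refine hc.trans ?_
        gcongr
      have h6 := mul_le_mul_of_nonneg_right h4 hB0
      have h7 : (1 - ρ) * (ℓ - S.card - 1) * B ≤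
          ((1 - ρ) ^ (m + 1) + m * c) * (ℓ - S.card - 1) := by
        rw [mul_right_comm]
        refine mul_le_mul_of_nonneg_right ?_ hN.le
        rw [hB, mul_add, ← pow_succ']
        have : 0 ≤ ρ * (m * c) := by positivity
        nlinarith
      push_cast
      nlinarith

/-- The walk that always leaves through the next half-edge meets, within `m` steps, a vertex of
`V 0` from which a climb of `N` steps gets stuck. -/
def HitFail (V : ℕ → Finset (Fin n)) (θ : ℕ → ℝ) (N : ℕ) (σ : Pairing (HalfEdge D))
    (L : Sym2 (HalfEdge D) → ℝ) : ℕ → HalfEdge D → Prop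
  | 0, _ => False
  | m + 1, h => ((σ.1 h).1 ∈ V 0 ∧ ClimbFail V θ σ L N 0 (σ.1 h).1) ∨
      HitFail V θ N σ L m (nextHalfEdge (σ.1 h))

/-- The walk may meet `V 0` at any of its `m` steps, so failures of the climb are summed over the
steps. When the climb begins, at most `s` half-edges are known. -/
lemma avg_hitFail_le {V : ℕ → Finset (Fin n)} {θ : ℕ → ℝ} {N s : ℕ} {c : ℝ} (hc : 0 ≤ c)
    (hcl : ∀ (x : Fin n) (σ₀ : Pairing (HalfEdge D)) (S : Finset (HalfEdge D)), x ∈ V 0 →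
      ClosedUnder σ₀ S → S.card ≤ s →
      AvgLE σ₀ S (fun σ => lengthProb D ν {L | ClimbFail V θ σ L N 0 x}) c) :
    ∀ (m : ℕ) (h : HalfEdge D) (σ₀ : Pairing (HalfEdge D)) (S : Finset (HalfEdge D)),
      ClosedUnder σ₀ S → S.card + 2 * m ≤ s →
      AvgLE σ₀ S (fun σ => lengthProb D ν {L | HitFail V θ N σ L m h}) (m * c) := by
  intro m
  induction m with
  | zero =>
    intro h σ₀ S _ _
    refine AvgLE.const_of_le fun σ _ => ?_
    simp only [HitFail]
    rw [lengthProb_false]; simp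
  | succ m ih =>
    intro h σ₀ S hS hs
    refine AvgLE.refine hS h fun σ₁ S' hS' hcard hh => ?_
    have h1 : AvgLE σ₁ S' (fun σ => lengthProb D ν
        {L | (σ₁.1 h).1 ∈ V 0 ∧ ClimbFail V θ σ L N 0 (σ₁.1 h).1}) c := by
      by_cases hV : (σ₁.1 h).1 ∈ V 0
      · refine (hcl _ σ₁ S' hV hS' (by omega)).mono (fun σ _ => ?_) le_rfl
        exact lengthProb_mono ν fun L hL => hL.2
      · refine AvgLE.const_of_le fun σ _ => ?_
        refine le_trans (lengthProb_mono ν (E' := {_L | False}) fun L hL => hV hL.1) ?_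
        rw [lengthProb_false]; exact hc
    refine (h1.add (ih (nextHalfEdge (σ₁.1 h)) σ₁ S' hS' (by omega))).mono (fun σ hσ => ?_) ?_
    · simp only [HitFail, mem_cyl.1 hσ h hh]
      exact lengthProb_or_le ν _ _
    · push_cast; linarith

/-- One of the first `m` edges of the walk that always leaves through the next half-edge is longer
than `W`. -/
def Heavy (W : ℝ) (σ : Pairing (HalfEdge D)) (L : Sym2 (HalfEdge D) → ℝ) : ℕ → HalfEdge D → Prop
  | 0, _ => False
  | m + 1, h => W < L s(h, σ.1 h) ∨ Heavy W σ L m (nextHalfEdge (σ.1 h))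

/-- For a fixed matching the walk is deterministic; a union bound over its `m` edges needs neither
that they are distinct nor that they are independent. -/
lemma lengthProb_heavy_le (W : ℝ) (σ : Pairing (HalfEdge D)) : ∀ (m : ℕ) (h : HalfEdge D),
    lengthProb D ν {L | Heavy W σ L m h} ≤ m * (1 - cdf ν W) := by
  intro m
  induction m with
  | zero => intro h; simp only [Heavy]; rw [lengthProb_false]; simp
  | succ m ih =>
    intro h
    simp only [Heavy]
    refine (lengthProb_or_le ν _ _).trans ?_
    rw [lengthProb_gt]
    have := ih (nextHalfEdge (σ.1 h))
    push_cast; linarith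

lemma exists_walk_to_top {V : ℕ → Finset (Fin n)} {θ : ℕ → ℝ} {N : ℕ} {W : ℝ} (hW : 0 ≤ W)
    {σ : Pairing (HalfEdge D)} {L : Sym2 (HalfEdge D) → ℝ} : ∀ (m : ℕ) (h : HalfEdge D),
      ¬ Avoids (V 0) σ m h → ¬ HitFail V θ N σ L m h → ¬ Heavy W σ L m h →
      ∃ l w, IsWalk σ h.1 l w ∧ w ∈ V N ∧ l.length ≤ m + N ∧
        pathWeight σ L l ≤ m * W + ∑ j ∈ Finset.range N, θ j := by
  intro m
  induction m with
  | zero => intro h h1; simp [Avoids] at h1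
  | succ m ih =>
    intro h h1 h2 h3
    simp only [Heavy, not_or, not_lt] at h3
    simp only [HitFail, not_or, not_and] at h2
    by_cases hV : (σ.1 h).1 ∈ V 0
    · obtain ⟨l, w, hl, hw, hlen, hwt⟩ := exists_climb N 0 _ hV (h2.1 hV)
      refine ⟨h :: l, w, ⟨rfl, hl⟩, by simpa using hw, by simp only [List.length_cons]; omega, ?_⟩
      simp only [pathWeight, List.map_cons, List.sum_cons, zero_add] at hwt ⊢
      have : 0 ≤ (m : ℝ) * W := by positivity
      push_cast; linarith [h3.1]
    · obtain ⟨l, w, hl, hw, hlen, hwt⟩ := ih (nextHalfEdge (σ.1 h))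
        (fun h' => h1 ⟨hV, h'⟩) h2.2 h3.2
      refine ⟨h :: l, w, ⟨rfl, hl⟩, hw, by simp; omega, ?_⟩
      simp only [pathWeight, List.map_cons, List.sum_cons] at hwt ⊢
      push_cast; linarith [h3.1]

end Graph

/-! ### Walks and paths -/

section Walks

variable {n : ℕ} {D : Fin n → ℕ} {σ : Pairing (HalfEdge D)} {L : Sym2 (HalfEdge D) → ℝ}

lemma Pairing.apply_apply (σ : Pairing (HalfEdge D)) (h : HalfEdge D) : σ.1 (σ.1 h) = h := (σ.2 h).1

lemma isWalk_append {l₁ l₂ : List (HalfEdge D)} {u v : Fin n} :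
    IsWalk σ u (l₁ ++ l₂) v ↔ ∃ w, IsWalk σ u l₁ w ∧ IsWalk σ w l₂ v := by
  induction l₁ generalizing u with
  | nil => simp [IsWalk]
  | cons h t ih => simp [IsWalk, ih, and_assoc]

lemma pathWeight_append (l₁ l₂ : List (HalfEdge D)) :
    pathWeight σ L (l₁ ++ l₂) = pathWeight σ L l₁ + pathWeight σ L l₂ := by
  simp [pathWeight]

lemma pathWeight_cons (h : HalfEdge D) (l : List (HalfEdge D)) :
    pathWeight σ L (h :: l) = L s(h, σ.1 h) + pathWeight σ L l := by
  simp [pathWeight]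

lemma pathWeight_nonneg (hL : ∀ e, 0 ≤ L e) (l : List (HalfEdge D)) : 0 ≤ pathWeight σ L l := by
  induction l with
  | nil => simp [pathWeight]
  | cons h t ih => rw [pathWeight_cons]; exact add_nonneg (hL _) ih

/-- The reversed walk. -/
def revWalk (σ : Pairing (HalfEdge D)) (l : List (HalfEdge D)) : List (HalfEdge D) :=
  l.reverse.map σ.1

lemma revWalk_cons (h : HalfEdge D) (l : List (HalfEdge D)) :
    revWalk σ (h :: l) = revWalk σ l ++ [σ.1 h] := by simp [revWalk]

lemma revWalk_append (l₁ l₂ : List (HalfEdge D)) :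
    revWalk σ (l₁ ++ l₂) = revWalk σ l₂ ++ revWalk σ l₁ := by simp [revWalk]

lemma length_revWalk (l : List (HalfEdge D)) : (revWalk σ l).length = l.length := by simp [revWalk]

lemma isWalk_revWalk {l : List (HalfEdge D)} {u v : Fin n} (h : IsWalk σ u l v) :
    IsWalk σ v (revWalk σ l) u := by
  induction l generalizing u with
  | nil => simpa [IsWalk, revWalk, eq_comm] using h
  | cons a t ih =>
    rw [revWalk_cons, isWalk_append]
    exact ⟨_, ih h.2, rfl, by rw [σ.apply_apply]; exact h.1⟩

lemma pathWeight_revWalk (l : List (HalfEdge D)) :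
    pathWeight σ L (revWalk σ l) = pathWeight σ L l := by
  induction l with
  | nil => simp [revWalk]
  | cons a t ih =>
    rw [revWalk_cons, pathWeight_append, ih, pathWeight_cons, pathWeight_cons, σ.apply_apply,
      Sym2.eq_swap]
    simp [pathWeight, add_comm]

lemma vertices_revWalk {l : List (HalfEdge D)} {u v : Fin n} (h : IsWalk σ u l v) :
    v :: (revWalk σ l).map (fun h => (σ.1 h).1) = (u :: l.map fun h => (σ.1 h).1).reverse := by
  induction l generalizing u with
  | nil => simp only [IsWalk] at h; simp [revWalk, h]
  | cons a t ih =>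
    have := ih h.2
    rw [revWalk_cons, List.map_append, ← List.cons_append, this, List.map_cons,
      List.reverse_cons (a := u)]
    simp [σ.apply_apply, h.1]

lemma isPath_revWalk {l : List (HalfEdge D)} {u v : Fin n} (h : IsPath σ u l v) :
    IsPath σ v (revWalk σ l) u :=
  ⟨isWalk_revWalk h.1, by rw [vertices_revWalk h.1]; exact List.nodup_reverse.2 h.2⟩

lemma isPath_prefix {l₁ l₂ : List (HalfEdge D)} {u v : Fin n} (h : IsPath σ u (l₁ ++ l₂) v) :
    ∃ w, IsPath σ u l₁ w := by
  obtain ⟨w, hw, _⟩ := isWalk_append.1 h.1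
  refine ⟨w, hw, ?_⟩
  have := h.2
  rw [List.map_append, ← List.cons_append] at this
  exact this.of_append_left

lemma exists_isPath_suffix {l : List (HalfEdge D)} {x u v : Fin n} (hL : ∀ e, 0 ≤ L e)
    (h : IsPath σ x l v) (hu : u ∈ x :: l.map fun h => (σ.1 h).1) :
    ∃ l', IsPath σ u l' v ∧ l'.length ≤ l.length ∧ pathWeight σ L l' ≤ pathWeight σ L l := by
  induction l generalizing x with
  | nil =>
    simp only [List.map_nil, List.mem_singleton] at hu
    exact ⟨[], hu ▸ h, le_rfl, le_rfl⟩
  | cons a t ih =>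
    rw [List.mem_cons] at hu
    rcases hu with rfl | hu
    · exact ⟨a :: t, h, le_rfl, le_rfl⟩
    · have h2 := h.2
      rw [List.map_cons, List.nodup_cons] at h2
      obtain ⟨l', h3, h4, h5⟩ := ih ⟨h.1.2, h2.2⟩ (by simpa using hu)
      refine ⟨l', h3, by simp only [List.length_cons]; omega, ?_⟩
      rw [pathWeight_cons]; linarith [hL s(a, σ.1 a)]

/-- Loop erasure. -/
lemma exists_isPath_of_isWalk (hL : ∀ e, 0 ≤ L e) {l : List (HalfEdge D)} {u v : Fin n}
    (h : IsWalk σ u l v) :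
    ∃ l', IsPath σ u l' v ∧ l'.length ≤ l.length ∧ pathWeight σ L l' ≤ pathWeight σ L l := by
  induction l generalizing u with
  | nil => exact ⟨[], ⟨h, by simp⟩, le_rfl, le_rfl⟩
  | cons a t ih =>
    obtain ⟨l', h1, h2, h3⟩ := ih h.2
    by_cases hu : u ∈ (σ.1 a).1 :: l'.map fun h => (σ.1 h).1
    · obtain ⟨l'', h4, h5, h6⟩ := exists_isPath_suffix hL h1 hu
      refine ⟨l'', h4, by simp only [List.length_cons]; omega, ?_⟩
      rw [pathWeight_cons]; linarith [hL s(a, σ.1 a)]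
    · refine ⟨a :: l', ⟨⟨h.1, h1.1⟩, ?_⟩, by simpa using h2, ?_⟩
      · rw [List.map_cons, List.nodup_cons]; exact ⟨hu, h1.2⟩
      · rw [pathWeight_cons, pathWeight_cons]; linarith

/-- Serves to recognise the vertices of a second half of a path among those met by the reversed
walk. -/
lemma target_eq_or {l : List (HalfEdge D)} {u v : Fin n} (h : IsWalk σ u l v) :
    ∀ a ∈ l, (σ.1 a).1 = v ∨ ∃ b ∈ l, b.1 = (σ.1 a).1 := by
  induction l generalizing u with
  | nil => simp
  | cons c t ih =>
    intro a ha
    rw [List.mem_cons] at ha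
    rcases ha with rfl | ha
    · cases t with
      | nil => left; exact h.2
      | cons b t => right; exact ⟨b, by simp, h.2.1⟩
    · rcases ih h.2 a ha with h1 | ⟨b, hb, h1⟩
      · exact Or.inl h1
      · exact Or.inr ⟨b, by simp [hb], h1⟩

end Walks

/-! ### Paths that leave the typical neighbourhood -/

section Lower

variable {n : ℕ} {D : Fin n → ℕ}

/-- A path of at most `m` further steps from `x` outside of `U` meets, at some step `i`, a vertex of
degree larger than `b i`. -/
def Exits (b : ℕ → ℝ) (σ : Pairing (HalfEdge D)) : ℕ → ℕ → Finset (Fin n) → Fin n → Prop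
  | 0, _, _, _ => False
  | m + 1, j, U, x => ∃ h : HalfEdge D, h.1 = x ∧ (σ.1 h).1 ∉ U ∧
      (b (j + 1) < D (σ.1 h).1 ∨ Exits b σ m (j + 1) (insert (σ.1 h).1 U) (σ.1 h).1)

open Classical in
-- First moment along self-avoiding paths. The partner of a half-edge at level `j` is either at a
-- vertex above the next threshold, which is the first sum in `hrec`, or at a vertex of degree `D`,
-- from which exit has average at most `D * (ρ / b (j + 1))`; size-biasing turns this factor `D`
-- into the sum of squares.
lemma avg_exits_le {b : ℕ → ℝ} {ρ : ℝ} {s k : ℕ} (hρ : 0 ≤ ρ) (hb : ∀ j, 0 < b j)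
    (hrec : ∀ j < k, ((∑ v ∈ Finset.univ.filter (fun v => b (j + 1) < D v), (D v : ℝ)) +
      ρ / b (j + 1) * ∑ v ∈ Finset.univ.filter (fun v => (D v : ℝ) ≤ b (j + 1)), (D v : ℝ) ^ 2)
        ≤ ρ / b j * (((∑ v, D v : ℕ) : ℝ) - s - 1)) :
    ∀ (m j : ℕ) (U : Finset (Fin n)) (x : Fin n) (σ₀ : Pairing (HalfEdge D))
      (S : Finset (HalfEdge D)), ClosedUnder σ₀ S → (∀ h ∈ S, h.1 ∈ U) → x ∈ U → j + m ≤ k →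
      S.card + 2 * m ≤ s →
      AvgLE σ₀ S (fun σ => if Exits b σ m j U x then 1 else 0) (D x * (ρ / b j)) := by
  intro m
  induction m with
  | zero =>
    intro j U x σ₀ S _ _ _ _ _
    refine AvgLE.const_of_le fun σ _ => ?_
    rw [if_neg (by simp [Exits])]
    have := hb j
    positivity
  | succ m ih =>
    intro j U x σ₀ S hS hSU hxU hjm hsm
    have hbj := hb j
    have hbj1 := hb (j + 1)
    set q : HalfEdge D → Pairing (HalfEdge D) → Prop := fun h σ => (σ.1 h).1 ∉ U ∧
      (b (j + 1) < D (σ.1 h).1 ∨ Exits b σ m (j + 1) (insert (σ.1 h).1 U) (σ.1 h).1) with hq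
    have h1 : ∀ h ∈ halfEdgesOf D {x}, AvgLE σ₀ S (fun σ => if q h σ then 1 else 0) (ρ / b j) := by
      intro h _
      -- A known half-edge leads back to `U`, since every known half-edge sits at a vertex of `U`; a
      -- self-avoiding path cannot use it. Hence only fresh, uniformly matched half-edges count.
      by_cases hh : h ∈ S
      · refine AvgLE.const_of_le fun σ hσ => ?_
        rw [if_neg]
        · positivity
        · rintro ⟨h2, _⟩
          exact h2 (hSU _ (by rw [mem_cyl.1 hσ h hh]; exact hS h hh))
      · have hN := card_add_one_lt hS hh
        have hsS : (S.card : ℝ) ≤ s := by exact_mod_cast (by omega : S.card ≤ s)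
        refine (AvgLE.reveal hS hh
          (fun k => if b (j + 1) < D k.1 then 1 else D k.1 * (ρ / b (j + 1))) ?_).mono
          (fun _ _ => le_rfl) ?_
        · intro k hk σ₁ hσ₁ hσk hcl
          have e : ∀ σ ∈ cyl σ₁ (insert h (insert k S)), σ.1 h = k := fun σ hσ => by
            rw [mem_cyl.1 hσ h (by simp), hσk]
          have hg0 : (0 : ℝ) ≤ if b (j + 1) < D k.1 then 1 else D k.1 * (ρ / b (j + 1)) := by
            split_ifs <;> positivity
          by_cases hkU : k.1 ∈ U
          · refine AvgLE.const_of_le fun σ hσ => ?_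
            rw [if_neg]
            · exact hg0
            · rintro ⟨h2, _⟩
              rw [e σ hσ] at h2; exact h2 hkU
          · by_cases hkb : b (j + 1) < D k.1
            · refine AvgLE.const_of_le fun σ hσ => ?_
              rw [if_pos hkb]; split_ifs <;> norm_num
            · rw [if_neg hkb]
              have hhx : h.1 = x := by
                have : h ∈ halfEdgesOf D {x} := by assumption
                simpa [mem_halfEdgesOf] using this
              refine (ih (j + 1) (insert k.1 U) k.1 σ₁ (insert h (insert k S)) hcl ?_ (by simp)
                (by omega) ?_).mono (fun σ hσ => ?_) le_rfl
              · intro y hy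
                simp only [Finset.mem_insert] at hy ⊢
                rcases hy with rfl | rfl | hy
                · right; rw [hhx]; exact hxU
                · left; rfl
                · right; exact hSU y hy
              · have h1 := Finset.card_insert_le h (insert k S)
                have h2 := Finset.card_insert_le k S
                omega
              · have hqi : q h σ → Exits b σ m (j + 1) (insert k.1 U) k.1 := by
                  rintro ⟨_, h3⟩
                  rw [e σ hσ] at h3
                  exact h3.resolve_left hkb
                split_ifs with h4 h5 h5
                · exact le_rfl
                · exact absurd (hqi h4) h5
                · norm_num
                · exact le_rfl
        · rw [div_le_iff₀ hN, card_halfEdge]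
          have h2 : ∑ k ∈ (insert h S)ᶜ, (if b (j + 1) < D k.1 then 1 else D k.1 * (ρ / b (j + 1)))
              ≤ ∑ k : HalfEdge D, (if b (j + 1) < D k.1 then 1 else D k.1 * (ρ / b (j + 1))) := by
            refine Finset.sum_le_sum_of_subset_of_nonneg (Finset.subset_univ _) fun k _ _ => ?_
            split_ifs <;> positivity
          have h3 : ∑ k : HalfEdge D, (if b (j + 1) < D k.1 then 1 else D k.1 * (ρ / b (j + 1))) =
              (∑ v ∈ Finset.univ.filter (fun v => b (j + 1) < D v), (D v : ℝ)) +
              ρ / b (j + 1) * ∑ v ∈ Finset.univ.filter (fun v => (D v : ℝ) ≤ b (j + 1)),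
                (D v : ℝ) ^ 2 := by
            rw [Fintype.sum_sigma]
            simp only [Finset.sum_const, Finset.card_univ, Fintype.card_fin, nsmul_eq_mul]
            rw [Finset.mul_sum, Finset.sum_filter, Finset.sum_filter, ← Finset.sum_add_distrib]
            refine Finset.sum_congr rfl fun v _ => ?_
            by_cases hv : b (j + 1) < D v
            · rw [if_pos hv, if_pos hv, if_neg (not_le.2 hv)]; ring
            · rw [if_neg hv, if_neg hv, if_pos (not_lt.1 hv)]; ring
          refine (h2.trans_eq h3).trans ((hrec j (by omega)).trans ?_)
          have : 0 ≤ ρ / b j := by positivity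
          gcongr
    refine (AvgLE.sum (halfEdgesOf D {x}) h1).mono (fun σ _ => ?_) ?_
    · split_ifs with hE
      · obtain ⟨h, hx, hE⟩ := hE
        have h2 : (1 : ℝ) = if q h σ then 1 else 0 := by rw [if_pos hE]
        have hm : h ∈ halfEdgesOf D {x} := by simp [mem_halfEdgesOf, hx]
        refine h2.le.trans
          (Finset.single_le_sum (f := fun h => if q h σ then (1 : ℝ) else 0) (fun i _ => ?_) hm)
        split_ifs <;> norm_num
      · exact Finset.sum_nonneg fun i _ => by split_ifs <;> norm_num
    · rw [Finset.sum_const, nsmul_eq_mul, card_halfEdgesOf, Finset.sum_singleton]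

variable (ν : Measure ℝ) [IsProbabilityMeasure ν]

/-- Among the walks of at most `m` further steps from `x`, with degrees bounded by `b`, one has an
edge at some step `i` of length less than `θ i`. -/
def HasShortEdge (b θ : ℕ → ℝ) (σ : Pairing (HalfEdge D)) (L : Sym2 (HalfEdge D) → ℝ) :
    ℕ → ℕ → Fin n → Prop
  | 0, _, _ => False
  | m + 1, i, x => ∃ h : HalfEdge D, h.1 = x ∧ (L s(h, σ.1 h) < θ (i + 1) ∨
      ((D (σ.1 h).1 : ℝ) ≤ b (i + 1) ∧ HasShortEdge b θ σ L m (i + 1) (σ.1 h).1))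

/-- The degree bounds limit the branching at step `i` to `b i`, so this union bound holds for every
matching, without averaging. -/
lemma lengthProb_hasShortEdge_le {b θ g : ℕ → ℝ} {k : ℕ} (σ : Pairing (HalfEdge D))
    (hg : ∀ i, 0 ≤ g i)
    (hrec : ∀ i < k, b i * (ν.real (Set.Iio (θ (i + 1))) + g (i + 1)) ≤ g i) :
    ∀ (m i : ℕ) (x : Fin n), i + m ≤ k → (D x : ℝ) ≤ b i →
      lengthProb D ν {L | HasShortEdge b θ σ L m i x} ≤ g i := by
  intro m
  induction m with
  | zero => intro i x _ _; simp only [HasShortEdge]; rw [lengthProb_false]; exact hg i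
  | succ m ih =>
    intro i x him hx
    have h1 : {L | HasShortEdge b θ σ L (m + 1) i x} ⊆ {L | ∃ h ∈ halfEdgesOf D {x},
        (L s(h, σ.1 h) < θ (i + 1) ∨
      ((D (σ.1 h).1 : ℝ) ≤ b (i + 1) ∧ HasShortEdge b θ σ L m (i + 1) (σ.1 h).1))} := by
      rintro L ⟨h, hx, hh⟩
      exact ⟨h, by simp [mem_halfEdgesOf, hx], hh⟩
    refine (lengthProb_mono ν h1).trans ((lengthProb_exists_le ν _ _).trans ?_)
    refine le_trans (Finset.sum_le_sum (g := fun _ => ν.real (Set.Iio (θ (i + 1))) + g (i + 1))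
      fun h _ => ?_) ?_
    · refine (lengthProb_or_le ν _ _).trans ?_
      rw [lengthProb_lt]
      gcongr
      by_cases hb : (D (σ.1 h).1 : ℝ) ≤ b (i + 1)
      · exact (lengthProb_mono ν fun L hL => hL.2).trans (ih (i + 1) _ (by omega) hb)
      · refine le_trans (lengthProb_mono ν (E' := {_L | False}) fun L hL => hb hL.1) ?_
        rw [lengthProb_false]; exact hg _
    · rw [Finset.sum_const, nsmul_eq_mul, card_halfEdgesOf, Finset.sum_singleton]
      refine le_trans ?_ (hrec i (by omega))
      have := hg (i + 1)
      have : 0 ≤ ν.real (Set.Iio (θ (i + 1))) := measureReal_nonneg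
      gcongr

/-- The absence of exits supplies the degree bounds under which the absence of short edges says
something about this path. -/
lemma sum_le_pathWeight {b θ : ℕ → ℝ} {σ : Pairing (HalfEdge D)} {L : Sym2 (HalfEdge D) → ℝ} :
    ∀ (l : List (HalfEdge D)) (m j : ℕ) (U : Finset (Fin n)) (x w : Fin n), x ∈ U →
      IsWalk σ x l w → (l.map fun h => (σ.1 h).1).Nodup → (∀ h ∈ l, (σ.1 h).1 ∉ U) →
      l.length ≤ m → ¬ Exits b σ m j U x → ¬ HasShortEdge b θ σ L m j x →
      ∑ i ∈ Finset.range l.length, θ (j + i + 1) ≤ pathWeight σ L l := by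
  intro l
  induction l with
  | nil => intros; simp [pathWeight]
  | cons h t ih =>
    intro m j U x w hx hw hnd hU hlen hE hS
    obtain ⟨m, rfl⟩ : ∃ m', m = m' + 1 := ⟨m - 1, by simp only [List.length_cons] at hlen; omega⟩
    simp only [Exits, HasShortEdge, not_exists, not_and, not_or, not_lt] at hE hS
    have h1 := hE h hw.1 (hU h (by simp))
    have h2 := hS h hw.1
    rw [List.map_cons, List.nodup_cons] at hnd
    have := ih m (j + 1) (insert (σ.1 h).1 U) (σ.1 h).1 w (by simp) hw.2 hnd.2 (by
      intro a ha
      rw [Finset.mem_insert, not_or]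
      refine ⟨fun e => hnd.1 ?_, hU a (by simp [ha])⟩
      rw [← e]; exact List.mem_map_of_mem (f := fun h => (σ.1 h).1) ha) (by simpa using hlen) h1.2 (h2.2 h1.1)
    rw [List.length_cons, Finset.sum_range_succ', pathWeight_cons, add_zero]
    have e : ∑ i ∈ Finset.range t.length, θ (j + (i + 1) + 1) =
        ∑ i ∈ Finset.range t.length, θ (j + 1 + i + 1) :=
      Finset.sum_congr rfl fun i _ => by rw [add_comm i 1, add_assoc j 1 i]
    rw [e]; linarith [h2.1]

lemma degree_le_of_not_exits {b : ℕ → ℝ} {σ : Pairing (HalfEdge D)} {B : ℝ} {k : ℕ}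
    (hB : ∀ j ≤ k, b j ≤ B) :
    ∀ (l : List (HalfEdge D)) (m j : ℕ) (U : Finset (Fin n)) (x w : Fin n), x ∈ U →
      IsWalk σ x l w → (l.map fun h => (σ.1 h).1).Nodup → (∀ h ∈ l, (σ.1 h).1 ∉ U) →
      l.length ≤ m → j + m ≤ k → ¬ Exits b σ m j U x → ∀ h ∈ l, (D (σ.1 h).1 : ℝ) ≤ B := by
  intro l
  induction l with
  | nil => intros; simp_all
  | cons h t ih =>
    intro m j U x w hx hw hnd hU hlen hjm hE
    obtain ⟨m, rfl⟩ : ∃ m', m = m' + 1 := ⟨m - 1, by simp only [List.length_cons] at hlen; omega⟩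
    simp only [Exits, not_exists, not_and, not_or, not_lt] at hE
    have h1 := hE h hw.1 (hU h (by simp))
    rw [List.map_cons, List.nodup_cons] at hnd
    have := ih m (j + 1) (insert (σ.1 h).1 U) (σ.1 h).1 w (by simp) hw.2 hnd.2 (by
      intro a ha
      rw [Finset.mem_insert, not_or]
      refine ⟨fun e => hnd.1 ?_, hU a (by simp [ha])⟩
      rw [← e]; exact List.mem_map_of_mem (f := fun h => (σ.1 h).1) ha) (by simpa using hlen)
      (by omega) h1.2
    intro a ha
    rw [List.mem_cons] at ha
    rcases ha with rfl | ha
    · exact h1.1.trans (hB _ (by omega))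
    · exact this a ha

open Classical in
/-- The end vertices of the walks from `x` of at most `m` steps through vertices of degree at
most `B`. -/
def reach (B : ℝ) (σ : Pairing (HalfEdge D)) : ℕ → Fin n → Finset (Fin n)
  | 0, x => {x}
  | m + 1, x => insert x ((halfEdgesOf D {x}).biUnion fun h =>
      if (D (σ.1 h).1 : ℝ) ≤ B then reach B σ m (σ.1 h).1 else ∅)

lemma mem_reach {B : ℝ} {σ : Pairing (HalfEdge D)} : ∀ (l : List (HalfEdge D)) (m : ℕ) (x w : Fin n),
    IsWalk σ x l w → l.length ≤ m → (∀ h ∈ l, (D (σ.1 h).1 : ℝ) ≤ B) → w ∈ reach B σ m x := by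
  intro l
  induction l with
  | nil =>
    intro m x w hw _ _
    simp only [IsWalk] at hw
    subst hw
    cases m <;> simp [reach]
  | cons h t ih =>
    intro m x w hw hlen hB
    obtain ⟨m, rfl⟩ : ∃ m', m = m' + 1 := ⟨m - 1, by simp only [List.length_cons] at hlen; omega⟩
    simp only [reach, Finset.mem_insert, Finset.mem_biUnion]
    refine Or.inr ⟨h, by simp [mem_halfEdgesOf, hw.1], ?_⟩
    rw [if_pos (hB h (by simp))]
    exact ih m _ w hw.2 (by simpa using hlen) fun a ha => hB a (by simp [ha])

lemma card_reach_le {B : ℝ} (hB : 0 ≤ B) (σ : Pairing (HalfEdge D)) : ∀ (m : ℕ) (x : Fin n),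
    (D x : ℝ) ≤ B → ((reach B σ m x).card : ℝ) ≤ (1 + B) ^ m := by
  intro m
  induction m with
  | zero => intro x _; simp [reach]
  | succ m ih =>
    intro x hx
    have h1 : (reach B σ (m + 1) x).card ≤ (∑ h ∈ halfEdgesOf D {x},
        (if (D (σ.1 h).1 : ℝ) ≤ B then reach B σ m (σ.1 h).1 else ∅).card) + 1 :=
      (Finset.card_insert_le _ _).trans (by gcongr; exact Finset.card_biUnion_le)
    have h2 : ((∑ h ∈ halfEdgesOf D {x},
        (if (D (σ.1 h).1 : ℝ) ≤ B then reach B σ m (σ.1 h).1 else ∅).card : ℕ) : ℝ) ≤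
        ∑ _h ∈ halfEdgesOf D {x}, (1 + B) ^ m := by
      push_cast
      refine Finset.sum_le_sum fun h _ => ?_
      split_ifs with hb
      · exact ih _ hb
      · simp only [Finset.card_empty, Nat.cast_zero]; positivity
    rw [Finset.sum_const, nsmul_eq_mul, card_halfEdgesOf, Finset.sum_singleton] at h2
    have h3 : ((reach B σ (m + 1) x).card : ℝ) ≤ D x * (1 + B) ^ m + 1 := by
      refine le_trans (by exact_mod_cast h1) (add_le_add_left h2 1)
    have h4 : (1 : ℝ) ≤ (1 + B) ^ m := one_le_pow₀ (by linarith)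
    have h5 : D x * (1 + B) ^ m ≤ B * (1 + B) ^ m := by gcongr
    rw [pow_succ]; linarith

/-- The deterministic core of the lower bounds. -/
lemma long_of_isPath {b θ : ℕ → ℝ} {σ : Pairing (HalfEdge D)} {L : Sym2 (HalfEdge D) → ℝ} {B : ℝ}
    {k : ℕ} {u v : Fin n} (hL : ∀ e, 0 ≤ L e) (hB : ∀ j ≤ k, b j ≤ B) (hv : (D v : ℝ) ≤ b 0)
    (hEu : ¬ Exits b σ k 0 {u} u) (hEv : ¬ Exits b σ k 0 {v} v)
    (hSu : ¬ HasShortEdge b θ σ L k 0 u) (hSv : ¬ HasShortEdge b θ σ L k 0 v)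
    (hr : v ∉ reach B σ (2 * k) u) {l : List (HalfEdge D)} (hl : IsPath σ u l v) :
    2 * k < l.length ∧ 2 * ∑ i ∈ Finset.range k, θ (i + 1) ≤ pathWeight σ L l := by
  -- Stated for both orientations: it is applied to initial segments of the path from `u` and of the
  -- reversed path from `v`.
  have key : ∀ (x y : Fin n) (l₁ l₂ : List (HalfEdge D)), IsPath σ x (l₁ ++ l₂) y → l₁.length ≤ k →
      ¬ Exits b σ k 0 {x} x → (∀ h ∈ l₁, (D (σ.1 h).1 : ℝ) ≤ B) ∧
      (¬ HasShortEdge b θ σ L k 0 x → ∑ i ∈ Finset.range l₁.length, θ (i + 1) ≤ pathWeight σ L l₁) := by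
    intro x y l₁ l₂ hp hk hE
    obtain ⟨w, hw, hnd⟩ := isPath_prefix hp
    rw [List.nodup_cons] at hnd
    have hU : ∀ h ∈ l₁, (σ.1 h).1 ∉ ({x} : Finset (Fin n)) := by
      intro h hh
      rw [Finset.mem_singleton]
      intro e
      exact hnd.1 (e ▸ List.mem_map_of_mem (f := fun h => (σ.1 h).1) hh)
    refine ⟨degree_le_of_not_exits hB l₁ k 0 {x} x w (by simp) hw hnd.2 hU hk (by omega) hE,
      fun hS => ?_⟩
    have := sum_le_pathWeight l₁ k 0 {x} x w (by simp) hw hnd.2 hU hk hE hS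
    simpa using this
  -- A shorter path would have a first part of at most `k` steps from `u` and a rest of at most `k`
  -- steps from `v`, both with degrees at most `B`, so `v` would be reachable.
  have hlen : 2 * k < l.length := by
    by_contra hcon
    rw [not_lt] at hcon
    apply hr
    refine mem_reach l (2 * k) u v hl.1 hcon ?_
    have hsplit := List.take_append_drop k l
    rw [← hsplit] at hl
    obtain ⟨w, hw1, hw2⟩ := isWalk_append.1 hl.1
    have h1 := (key u v (l.take k) (l.drop k) hl (by simp) hEu).1
    have hrev := isPath_revWalk hl
    rw [revWalk_append] at hrev
    have h2 := (key v u _ _ hrev (by rw [length_revWalk, List.length_drop]; omega) hEv).1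
    intro h hh
    rw [← hsplit, List.mem_append] at hh
    rcases hh with hh | hh
    · exact h1 h hh
    -- In the second part a vertex is either `v` or the start of a later half-edge `c`; the latter
    -- is the target of `σ.1 c` in the reversed walk, whose degrees are controlled.
    · rcases target_eq_or hw2 h hh with e | ⟨c, hc, e⟩
      · rw [e]; exact hv.trans (hB 0 (by omega))
      · rw [← e]
        have := h2 (σ.1 c) (by
          simp only [revWalk, List.mem_map, List.mem_reverse]
          exact ⟨c, hc, rfl⟩)
        rwa [σ.apply_apply] at this
  refine ⟨hlen, ?_⟩
  -- Since the path has more than `2 * k` edges, its first `k` and last `k` edges are disjoint; the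
  -- middle part has nonnegative weight and is dropped.
  have hsplit : l = (l.take k ++ (l.drop k).take (l.length - 2 * k)) ++
      (l.drop k).drop (l.length - 2 * k) := by
    rw [List.append_assoc, List.take_append_drop, List.take_append_drop]
  set l₁ := l.take k with hl1
  set l₂ := (l.drop k).take (l.length - 2 * k) with hl2
  set l₃ := (l.drop k).drop (l.length - 2 * k) with hl3
  have hlen1 : l₁.length = k := by rw [hl1, List.length_take]; omega
  have hlen3 : l₃.length = k := by rw [hl3, List.length_drop, List.length_drop]; omega
  rw [hsplit] at hl ⊢
  have hrev := isPath_revWalk hl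
  rw [List.append_assoc] at hl
  rw [revWalk_append] at hrev
  have h1 := (key u v _ _ hl hlen1.le hEu).2 hSu
  have h2 := (key v u _ _ hrev (by rw [length_revWalk, hlen3]) hEv).2 hSv
  rw [length_revWalk, pathWeight_revWalk, hlen3] at h2
  rw [hlen1] at h1
  have h3 : 0 ≤ pathWeight σ L l₂ := pathWeight_nonneg hL l₂
  rw [pathWeight_append, pathWeight_append]
  linarith

end Lower

/-! ### Estimates for the whole probability space -/

section Assemble

instance (H : Type) : DiscreteMeasurableSpace (Pairing H) := ⟨fun _ => trivial⟩

variable {n : ℕ} {D : Fin n → ℕ} (ν : Measure ℝ) [IsProbabilityMeasure ν]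

/-- A cover of `E` by rectangles, one for each matching and pair of vertices. Only subadditivity is
used, so `E` need not be measurable. -/
lemma sampleMeasure_le (E : Set (Sample D)) :
    sampleMeasure D ν E ≤ ∑ σ : Pairing (HalfEdge D), ∑ u : Fin n, ∑ v : Fin n,
      ENNReal.ofReal (lengthProb D ν {L | (σ, L, u, v) ∈ E}) *
        ((Fintype.card (Pairing (HalfEdge D)) : ℝ≥0∞)⁻¹ * ((n : ℝ≥0∞) ^ 2)⁻¹) := by
  classical
  have hE : E ⊆ ⋃ σ : Pairing (HalfEdge D), ⋃ u : Fin n, ⋃ v : Fin n,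
      ({σ} : Set (Pairing (HalfEdge D))) ×ˢ
        ({L | (σ, L, u, v) ∈ E} ×ˢ ({(u, v)} : Set (Fin n × Fin n))) := by
    rintro ⟨σ, L, u, v⟩ h
    simp only [Set.mem_iUnion]
    exact ⟨σ, u, v, by simpa using h⟩
  refine (measure_mono hE).trans ((measure_iUnion_fintype_le _ _).trans ?_)
  refine Finset.sum_le_sum fun σ _ => (measure_iUnion_fintype_le _ _).trans ?_
  refine Finset.sum_le_sum fun u _ => (measure_iUnion_fintype_le _ _).trans ?_
  refine Finset.sum_le_sum fun v _ => le_of_eq ?_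
  have h1 : uniformOn (Set.univ : Set (Pairing (HalfEdge D))) {σ} =
      (Fintype.card (Pairing (HalfEdge D)) : ℝ≥0∞)⁻¹ := by
    rw [uniformOn_univ, Measure.count_singleton, one_div]
  have h2 : uniformOn (Set.univ : Set (Fin n × Fin n)) {(u, v)} = ((n : ℝ≥0∞) ^ 2)⁻¹ := by
    rw [uniformOn_univ, Measure.count_singleton, one_div]
    simp [sq]
  rw [sampleMeasure, Measure.prod_prod, Measure.prod_prod, h1, h2, lengthProb,
    ofReal_measureReal]
  ring

lemma sampleMeasure_le_of_sum (E : Set (Sample D)) {c : ℝ} (hc : 0 ≤ c)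
    (h : ∑ σ : Pairing (HalfEdge D), ∑ u : Fin n, ∑ v : Fin n,
      lengthProb D ν {L | (σ, L, u, v) ∈ E} ≤ c * (Fintype.card (Pairing (HalfEdge D)) * (n : ℝ) ^ 2)) :
    sampleMeasure D ν E ≤ ENNReal.ofReal c := by
  refine (sampleMeasure_le ν E).trans ?_
  simp_rw [← Finset.sum_mul]
  have h1 : ∑ σ : Pairing (HalfEdge D), ∑ u : Fin n, ∑ v : Fin n,
      ENNReal.ofReal (lengthProb D ν {L | (σ, L, u, v) ∈ E}) = ENNReal.ofReal
      (∑ σ : Pairing (HalfEdge D), ∑ u : Fin n, ∑ v : Fin n,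
        lengthProb D ν {L | (σ, L, u, v) ∈ E}) := by
    rw [ENNReal.ofReal_sum_of_nonneg fun σ _ => Finset.sum_nonneg fun u _ =>
      Finset.sum_nonneg fun v _ => lengthProb_nonneg ν _]
    refine Finset.sum_congr rfl fun σ _ => ?_
    rw [ENNReal.ofReal_sum_of_nonneg fun u _ => Finset.sum_nonneg fun v _ => lengthProb_nonneg ν _]
    refine Finset.sum_congr rfl fun u _ => ?_
    rw [ENNReal.ofReal_sum_of_nonneg fun v _ => lengthProb_nonneg ν _]
  rw [h1]
  refine (mul_le_mul_left (ENNReal.ofReal_le_ofReal h) _).trans ?_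
  rw [ENNReal.ofReal_mul hc, ENNReal.ofReal_mul (Nat.cast_nonneg _), ENNReal.ofReal_pow
    (Nat.cast_nonneg _), ENNReal.ofReal_natCast, ENNReal.ofReal_natCast, mul_assoc]
  refine mul_le_of_le_one_right zero_le ?_
  rw [mul_mul_mul_comm]
  exact mul_le_one' (ENNReal.mul_inv_le_one _) (ENNReal.mul_inv_le_one _)

lemma sampleMeasure_le_of_avg (σ₀ : Pairing (HalfEdge D)) (E : Set (Sample D)) {c : ℝ} (hc : 0 ≤ c)
    (h : ∀ u v, AvgLE σ₀ ∅ (fun σ => lengthProb D ν {L | (σ, L, u, v) ∈ E}) c) :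
    sampleMeasure D ν E ≤ ENNReal.ofReal c := by
  refine sampleMeasure_le_of_sum ν E hc ?_
  have hcyl : cyl σ₀ ∅ = Finset.univ := by ext; simp [cyl]
  simp only [AvgLE, hcyl, Finset.card_univ] at h
  rw [Finset.sum_comm]
  calc _ ≤ ∑ _u : Fin n, ∑ _v : Fin n, c * Fintype.card (Pairing (HalfEdge D)) := by
        refine Finset.sum_le_sum fun u _ => ?_
        rw [Finset.sum_comm]
        exact Finset.sum_le_sum fun v _ => h u v
    _ = _ := by simp; ring

lemma lengthProb_exists_neg (hν : ∀ᵐ x ∂ν, 0 ≤ x) :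
    lengthProb D ν {L | ∃ e, L e < 0} = 0 := by
  have h0 : ν.real (Set.Iio 0) = 0 := by
    rw [measureReal_def]
    have : ν (Set.Iio 0) = 0 := by
      refine measure_mono_null (fun x hx => ?_) (ae_iff.1 hν)
      simpa using hx
    simp [this]
  refine le_antisymm ?_ (lengthProb_nonneg ν _)
  have := lengthProb_exists_le (D := D) ν Finset.univ (fun (e : Sym2 (HalfEdge D)) L => L e < 0)
  simp only [lengthProb_lt, h0, Finset.sum_const_zero, Finset.mem_univ, true_and] at this
  exact this

lemma AvgLE.indicator {σ₀ : Pairing (HalfEdge D)} {S : Finset (HalfEdge D)}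
    {p : Pairing (HalfEdge D) → Prop} [DecidablePred p] {c : ℝ}
    (h : AvgLE σ₀ S (fun σ => if p σ then 1 else 0) c) :
    AvgLE σ₀ S (fun σ => lengthProb D ν {_L | p σ}) c := by
  refine h.mono (fun σ _ => ?_) le_rfl
  split_ifs with hp
  · exact lengthProb_le_one ν _
  · simp only [hp]; rw [lengthProb_false]

/-- The lower bounds for a fixed number of vertices. -/
theorem sampleMeasure_not_long_le (σ₀ : Pairing (HalfEdge D)) (hν : ∀ᵐ x ∂ν, 0 ≤ x)
    {b θ g : ℕ → ℝ} {ρ B p : ℝ} {k : ℕ} (hρ : 0 ≤ ρ) (hb : ∀ j, 0 < b j)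
    (hB : ∀ j ≤ k, b j ≤ B) (hg : ∀ i, 0 ≤ g i) (hp : 0 ≤ p)
    (hexit : ∀ j < k, ((∑ v ∈ Finset.univ.filter (fun v => b (j + 1) < D v), (D v : ℝ)) +
      ρ / b (j + 1) * ∑ v ∈ Finset.univ.filter (fun v => (D v : ℝ) ≤ b (j + 1)), (D v : ℝ) ^ 2)
        ≤ ρ / b j * (((∑ v, D v : ℕ) : ℝ) - (2 * k : ℕ) - 1))
    (hshort : ∀ i < k, b i * (ν.real (Set.Iio (θ (i + 1))) + g (i + 1)) ≤ g i)
    (hdeg : ((Finset.univ.filter fun v => b 0 < D v).card : ℝ) ≤ p * n) :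
    sampleMeasure D ν {ω | ¬ ∀ l, IsPath ω.1 ω.2.2.1 l ω.2.2.2 →
      2 * k < l.length ∧ 2 * ∑ i ∈ Finset.range k, θ (i + 1) ≤ pathWeight ω.1 ω.2.1 l} ≤
      ENNReal.ofReal (2 * p + 2 * ρ + 2 * g 0 + (1 + B) ^ (2 * k) / n) := by
  classical
  have hB0 : 0 ≤ B := (hb 0).le.trans (hB 0 (by omega))
  set X := Fintype.card (Pairing (HalfEdge D)) with hX
  have hcyl : cyl σ₀ ∅ = Finset.univ := by ext; simp [cyl]
  have hcard : (cyl σ₀ ∅).card = X := by rw [hcyl, Finset.card_univ]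
  -- a path in the exceptional event forces one of the following events
  set q : Fin n → Pairing (HalfEdge D) → (Sym2 (HalfEdge D) → ℝ) → Prop := fun u σ L =>
    (D u : ℝ) ≤ b 0 ∧ (Exits b σ k 0 {u} u ∨ HasShortEdge b θ σ L k 0 u) with hq
  -- Starting points of degree above `b 0` are excluded from `q`; they are rare and are counted
  -- separately through `hdeg`.
  have hqavg : ∀ u, ∑ σ, lengthProb D ν {L | q u σ L} ≤ (ρ + g 0) * X := by
    intro u
    rw [← hcard, ← hcyl]
    by_cases hu : (D u : ℝ) ≤ b 0
    · have h1 := (avg_exits_le (s := 2 * k) hρ hb hexit k 0 {u} u σ₀ ∅ (fun h hh => by simp at hh)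
        (by simp) (by simp) (by omega) (by simp)).indicator ν
      have h2 : AvgLE σ₀ ∅ (fun σ => lengthProb D ν {L | HasShortEdge b θ σ L k 0 u}) (g 0) :=
        AvgLE.const_of_le fun σ _ =>
          lengthProb_hasShortEdge_le ν σ hg hshort k 0 u (by omega) hu
      refine (h1.add h2).mono (fun σ _ => ?_) ?_
      · refine (lengthProb_mono ν fun L hL => hL.2).trans (lengthProb_or_le ν _ _)
      · gcongr
        rw [mul_div_assoc', div_le_iff₀ (hb 0), mul_comm]; gcongr
    · refine AvgLE.const_of_le fun σ _ => ?_
      refine (lengthProb_mono ν (E' := {_L | False}) fun L hL => hu hL.1).trans ?_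
      rw [lengthProb_false]; have := hg 0; positivity
  have hslice : ∀ σ u v, lengthProb D ν {L | (σ, L, u, v) ∈ {ω : Sample D | ¬ ∀ l,
      IsPath ω.1 ω.2.2.1 l ω.2.2.2 →
      2 * k < l.length ∧ 2 * ∑ i ∈ Finset.range k, θ (i + 1) ≤ pathWeight ω.1 ω.2.1 l}} ≤
      (if b 0 < D u then 1 else 0) + (if b 0 < D v then 1 else 0) +
      lengthProb D ν {L | q u σ L} + lengthProb D ν {L | q v σ L} +
      (if (D u : ℝ) ≤ b 0 ∧ v ∈ reach B σ (2 * k) u then 1 else 0) := by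
    intro σ u v
    have hn1 := lengthProb_nonneg ν {L | q u σ L}
    have hn2 := lengthProb_nonneg ν {L | q v σ L}
    by_cases hu : b 0 < D u
    · refine (lengthProb_le_one ν _).trans ?_
      rw [if_pos hu]
      split_ifs <;> linarith
    by_cases hv : b 0 < D v
    · refine (lengthProb_le_one ν _).trans ?_
      rw [if_pos hv]
      split_ifs <;> linarith
    by_cases hr : v ∈ reach B σ (2 * k) u
    · refine (lengthProb_le_one ν _).trans ?_
      rw [if_pos (⟨not_lt.1 hu, hr⟩ : (D u : ℝ) ≤ b 0 ∧ v ∈ reach B σ (2 * k) u)]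
      split_ifs <;> linarith
    rw [if_neg hu, if_neg hv, if_neg (fun h => hr h.2)]
    -- Lengths are nonnegative only almost surely, hence the additional null event.
    have hsub : {L | (σ, L, u, v) ∈ {ω : Sample D | ¬ ∀ l, IsPath ω.1 ω.2.2.1 l ω.2.2.2 →
        2 * k < l.length ∧ 2 * ∑ i ∈ Finset.range k, θ (i + 1) ≤ pathWeight ω.1 ω.2.1 l}} ⊆
        {L | ∃ e, L e < 0} ∪ ({L | q u σ L} ∪ {L | q v σ L}) := by
      intro L hL
      by_contra hcon
      simp only [Set.mem_union, not_or, Set.mem_ofPred_eq, not_exists, not_lt] at hcon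
      obtain ⟨hLpos, h1, h2⟩ := hcon
      refine hL fun l hl => ?_
      simp only [hq, not_and, not_or] at h1 h2
      have h1 := h1 (not_lt.1 hu)
      have h2 := h2 (not_lt.1 hv)
      exact long_of_isPath hLpos hB (not_lt.1 hv) h1.1 h2.1 h1.2 h2.2 hr hl
    refine (lengthProb_mono ν hsub).trans ((lengthProb_union_le ν _ _).trans ?_)
    rw [lengthProb_exists_neg ν hν]
    have := lengthProb_union_le ν {L | q u σ L} {L | q v σ L}
    linarith
  have hn0 : (0 : ℝ) ≤ n := Nat.cast_nonneg n
  have hX0 : (0 : ℝ) ≤ X := Nat.cast_nonneg X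
  refine sampleMeasure_le_of_sum ν _ (by have := hg 0; positivity) ?_
  refine (Finset.sum_le_sum fun σ _ => Finset.sum_le_sum fun u _ => Finset.sum_le_sum fun v _ =>
    hslice σ u v).trans ?_
  simp only [Finset.sum_add_distrib]
  have e1 : ∑ _σ : Pairing (HalfEdge D), ∑ u : Fin n, ∑ _v : Fin n,
      (if b 0 < D u then (1 : ℝ) else 0) ≤ p * (X * n ^ 2) := by
    simp only [Finset.sum_const, Finset.card_univ, Fintype.card_fin, nsmul_eq_mul, ← Finset.mul_sum,
      Finset.sum_boole]
    have := mul_le_mul_of_nonneg_left hdeg (mul_nonneg hX0 hn0)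
    linarith
  have e2 : ∑ _σ : Pairing (HalfEdge D), ∑ _u : Fin n, ∑ v : Fin n,
      (if b 0 < D v then (1 : ℝ) else 0) ≤ p * (X * n ^ 2) := by
    simp only [Finset.sum_const, Finset.card_univ, Fintype.card_fin, nsmul_eq_mul,
      Finset.sum_boole]
    have := mul_le_mul_of_nonneg_left hdeg (mul_nonneg hX0 hn0)
    linarith
  have e3 : ∑ σ : Pairing (HalfEdge D), ∑ u : Fin n, ∑ _v : Fin n,
      lengthProb D ν {L | q u σ L} ≤ (ρ + g 0) * (X * n ^ 2) := by
    rw [Finset.sum_comm]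
    calc _ = ∑ u : Fin n, n * ∑ σ, lengthProb D ν {L | q u σ L} := by
          refine Finset.sum_congr rfl fun u _ => ?_
          rw [Finset.mul_sum]; simp
      _ ≤ ∑ _u : Fin n, n * ((ρ + g 0) * X) := by
          refine Finset.sum_le_sum fun u _ => ?_
          gcongr; exact hqavg u
      _ = _ := by simp; ring
  have e4 : ∑ σ : Pairing (HalfEdge D), ∑ _u : Fin n, ∑ v : Fin n,
      lengthProb D ν {L | q v σ L} ≤ (ρ + g 0) * (X * n ^ 2) := by
    refine le_trans (le_of_eq ?_) e3
    refine Finset.sum_congr rfl fun σ _ => ?_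
    rw [Finset.sum_comm]
  -- The vertex `v` is uniform and independent of the reachable set, which has at most `(1 + B) ^ (2
  -- * k)` elements whatever the matching.
  have e5 : ∑ σ : Pairing (HalfEdge D), ∑ u : Fin n, ∑ v : Fin n,
      (if (D u : ℝ) ≤ b 0 ∧ v ∈ reach B σ (2 * k) u then (1 : ℝ) else 0) ≤
        (1 + B) ^ (2 * k) / n * (X * n ^ 2) := by
    have : ∀ σ : Pairing (HalfEdge D), ∀ u : Fin n, ∑ v : Fin n,
      (if (D u : ℝ) ≤ b 0 ∧ v ∈ reach B σ (2 * k) u then (1 : ℝ) else 0) ≤ (1 + B) ^ (2 * k) := by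
      intro σ u
      rw [Finset.sum_boole]
      by_cases hu : (D u : ℝ) ≤ b 0
      · refine le_trans ?_ (card_reach_le hB0 σ (2 * k) u (hu.trans (hB 0 (by omega))))
        refine Nat.cast_le.2 (Finset.card_le_card fun v hv => ?_)
        exact ((Finset.mem_filter.1 hv).2).2
      · simp only [hu, false_and, Finset.filter_false, Finset.card_empty, Nat.cast_zero]
        positivity
    refine (Finset.sum_le_sum fun σ _ => Finset.sum_le_sum fun u _ => this σ u).trans (le_of_eq ?_)
    simp only [Finset.sum_const, Finset.card_univ, Fintype.card_fin, nsmul_eq_mul]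
    rw [← hX]
    rcases Nat.eq_zero_or_pos n with h0 | h0
    · simp [h0]
    · have : (n : ℝ) ≠ 0 := by positivity
      field_simp
  linarith

/-- The upper bounds for a fixed number of vertices. -/
theorem sampleMeasure_not_short_le (σ₀ : Pairing (HalfEdge D)) (hν : ∀ᵐ x ∂ν, 0 ≤ x)
    (hD : ∀ v, 2 ≤ D v) {V : ℕ → Finset (Fin n)} {θ g ε z : ℕ → ℝ} {N R m t : ℕ}
    {ρ c W θ' : ℝ} (hW : 0 ≤ W) (hθ' : 0 ≤ θ')
    (hg : ∀ i, 0 ≤ g i) (hz : ∀ i < N, ∀ x ∈ V i, (D x : ℝ) ≤ z i)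
    (hε : ∀ i < N, ∀ x ∈ V i, ∀ (σ₀ : Pairing (HalfEdge D)) (S : Finset (HalfEdge D)),
      ClosedUnder σ₀ S → S.card ≤ 2 * R + 2 * i →
      AvgLE σ₀ S (fun σ => lengthProb D ν {L | Stuck (V (i + 1)) (θ i) σ L x}) (ε i))
    (hrec : ∀ i < N, ε i + z i * g (i + 1) ≤ g i)
    (hρ0 : 0 ≤ ρ) (hρ1 : ρ ≤ 1)
    (hρ : ρ * ((∑ v, D v : ℕ) : ℝ) + (2 * R : ℕ) + 1 ≤ ((∑ v ∈ V 0, D v : ℕ) : ℝ))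
    (hc : ((2 * R : ℕ) : ℝ) + 1 ≤ c * (((∑ v, D v : ℕ) : ℝ) - (2 * R : ℕ) - 1)) (hc0 : 0 ≤ c)
    (htop : ∀ x ∈ V N, 2 * m ≤ D x ∧ t + 2 * m ≤ D x) (htℓ : t ≤ ∑ v, D v) :
    sampleMeasure D ν {ω | ¬ ∃ l, IsPath ω.1 ω.2.2.1 l ω.2.2.2 ∧
      pathWeight ω.1 ω.2.1 l ≤ 2 * (R * W + ∑ j ∈ Finset.range N, θ j) + θ' ∧
      l.length ≤ 2 * (R + N) + 1} ≤
      ENNReal.ofReal (2 * ((1 - ρ) ^ R + R * c + R * g 0 + R * (1 - cdf ν W)) +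
        n ^ 2 * (1 - cdf ν θ' * t / ((∑ v, D v : ℕ) : ℝ)) ^ m) := by
  classical
  have hW1 : 0 ≤ 1 - cdf ν W := by linarith [cdf_le_one ν W]
  have hr1 : 0 ≤ 1 - cdf ν θ' * t / ((∑ v, D v : ℕ) : ℝ) := by
    rw [sub_nonneg]
    refine div_le_one_of_le₀ ?_ (Nat.cast_nonneg _)
    calc cdf ν θ' * t ≤ 1 * t := by gcongr; exact cdf_le_one ν θ'
      _ ≤ _ := by rw [one_mul]; exact_mod_cast htℓ
  have hg0 := hg 0
  have hρ' : 0 ≤ (1 - ρ) ^ R := pow_nonneg (by linarith) R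
  set e : ∀ u : Fin n, HalfEdge D := fun u => ⟨u, ⟨0, by have := hD u; omega⟩⟩ with he
  set A : Fin n → Pairing (HalfEdge D) → (Sym2 (HalfEdge D) → ℝ) → Prop := fun u σ L =>
    (Avoids (V 0) σ R (e u) ∨ HitFail V θ N σ L R (e u)) ∨ Heavy W σ L R (e u) with hA
  have hAavg : ∀ u, AvgLE σ₀ ∅ (fun σ => lengthProb D ν {L | A u σ L})
      ((1 - ρ) ^ R + R * c + R * g 0 + R * (1 - cdf ν W)) := by
    intro u
    have h1 := (avg_avoids_le hD (V 0) (2 * R) hρ0 hρ1 hρ hc hc0 R (e u) σ₀ ∅ (by simp)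
      (fun h hh => by simp at hh) (by simp)).indicator ν
    have h2 := avg_hitFail_le (V := V) (θ := θ) (N := N) (s := 2 * R) ν hg0 (fun x σ₁ S hx hS hSs =>
      avg_climbFail_le ν hg hz hε hrec N 0 x σ₁ S hx (by omega) hS (by omega)) R (e u) σ₀ ∅
      (fun h hh => by simp at hh) (by simp)
    have h3 : AvgLE σ₀ ∅ (fun σ => lengthProb D ν {L | Heavy W σ L R (e u)})
      (R * (1 - cdf ν W)) := AvgLE.const_of_le fun σ _ => lengthProb_heavy_le ν W σ R (e u)
    refine ((h1.add h2).add h3).mono (fun σ _ => ?_) le_rfl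
    refine (lengthProb_or_le ν _ _).trans (add_le_add_left ?_ _)
    exact lengthProb_or_le ν _ _
  -- The climbs may end at any two vertices of the top layer, so all ordered pairs of distinct ones
  -- are required to be joined; there are at most `n ^ 2`.
  set pairs : Finset (Fin n × Fin n) := (V N ×ˢ V N).filter fun x => x.1 ≠ x.2 with hpairs
  have hTop : AvgLE σ₀ ∅ (fun σ => lengthProb D ν {L | ∃ x ∈ pairs, Stuck {x.2} θ' σ L x.1})
      (n ^ 2 * (1 - cdf ν θ' * t / ((∑ v, D v : ℕ) : ℝ)) ^ m) := by
    have h1 : ∀ x ∈ pairs, AvgLE σ₀ ∅ (fun σ => lengthProb D ν {L | Stuck {x.2} θ' σ L x.1})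
        ((1 - cdf ν θ' * t / ((∑ v, D v : ℕ) : ℝ)) ^ m) := by
      intro x hx
      simp only [hpairs, Finset.mem_filter, Finset.mem_product] at hx
      refine avg_stuck_le ν (fun h hh => by simp at hh) {x.2} θ' x.1 m t ?_ ?_
      · simpa using (htop _ hx.1.1).1
      · simpa using (htop _ hx.1.2).2
    refine (AvgLE.sum pairs h1).mono (fun σ _ => lengthProb_exists_le ν _ _) ?_
    rw [Finset.sum_const, nsmul_eq_mul]
    refine mul_le_mul_of_nonneg_right ?_ (pow_nonneg hr1 m)
    have : pairs.card ≤ n ^ 2 := by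
      refine (Finset.card_le_univ _).trans ?_
      simp [sq]
    exact_mod_cast this
  refine sampleMeasure_le_of_avg ν σ₀ _ ?_ fun u v => ?_
  · have := pow_nonneg hr1 m
    positivity
  refine (((hAavg u).add (hAavg v)).add hTop).mono (fun σ _ => ?_) (by linarith)
  have hsub : {L | (σ, L, u, v) ∈ {ω : Sample D | ¬ ∃ l, IsPath ω.1 ω.2.2.1 l ω.2.2.2 ∧
      pathWeight ω.1 ω.2.1 l ≤ 2 * (R * W + ∑ j ∈ Finset.range N, θ j) + θ' ∧
      l.length ≤ 2 * (R + N) + 1}} ⊆ {L | ∃ e, L e < 0} ∪ (({L | A u σ L} ∪ {L | A v σ L}) ∪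
        {L | ∃ x ∈ pairs, Stuck {x.2} θ' σ L x.1}) := by
    intro L hL
    by_contra hcon
    simp only [Set.mem_union, not_or, Set.mem_ofPred_eq, not_exists, not_lt, hA, not_and] at hcon
    obtain ⟨hLpos, ⟨⟨⟨h1, h2⟩, h3⟩, ⟨h4, h5⟩, h6⟩, h7⟩ := hcon
    obtain ⟨l₁, x, hl₁, hx, hlen₁, hw₁⟩ := exists_walk_to_top hW R (e u) h1 h2 h3
    obtain ⟨l₂, y, hl₂, hy, hlen₂, hw₂⟩ := exists_walk_to_top hW R (e v) h4 h5 h6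
    -- The two climbs may end at the same vertex, and then no connecting edge is needed.
    have hmid : ∃ l₃, IsWalk σ x l₃ y ∧ l₃.length ≤ 1 ∧ pathWeight σ L l₃ ≤ θ' := by
      by_cases hxy : x = y
      · exact ⟨[], hxy, by simp, by simpa [pathWeight] using hθ'⟩
      · have := h7 (x, y) (by simp [hpairs, hx, hy, hxy])
        simp only [Stuck, not_forall, not_lt, Finset.mem_singleton] at this
        obtain ⟨a, ha, hay, haL⟩ := this
        exact ⟨[a], ⟨ha, hay⟩, by simp, by simpa [pathWeight] using haL⟩
    obtain ⟨l₃, hl₃, hlen₃, hw₃⟩ := hmid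
    have hwalk : IsWalk σ u (l₁ ++ (l₃ ++ revWalk σ l₂)) v :=
      isWalk_append.2 ⟨x, hl₁, isWalk_append.2 ⟨y, hl₃, isWalk_revWalk hl₂⟩⟩
    obtain ⟨l, hl, hlen, hw⟩ := exists_isPath_of_isWalk hLpos hwalk
    refine hL ⟨l, hl, ?_, ?_⟩
    · rw [pathWeight_append, pathWeight_append, pathWeight_revWalk] at hw
      simp only; linarith
    · rw [List.length_append, List.length_append, length_revWalk] at hlen
      omega
  refine (lengthProb_mono ν hsub).trans ((lengthProb_union_le ν _ _).trans ?_)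
  rw [lengthProb_exists_neg ν hν, zero_add]
  refine (lengthProb_union_le ν _ _).trans (add_le_add_left ?_ _)
  exact lengthProb_union_le ν _ _

end Assemble

/-! ### Consequences of the assumptions on the degrees -/

section Degrees

/-- Sublinearity of `y ^ γ`; with `y = log x` it absorbs the correction exp(C (log x)^γ) into a
constant times `x ^ δ`. -/
lemma exists_mul_rpow_le {C γ δ : ℝ} (hC : 0 < C) (hγ0 : 0 < γ) (hγ : γ < 1) (hδ : 0 < δ) :
    ∃ K, ∀ y : ℝ, 0 ≤ y → C * y ^ γ ≤ δ * y + K := by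
  -- The point where `C * y ^ γ` equals `δ * y`.
  set y₀ : ℝ := (C / δ) ^ (1 / (1 - γ)) with hy₀
  have hpos : 0 < y₀ := Real.rpow_pos_of_pos (by positivity) _
  refine ⟨C * y₀ ^ γ, fun y hy => ?_⟩
  rcases le_total y y₀ with h | h
  · have : C * y ^ γ ≤ C * y₀ ^ γ := by gcongr
    have : 0 ≤ δ * y := by positivity
    linarith
  · have hy0 : 0 < y := hpos.trans_le h
    have h1 : y₀ ^ (1 - γ) = C / δ := by
      rw [hy₀, ← Real.rpow_mul (by positivity), one_div_mul_cancel (by linarith), Real.rpow_one]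
    have h2 : C / δ ≤ y ^ (1 - γ) := by
      rw [← h1]; exact Real.rpow_le_rpow hpos.le h (by linarith)
    have h3 : y ^ (1 - γ) * y ^ γ = y := by
      rw [← Real.rpow_add hy0]; simp
    have h4 : C ≤ δ * y ^ (1 - γ) := by rw [div_le_iff₀ hδ] at h2; linarith
    have h5 : C * y ^ γ ≤ δ * y := by
      calc C * y ^ γ ≤ δ * y ^ (1 - γ) * y ^ γ := by gcongr
        _ = δ * y := by rw [mul_assoc, h3]
    have : 0 ≤ C * y₀ ^ γ := by positivity
    linarith

lemma mul_one_sub_empiricalCDF {n : ℕ} (d : Fin n → ℕ) (hn : 1 ≤ n) (x : ℝ) :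
    (n : ℝ) * (1 - empiricalCDF d x) = ((Finset.univ.filter fun v => x < (d v : ℝ)).card : ℝ) := by
  have h := Finset.card_filter_add_card_filter_not (s := (Finset.univ : Finset (Fin n)))
    (fun v => (d v : ℝ) ≤ x)
  simp only [not_le, Finset.card_univ, Fintype.card_fin] at h
  have h' : ((Finset.univ.filter fun v => (d v : ℝ) ≤ x).card : ℝ) +
    ((Finset.univ.filter fun v => x < (d v : ℝ)).card : ℝ) = n := by exact_mod_cast h
  have hn' : (n : ℝ) ≠ 0 := by positivity
  rw [empiricalCDF, mul_sub, mul_div_cancel₀ _ hn']; linarith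

variable {d : ∀ n : ℕ, Fin n → ℕ} {τ : ℝ}

lemma PowerLawTail.exists_tail (hd : PowerLawTail d τ) : ∃ α : ℝ, 1 / 2 < α ∧ ∀ δ : ℝ, 0 < δ →
    ∃ C : ℝ, 0 < C ∧ ∀ n : ℕ, 1 ≤ n → ∀ x : ℝ, 1 ≤ x → x < (n : ℝ) ^ α →
      n * (C⁻¹ * x ^ (-(τ - 1) - δ)) ≤ ((Finset.univ.filter fun v => x < (d n v : ℝ)).card : ℝ) ∧
      ((Finset.univ.filter fun v => x < (d n v : ℝ)).card : ℝ) ≤ n * (C * x ^ (-(τ - 1) + δ)) := by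
  obtain ⟨_, _, ⟨γ, C, α, hγ0, hγ1, hC, hα, h⟩, _⟩ := hd
  refine ⟨α, hα, fun δ hδ => ?_⟩
  obtain ⟨K, hK⟩ := exists_mul_rpow_le hC hγ0 hγ1 hδ
  refine ⟨Real.exp K, Real.exp_pos K, fun n hn x hx hxn => ?_⟩
  obtain ⟨h1, h2⟩ := h n hn x hx hxn
  have hx0 : 0 < x := by linarith
  have hk := hK (Real.log x) (Real.log_nonneg hx)
  have hn0 : (0 : ℝ) ≤ n := Nat.cast_nonneg n
  rw [← mul_one_sub_empiricalCDF (d n) hn]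
  have e1 : 1 / x ^ (τ - 1) = Real.exp (-(τ - 1) * Real.log x) := by
    rw [one_div, ← Real.rpow_neg hx0.le, Real.rpow_def_of_pos hx0, mul_comm]
  constructor
  · refine mul_le_mul_of_nonneg_left (le_trans ?_ h1) hn0
    rw [e1, ← Real.exp_add, ← Real.exp_neg, Real.rpow_def_of_pos hx0, ← Real.exp_add,
      Real.exp_le_exp]
    linarith
  · refine mul_le_mul_of_nonneg_left (h2.trans ?_) hn0
    rw [e1, ← Real.exp_add, Real.rpow_def_of_pos hx0, ← Real.exp_add,
      Real.exp_le_exp]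
    linarith

/-- Dyadic decomposition: the power-law tail makes the contribution of degrees between 2^j and
2^(j+1) decay geometrically when `q < τ - 1`. -/
lemma PowerLawTail.exists_moment_le (hd : PowerLawTail d τ) {α : ℝ}
    (hα : ∀ δ : ℝ, 0 < δ → ∃ C : ℝ, 0 < C ∧ ∀ n : ℕ, 1 ≤ n → ∀ x : ℝ, 1 ≤ x → x < (n : ℝ) ^ α →
      n * (C⁻¹ * x ^ (-(τ - 1) - δ)) ≤ ((Finset.univ.filter fun v => x < (d n v : ℝ)).card : ℝ) ∧
      ((Finset.univ.filter fun v => x < (d n v : ℝ)).card : ℝ) ≤ n * (C * x ^ (-(τ - 1) + δ)))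
    {q : ℝ} (hq0 : 0 < q) (hq : q < τ - 1) :
    ∃ C : ℝ, 0 < C ∧ ∀ n : ℕ, 1 ≤ n → ∀ b : ℝ, b < (n : ℝ) ^ α →
      ∑ v ∈ Finset.univ.filter (fun v => (d n v : ℝ) ≤ b), (d n v : ℝ) ^ q ≤ C * n := by
  -- Half of the gap, so that the ratio `r` of the geometric series stays below 1.
  set δ : ℝ := (τ - 1 - q) / 2 with hδ
  have hδ0 : 0 < δ := by rw [hδ]; linarith
  obtain ⟨C, hC, h⟩ := hα δ hδ0
  set r : ℝ := (2 : ℝ) ^ (q - (τ - 1) + δ) with hr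
  have hr0 : 0 < r := Real.rpow_pos_of_pos (by norm_num) _
  have hr1 : r < 1 := Real.rpow_lt_one_of_one_lt_of_neg (by norm_num) (by rw [hδ]; linarith)
  refine ⟨2 ^ q * C * (1 - r)⁻¹, by have := sub_pos.2 hr1; positivity, fun n hn b hb => ?_⟩
  have hn0 : (0 : ℝ) ≤ n := Nat.cast_nonneg n
  set J := ⌈b⌉₊ with hJ
  have hpt : ∀ v ∈ Finset.univ.filter (fun v => (d n v : ℝ) ≤ b), (d n v : ℝ) ^ q ≤
      ∑ j ∈ Finset.range J, if (2 : ℝ) ^ j < d n v then ((2 : ℝ) ^ (j + 1)) ^ q else 0 := by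
    intro v hv
    have hvb : (d n v : ℝ) ≤ b := (Finset.mem_filter.1 hv).2
    have h2 : 2 ≤ d n v := hd.2.2.2 n v
    -- Subtracting 1 gives 2^j < d ≤ 2^(j+1), with the strict inequality on the side where the tail
    -- counts it.
    set j := Nat.log 2 (d n v - 1) with hj
    have h3 : 2 ^ j ≤ d n v - 1 := Nat.pow_log_le_self 2 (by omega)
    have h4 : d n v - 1 < 2 ^ (j + 1) := Nat.lt_pow_succ_log_self (by norm_num) _
    have h5 : (2 : ℝ) ^ j < d n v := by exact_mod_cast (by omega : 2 ^ j < d n v)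
    have h6 : (d n v : ℝ) ≤ 2 ^ (j + 1) := by exact_mod_cast (by omega : d n v ≤ 2 ^ (j + 1))
    have hjJ : j < J := by
      have h7 : (j : ℝ) < b := by
        have : (j : ℝ) < 2 ^ j := by exact_mod_cast Nat.lt_two_pow_self
        linarith
      exact_mod_cast h7.trans_le (Nat.le_ceil b)
    have h8 : (d n v : ℝ) ^ q ≤ (if (2 : ℝ) ^ j < d n v then ((2 : ℝ) ^ (j + 1)) ^ q else 0) := by
      rw [if_pos h5]; exact Real.rpow_le_rpow (Nat.cast_nonneg _) h6 hq0.le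
    refine h8.trans (Finset.single_le_sum
      (f := fun j => if (2 : ℝ) ^ j < d n v then ((2 : ℝ) ^ (j + 1)) ^ q else 0) (fun i _ => ?_)
      (Finset.mem_range.2 hjJ))
    split_ifs <;> positivity
  refine (Finset.sum_le_sum hpt).trans ?_
  rw [Finset.sum_comm]
  have hj : ∀ j ∈ Finset.range J, ∑ v ∈ Finset.univ.filter (fun v => (d n v : ℝ) ≤ b),
      (if (2 : ℝ) ^ j < d n v then ((2 : ℝ) ^ (j + 1)) ^ q else 0) ≤ 2 ^ q * C * n * r ^ j := by
    intro j _
    -- Scales at or above `b` contribute nothing; the others lie below `n ^ α`, where the tail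
    -- estimate is available.
    by_cases hjb : (2 : ℝ) ^ j < b
    · have h1 := (h n hn (2 ^ j) (one_le_pow₀ (by norm_num)) (hjb.trans hb)).2
      calc _ ≤ ∑ v : Fin n, (if (2 : ℝ) ^ j < d n v then ((2 : ℝ) ^ (j + 1)) ^ q else 0) := by
            refine Finset.sum_le_sum_of_subset_of_nonneg (Finset.filter_subset _ _) fun i _ _ => ?_
            split_ifs <;> positivity
        _ = ((Finset.univ.filter fun v => (2 : ℝ) ^ j < (d n v : ℝ)).card : ℝ) *
            ((2 : ℝ) ^ (j + 1)) ^ q := by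
            rw [← Finset.sum_filter, Finset.sum_const, nsmul_eq_mul]
        _ ≤ n * (C * ((2 : ℝ) ^ j) ^ (-(τ - 1) + δ)) * ((2 : ℝ) ^ (j + 1)) ^ q := by gcongr
        _ = 2 ^ q * C * n * (((2 : ℝ) ^ j) ^ (-(τ - 1) + δ) * ((2 : ℝ) ^ j) ^ q) := by
            rw [pow_succ, Real.mul_rpow (by positivity) (by norm_num)]; ring
        _ = _ := by
            rw [← Real.rpow_add (by positivity), ← Real.rpow_natCast 2 j, ← Real.rpow_mul (by norm_num),
              hr, ← Real.rpow_mul_natCast (by norm_num)]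
            congr 2; ring
    · refine le_trans (le_of_eq (Finset.sum_eq_zero fun v hv => ?_)) (by positivity)
      rw [if_neg]
      exact not_lt.2 ((Finset.mem_filter.1 hv).2.trans (not_lt.1 hjb))
  refine (Finset.sum_le_sum hj).trans ?_
  rw [← Finset.mul_sum]
  have hgeo : ∑ j ∈ Finset.range J, r ^ j ≤ (1 - r)⁻¹ := by
    rw [← tsum_geometric_of_lt_one hr0.le hr1]
    exact (summable_geometric_of_lt_one hr0.le hr1).sum_le_tsum _ fun i _ => by positivity
  calc _ ≤ 2 ^ q * C * n * (1 - r)⁻¹ := by gcongr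
    _ = _ := by ring

lemma summable_sizeBiasedMass {n : ℕ} (d : Fin n → ℕ) : Summable (sizeBiasedMass d) := by
  refine summable_of_ne_finset_zero (s := Finset.univ.image fun v => d v - 1) fun k hk => ?_
  have : (Finset.univ.filter fun v => d v = k + 1) = ∅ := by
    ext v
    simp only [Finset.mem_filter, Finset.mem_univ, true_and, Finset.notMem_empty, iff_false]
    intro hv
    exact hk (Finset.mem_image.2 ⟨v, Finset.mem_univ v, by omega⟩)
  simp [sizeBiasedMass, this]

lemma sum_sizeBiasedMass {n : ℕ} (d : Fin n → ℕ) (hd : ∀ v, 1 ≤ d v) (A : Finset ℕ) :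
    ∑ k ∈ A, sizeBiasedMass d k =
      (∑ v ∈ Finset.univ.filter (fun v => d v - 1 ∈ A), (d v : ℝ)) / ((∑ v, d v : ℕ) : ℝ) := by
  rw [Finset.sum_div, ← Finset.sum_fiberwise_of_maps_to (s := Finset.univ.filter
    (fun v => d v - 1 ∈ A)) (t := A) (g := fun v => d v - 1) (fun v hv => (Finset.mem_filter.1 hv).2)]
  refine Finset.sum_congr rfl fun k hk => ?_
  have : (Finset.univ.filter fun v => d v - 1 ∈ A).filter (fun v => d v - 1 = k) =
      Finset.univ.filter fun v => d v = k + 1 := by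
    ext v
    have := hd v
    simp only [Finset.mem_filter, Finset.mem_univ, true_and]
    constructor
    · rintro ⟨_, h⟩; omega
    · intro h
      have : d v - 1 = k := by omega
      exact ⟨this ▸ hk, this⟩
  rw [this, Finset.sum_congr rfl (g := fun _ => ((k : ℝ) + 1) / ((∑ v, d v : ℕ) : ℝ))]
  · rw [Finset.sum_const, nsmul_eq_mul, sizeBiasedMass]; ring
  · intro v hv
    rw [(Finset.mem_filter.1 hv).2]; push_cast; ring

lemma abs_sum_sub_sum_le {p : ℕ → ℝ} {P : PMF ℕ} (hp : Summable p) (A : Finset ℕ) :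
    |∑ k ∈ A, p k - ∑ k ∈ A, (P k).toReal| ≤ 2 * tvDist p fun k => (P k).toReal := by
  have hP : Summable fun k => (P k).toReal := ENNReal.summable_toReal P.tsum_coe_ne_top
  rw [← Finset.sum_sub_distrib, tvDist]
  refine (Finset.abs_sum_le_sum_abs _ _).trans ?_
  have := (hp.sub hP).abs.sum_le_tsum A fun i _ => abs_nonneg _
  linarith

/-- There is no restriction `b < n ^ α` here. The total degree above `b`, divided by the sum of all
degrees, is a size-biased probability, hence close to its value under the limit law. That law is
independent of `n`, so it inherits a tail bound from much larger graphs. -/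
lemma exists_sum_degree_tail_le (hd : PowerLawTail d τ) (hlim : LimitingDistributions d) {α : ℝ}
    (hα0 : 0 < α) {q C : ℝ} (hq0 : 0 < q)
    (hC : ∀ n : ℕ, 1 ≤ n → ∀ b : ℝ, b < (n : ℝ) ^ α →
      ∑ v ∈ Finset.univ.filter (fun v => (d n v : ℝ) ≤ b), (d n v : ℝ) ^ (1 + q) ≤ C * n) :
    ∃ κ : ℝ, 0 < κ ∧ ∀ n : ℕ, 1 ≤ n → ∀ b : ℝ, 0 < b →
      ∑ v ∈ Finset.univ.filter (fun v => b < d n v), (d n v : ℝ) ≤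
        (C * b ^ (-q) + 2 * (n : ℝ) ^ (-κ)) * ((∑ v, d n v : ℕ) : ℝ) := by
  obtain ⟨pD, pB, κ, hκ, h⟩ := hlim
  have hd2 := hd.2.2.2
  have hH : ∀ n : ℕ, 1 ≤ n → (0 : ℝ) < n ∧ (n : ℝ) ≤ ((∑ v, d n v : ℕ) : ℝ) := by
    intro n hn
    refine ⟨by positivity, ?_⟩
    have : ∑ _v : Fin n, 1 ≤ ∑ v, d n v := Finset.sum_le_sum fun v _ => by have := hd2 n v; omega
    simp only [Finset.sum_const, Finset.card_univ, Fintype.card_fin, smul_eq_mul, mul_one] at this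
    exact_mod_cast this
  refine ⟨κ, hκ, fun n hn b hb => ?_⟩
  -- A finite set of values, taken from the degrees for this `n` and then held fixed.
  set A : Finset ℕ := (Finset.univ.filter fun v => b < (d n v : ℝ)).image fun v => d n v - 1 with hA
  have hAb : ∀ k ∈ A, b < (k : ℝ) + 1 := by
    intro k hk
    simp only [hA, Finset.mem_image, Finset.mem_filter, Finset.mem_univ, true_and] at hk
    obtain ⟨v, hv, rfl⟩ := hk
    have := hd2 n v
    rwa [Nat.cast_sub (by omega), Nat.cast_one, sub_add_cancel]
  have htv : ∀ m : ℕ, 1 ≤ m → |∑ k ∈ A, sizeBiasedMass (d m) k - ∑ k ∈ A, (pB k).toReal| ≤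
      2 * (m : ℝ) ^ (-κ) := fun m hm =>
    (abs_sum_sub_sum_le (summable_sizeBiasedMass _) A).trans
      (by linarith [(le_max_right _ _).trans (h m hm)])
  -- For `m` large all of `A` lies below `m ^ α`, so the moment bound and Markov's inequality apply
  -- to the m-th graph; then `m` tends to infinity.
  have hlimit : ∑ k ∈ A, (pB k).toReal ≤ C * b ^ (-q) := by
    have hev : ∀ᶠ m : ℕ in atTop, ∑ k ∈ A, (pB k).toReal ≤ C * b ^ (-q) + 2 * (m : ℝ) ^ (-κ) := by
      have h1 : Tendsto (fun m : ℕ => (m : ℝ) ^ α) atTop atTop :=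
        (tendsto_rpow_atTop hα0).comp tendsto_natCast_atTop_atTop
      filter_upwards [h1.eventually_gt_atTop ((A.sup id : ℕ) + 1 : ℝ), eventually_ge_atTop 1]
        with m hm hm1
      have h2 := abs_le.1 (htv m hm1)
      have h3 : ∑ k ∈ A, sizeBiasedMass (d m) k ≤ C * b ^ (-q) := by
        rw [sum_sizeBiasedMass _ (fun v => by have := hd2 m v; omega)]
        rw [div_le_iff₀ ((hH m hm1).1.trans_le (hH m hm1).2)]
        have h4 : ∑ v ∈ Finset.univ.filter (fun v => d m v - 1 ∈ A), (d m v : ℝ) ≤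
            ∑ v ∈ Finset.univ.filter (fun v => (d m v : ℝ) ≤ (A.sup id : ℕ) + 1),
              b ^ (-q) * (d m v : ℝ) ^ (1 + q) := by
          refine le_trans (Finset.sum_le_sum (g := fun v => b ^ (-q) * (d m v : ℝ) ^ (1 + q))
            fun v hv => ?_) (Finset.sum_le_sum_of_subset_of_nonneg ?_ fun v _ _ => by positivity)
          · have h5 := hAb _ (Finset.mem_filter.1 hv).2
            have h6 := hd2 m v
            rw [Nat.cast_sub (by omega), Nat.cast_one, sub_add_cancel] at h5
            have h7 : (0 : ℝ) < d m v := hb.trans h5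
            rw [Real.rpow_add h7, Real.rpow_one, mul_left_comm]
            refine le_mul_of_one_le_right h7.le ?_
            rw [Real.rpow_neg hb.le, inv_mul_eq_div, one_le_div (Real.rpow_pos_of_pos hb q)]
            exact Real.rpow_le_rpow hb.le h5.le hq0.le
          · intro v hv
            have h5 : d m v - 1 ≤ A.sup id := Finset.le_sup (f := id) (Finset.mem_filter.1 hv).2
            simp only [Finset.mem_filter, Finset.mem_univ, true_and]
            exact_mod_cast (by omega : d m v ≤ A.sup id + 1)
        rw [← Finset.mul_sum] at h4
        have h5 := hC m hm1 _ hm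
        have h6 : 0 ≤ b ^ (-q) := by positivity
        have h8 : 0 ≤ C := by
          have h9 : 0 ≤ C * m := le_trans (Finset.sum_nonneg fun v _ => by positivity) h5
          exact nonneg_of_mul_nonneg_left h9 (hH m hm1).1
        calc _ ≤ b ^ (-q) * (C * m) := h4.trans (by gcongr)
          _ ≤ b ^ (-q) * (C * ((∑ v, d m v : ℕ) : ℝ)) := by have := (hH m hm1).2; gcongr
          _ = _ := by ring
      linarith [h2.1]
    have h2 : Tendsto (fun m : ℕ => C * b ^ (-q) + 2 * (m : ℝ) ^ (-κ)) atTop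
        (𝓝 (C * b ^ (-q) + 2 * 0)) :=
      (((tendsto_rpow_neg_atTop hκ).comp tendsto_natCast_atTop_atTop).const_mul 2).const_add _
    rw [mul_zero, add_zero] at h2
    exact ge_of_tendsto h2 hev
  have h1 := abs_le.1 (htv n hn)
  have h2 : ∑ k ∈ A, sizeBiasedMass (d n) k ≤ C * b ^ (-q) + 2 * (n : ℝ) ^ (-κ) := by linarith [h1.2]
  rw [sum_sizeBiasedMass _ (fun v => by have := hd2 n v; omega),
    div_le_iff₀ ((hH n hn).1.trans_le (hH n hn).2)] at h2
  refine le_trans (Finset.sum_le_sum_of_subset_of_nonneg ?_ fun v _ _ => by positivity) h2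
  intro v hv
  rw [Finset.mem_filter] at hv ⊢
  exact ⟨hv.1, Finset.mem_image.2 ⟨v, by simpa using hv.2, rfl⟩⟩

end Degrees

/-! ### Parity of the total degree, perfect matchings and the resulting degree bounds -/

section EvenDegrees

variable {n : ℕ}

lemma le_evenDegrees (d : Fin n → ℕ) (v : Fin n) : d v ≤ evenDegrees d v := by
  unfold evenDegrees; split_ifs <;> omega

lemma evenDegrees_le (d : Fin n → ℕ) (v : Fin n) : evenDegrees d v ≤ d v + 1 := by
  unfold evenDegrees; split_ifs <;> omega

lemma even_sum_evenDegrees (d : Fin n → ℕ) : Even (∑ v, evenDegrees d v) := by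
  by_cases h : Odd (∑ w, d w)
  · cases n with
    | zero => simp
    | succ m =>
      have h1 : ∀ v : Fin m, evenDegrees d v.castSucc = d v.castSucc := by
        intro v
        have : (v : ℕ) ≠ m := v.2.ne
        simp [evenDegrees, this]
      have h2 : evenDegrees d (Fin.last m) = d (Fin.last m) + 1 := by
        simp [evenDegrees, h]
      rw [Fin.sum_univ_castSucc, h2]
      simp_rw [h1]
      rw [← add_assoc, ← Fin.sum_univ_castSucc]
      exact h.add_one
  · have h1 : ∀ v, evenDegrees d v = d v := fun v => by simp [evenDegrees, h]
    simp_rw [h1]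
    exact Nat.not_odd_iff_even.1 h

end EvenDegrees

/-- A set with an even number of elements has a perfect matching. -/
lemma nonempty_pairing {H : Type} [Fintype H] (h : Even (Fintype.card H)) : Nonempty (Pairing H) := by
  obtain ⟨k, hk⟩ := h
  have e : H ≃ Fin k × Bool := Fintype.equivOfCardEq (by simp [hk, mul_two])
  let f : Equiv.Perm (Fin k × Bool) := Equiv.prodCongr (Equiv.refl _) Equiv.boolNot
  have hf : ∀ y, f (f y) = y := by rintro ⟨a, b⟩; simp [f]
  refine ⟨⟨e.trans (f.trans e.symm), fun x => ⟨?_, fun hx => ?_⟩⟩⟩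
  · rw [Equiv.trans_apply, Equiv.trans_apply, Equiv.trans_apply, Equiv.trans_apply,
      Equiv.apply_symm_apply, hf, Equiv.symm_apply_apply]
  have h1 : f (e x) = e x := by
    have := congrArg e hx
    simpa using this
  have h2 := congrArg Prod.snd h1
  simp [f] at h2

/-- The estimates on the degrees on which the proof relies. -/
structure DegreeBounds (D : ∀ n : ℕ, Fin n → ℕ) (s α : ℝ) : Prop where
  half_lt : 1 / 2 < α
  two_le : ∀ n v, 2 ≤ D n v
  even : ∀ n, Even (∑ v, D n v)
  linear : ∃ Λ : ℝ, 0 < Λ ∧ ∀ᶠ n : ℕ in atTop, ((∑ v, D n v : ℕ) : ℝ) ≤ Λ * n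
  upper : ∀ q : ℝ, 0 < q → q < s → ∃ C κ : ℝ, 0 < C ∧ 0 < κ ∧ ∀ n : ℕ, 1 ≤ n → ∀ b : ℝ, 0 < b →
    (∑ v ∈ Finset.univ.filter (fun v => b < D n v), (D n v : ℝ) ≤
      C * (b ^ (-q) + (n : ℝ) ^ (-κ)) * ((∑ v, D n v : ℕ) : ℝ)) ∧
    (b < (n : ℝ) ^ α →
      ∑ v ∈ Finset.univ.filter (fun v => (D n v : ℝ) ≤ b), (D n v : ℝ) ^ 2 ≤ C * b ^ (1 - q) * n)
  lower : ∀ δ ζ : ℝ, 0 < δ → 0 < ζ → ∃ M : ℝ, 1 ≤ M ∧ ∀ n : ℕ, 1 ≤ n → ∀ y : ℝ, M ≤ y →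
    y ^ (1 + ζ) < (n : ℝ) ^ α → n * y ^ (-s - δ) ≤
      ((∑ v ∈ Finset.univ.filter (fun v => y < D n v ∧ (D n v : ℝ) ≤ 2 * y ^ (1 + ζ)), D n v : ℕ) : ℝ)

lemma DegreeBounds.le_sum {D : ∀ n : ℕ, Fin n → ℕ} {s α : ℝ} (h : DegreeBounds D s α) (n : ℕ) :
    2 * (n : ℝ) ≤ ((∑ v, D n v : ℕ) : ℝ) := by
  have : ∑ _v : Fin n, 2 ≤ ∑ v, D n v := Finset.sum_le_sum fun v _ => h.two_le n v
  simp only [Finset.sum_const, Finset.card_univ, Fintype.card_fin, smul_eq_mul] at this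
  have h2 : ((n * 2 : ℕ) : ℝ) ≤ ((∑ v, D n v : ℕ) : ℝ) := by exact_mod_cast this
  push_cast at h2 ⊢; linarith

lemma DegreeBounds.nonempty_pairing {D : ∀ n : ℕ, Fin n → ℕ} {s α : ℝ} (h : DegreeBounds D s α)
    (n : ℕ) : Nonempty (Pairing (HalfEdge (D n))) :=
  ConfigModel.nonempty_pairing (by rw [card_halfEdge]; exact h.even n)

/-- The half-edge added for parity at most doubles a degree and so affects only constants. -/
lemma exists_degreeBounds {d : ∀ n : ℕ, Fin n → ℕ} {τ : ℝ} (hd : PowerLawTail d τ)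
    (hlim : LimitingDistributions d) :
    ∃ α, DegreeBounds (fun n => evenDegrees (d n)) (τ - 2) α := by
  obtain ⟨α, hα, htail⟩ := hd.exists_tail
  have hτ := hd.1
  have hd2 := hd.2.2.2
  have hα0 : 0 < α := by linarith
  have hle : ∀ n v, (d n v : ℝ) ≤ evenDegrees (d n) v := fun n v =>
    by exact_mod_cast le_evenDegrees (d n) v
  have hge : ∀ n v, (evenDegrees (d n) v : ℝ) ≤ 2 * d n v := fun n v => by
    have h1 := evenDegrees_le (d n) v
    have h2 := hd2 n v
    exact_mod_cast (by omega : evenDegrees (d n) v ≤ 2 * d n v)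
  have hsum : ∀ n, ((∑ v, d n v : ℕ) : ℝ) ≤ ((∑ v, evenDegrees (d n) v : ℕ) : ℝ) := fun n => by
    exact_mod_cast Finset.sum_le_sum fun v _ => le_evenDegrees (d n) v
  refine ⟨α, hα, fun n v => (hd2 n v).trans (le_evenDegrees _ v), fun n => even_sum_evenDegrees _,
    ?_, ?_, ?_⟩
  · set q : ℝ := (τ - 2) / 2 with hq
    have hq0 : 0 < q := by rw [hq]; linarith
    obtain ⟨C, hC, hmom⟩ := hd.exists_moment_le htail (q := 1 + q) (by linarith) (by rw [hq]; linarith)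
    obtain ⟨κ, hκ, h⟩ := exists_sum_degree_tail_le hd hlim hα0 hq0 hmom
    -- Degrees above this fixed `b` then carry at most half of the total, for `n` large, while the
    -- others carry at most `b * n`. The total is thus at most `2 * b * n`, and at most twice that
    -- after the parity correction.
    have h1 : ∃ b : ℝ, 0 < b ∧ C * b ^ (-q) ≤ 1 / 4 := by
      have : Tendsto (fun b : ℝ => C * b ^ (-q)) atTop (𝓝 (C * 0)) :=
        (tendsto_rpow_neg_atTop hq0).const_mul C
      rw [mul_zero] at this
      obtain ⟨b, hb, hb0⟩ := ((this.eventually (ge_mem_nhds (by norm_num : (0 : ℝ) < 1 / 4))).and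
        (eventually_gt_atTop 0)).exists
      exact ⟨b, hb0, hb⟩
    obtain ⟨b, hb0, hb⟩ := h1
    refine ⟨4 * b, by positivity, ?_⟩
    have h2 : Tendsto (fun n : ℕ => 2 * (n : ℝ) ^ (-κ)) atTop (𝓝 (2 * 0)) :=
      ((tendsto_rpow_neg_atTop hκ).comp tendsto_natCast_atTop_atTop).const_mul 2
    rw [mul_zero] at h2
    filter_upwards [h2.eventually (ge_mem_nhds (by norm_num : (0 : ℝ) < 1 / 4)),
      eventually_ge_atTop 1] with n hn hn1
    have h3 := h n hn1 b hb0
    have h4 : ∑ v ∈ Finset.univ.filter (fun v => ¬ b < d n v), (d n v : ℝ) ≤ b * n := by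
      calc _ ≤ ∑ v ∈ Finset.univ.filter (fun v => ¬ b < d n v), b :=
            Finset.sum_le_sum fun v hv => not_lt.1 (Finset.mem_filter.1 hv).2
        _ ≤ ∑ _v : Fin n, b :=
            Finset.sum_le_sum_of_subset_of_nonneg (Finset.filter_subset _ _) fun _ _ _ => hb0.le
        _ = b * n := by simp [mul_comm]
    have h5 := Finset.sum_filter_add_sum_filter_not Finset.univ (fun v => b < (d n v : ℝ))
      (fun v => (d n v : ℝ))
    have h6 : ((∑ v, evenDegrees (d n) v : ℕ) : ℝ) ≤ 2 * ∑ v, (d n v : ℝ) := by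
      rw [Finset.mul_sum]; push_cast
      exact Finset.sum_le_sum fun v _ => hge n v
    have h7 : (0 : ℝ) ≤ ∑ v, (d n v : ℝ) := Finset.sum_nonneg fun v _ => Nat.cast_nonneg _
    push_cast at h3 h6 ⊢
    nlinarith
  · intro q hq0 hq
    obtain ⟨C, hC, hmom⟩ := hd.exists_moment_le htail (q := 1 + q) (by linarith) (by linarith)
    obtain ⟨κ, hκ, h⟩ := exists_sum_degree_tail_le hd hlim hα0 hq0 hmom
    refine ⟨2 * C * 2 ^ q + 4 * C + 4, κ, by positivity, hκ, fun n hn b hb => ⟨?_, fun hbn => ?_⟩⟩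
    · have h1 := h n hn (b / 2) (by positivity)
      have h2 : ∑ v ∈ Finset.univ.filter (fun v => b < evenDegrees (d n) v),
          (evenDegrees (d n) v : ℝ) ≤
          ∑ v ∈ Finset.univ.filter (fun v => b / 2 < d n v), 2 * (d n v : ℝ) := by
        refine (Finset.sum_le_sum fun v _ => hge n v).trans
          (Finset.sum_le_sum_of_subset_of_nonneg ?_ fun v _ _ => by positivity)
        intro v hv
        simp only [Finset.mem_filter, Finset.mem_univ, true_and] at hv ⊢
        linarith [hge n v]
      rw [← Finset.mul_sum] at h2
      rw [Real.div_rpow hb.le (by norm_num), Real.rpow_neg (by norm_num : (0 : ℝ) ≤ 2),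
        div_inv_eq_mul] at h1
      have hx : 0 ≤ b ^ (-q) := by positivity
      have hy : 0 ≤ (n : ℝ) ^ (-κ) := by positivity
      have hz : 0 ≤ ((∑ v, d n v : ℕ) : ℝ) := Nat.cast_nonneg _
      have hw : (0 : ℝ) < 2 ^ q := by positivity
      calc _ ≤ 2 * ((C * (b ^ (-q) * 2 ^ q) + 2 * (n : ℝ) ^ (-κ)) * ((∑ v, d n v : ℕ) : ℝ)) :=
            h2.trans (by gcongr)
        _ ≤ (2 * C * 2 ^ q + 4 * C + 4) * (b ^ (-q) + (n : ℝ) ^ (-κ)) * ((∑ v, d n v : ℕ) : ℝ) := by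
            rw [← mul_assoc]
            refine mul_le_mul_of_nonneg_right ?_ hz
            have h3 : 0 ≤ (4 * C + 4) * b ^ (-q) := by positivity
            have h4 : 0 ≤ (2 * C * 2 ^ q + 4 * C) * (n : ℝ) ^ (-κ) := by positivity
            linarith
        _ ≤ _ := mul_le_mul_of_nonneg_left (hsum n) (by positivity)
    · have h1 := hmom n hn b hbn
      have h2 : ∑ v ∈ Finset.univ.filter (fun v => (evenDegrees (d n) v : ℝ) ≤ b),
          (evenDegrees (d n) v : ℝ) ^ 2 ≤
          ∑ v ∈ Finset.univ.filter (fun v => (d n v : ℝ) ≤ b),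
            4 * b ^ (1 - q) * (d n v : ℝ) ^ (1 + q) := by
        refine le_trans (Finset.sum_le_sum
          (g := fun v => 4 * b ^ (1 - q) * (d n v : ℝ) ^ (1 + q)) fun v hv => ?_)
          (Finset.sum_le_sum_of_subset_of_nonneg ?_ fun v _ _ => by positivity)
        · have hvb := (Finset.mem_filter.1 hv).2
          have h3 : (0 : ℝ) < d n v := by exact_mod_cast (by have := hd2 n v; omega : 0 < d n v)
          have h4 : (d n v : ℝ) ≤ b := (hle n v).trans hvb
          have h5 : (d n v : ℝ) ^ (2 : ℕ) ≤ b ^ (1 - q) * (d n v : ℝ) ^ (1 + q) := by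
            have : (d n v : ℝ) ^ (2 : ℕ) = (d n v : ℝ) ^ (1 - q) * (d n v : ℝ) ^ (1 + q) := by
              rw [← Real.rpow_add h3, ← Real.rpow_natCast]; congr 1; push_cast; ring
            rw [this]
            gcongr
            linarith [hd.2.1]
          have h6 : (evenDegrees (d n) v : ℝ) ^ 2 ≤ (2 * d n v) ^ 2 := by
            gcongr; exact hge n v
          rw [mul_pow] at h6
          linarith
        · intro v hv
          simp only [Finset.mem_filter, Finset.mem_univ, true_and] at hv ⊢
          exact (hle n v).trans hv
      rw [← Finset.mul_sum] at h2
      have hw : 0 ≤ b ^ (1 - q) * n := by positivity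
      have hw2 : (0 : ℝ) ≤ 2 * C * 2 ^ q + 4 := by positivity
      calc _ ≤ 4 * b ^ (1 - q) * (C * n) := h2.trans (by gcongr)
        _ ≤ _ := by nlinarith
  · intro δ ζ hδ hζ
    -- The number of degrees between `y` and `y ^ (1 + ζ)` is a difference of two tails. With this
    -- `δ'` the tail at `y ^ (1 + ζ)` is smaller than the one at `y` by a factor of order `y ^ (-(ζ
    -- / 2))`, because `τ - 1 > 1`.
    set δ' : ℝ := min (δ / 2) (ζ / (2 + ζ) / 2) with hδ'
    have hδ0 : 0 < δ' := by positivity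
    have hδ1 : δ' ≤ δ / 2 := min_le_left _ _
    have hδ2 : δ' * (2 + ζ) ≤ ζ / 2 := by
      have : δ' ≤ ζ / (2 + ζ) / 2 := min_le_right _ _
      calc δ' * (2 + ζ) ≤ ζ / (2 + ζ) / 2 * (2 + ζ) := by gcongr
        _ = ζ / 2 := by field_simp
    obtain ⟨C, hC, ht⟩ := htail δ' hδ0
    have hω : 0 < ζ / 2 := by positivity
    have hlim1 : Tendsto (fun y : ℝ => C * y ^ (-(ζ / 2))) atTop (𝓝 (C * 0)) :=
      (tendsto_rpow_neg_atTop hω).const_mul C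
    have hlim2 : Tendsto (fun y : ℝ => y ^ (-δ')) atTop (𝓝 0) := tendsto_rpow_neg_atTop hδ0
    rw [mul_zero] at hlim1
    obtain ⟨M, hM⟩ := eventually_atTop.1 ((hlim1.eventually (ge_mem_nhds (by positivity :
      (0 : ℝ) < C⁻¹ / 2))).and (hlim2.eventually (ge_mem_nhds (by positivity : (0 : ℝ) < C⁻¹ / 2))))
    refine ⟨max M 1, le_max_right _ _, fun n hn y hy hyn => ?_⟩
    have hy1 : 1 ≤ y := (le_max_right _ _).trans hy
    have hy0 : 0 < y := by linarith
    obtain ⟨hM1, hM2⟩ := hM y ((le_max_left _ _).trans hy)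
    set z := y ^ (1 + ζ) with hz
    have hyz : y ≤ z := by
      rw [hz]; nth_rewrite 1 [← Real.rpow_one y]
      exact Real.rpow_le_rpow_of_exponent_le hy1 (by linarith)
    have h1 := (ht n hn y hy1 (hyz.trans_lt hyn)).1
    have h2 := (ht n hn z (hy1.trans hyz) hyn).2
    have hn0 : (0 : ℝ) ≤ n := Nat.cast_nonneg n
    have h3 : z ^ (-(τ - 1) + δ') ≤ y ^ (-(τ - 1) - δ') * y ^ (-(ζ / 2)) := by
      rw [hz, ← Real.rpow_mul hy0.le, ← Real.rpow_add hy0]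
      refine Real.rpow_le_rpow_of_exponent_le hy1 ?_
      nlinarith
    have h4 : y ^ (-(τ - 2) - δ) ≤ y * (y ^ (-(τ - 1) - δ') * y ^ (-δ')) := by
      nth_rewrite 2 [← Real.rpow_one y]
      rw [← Real.rpow_add hy0, ← Real.rpow_add hy0]
      refine Real.rpow_le_rpow_of_exponent_le hy1 ?_
      linarith
    have h5 : ((Finset.univ.filter fun v => y < (d n v : ℝ)).card : ℝ) -
        ((Finset.univ.filter fun v => z < (d n v : ℝ)).card : ℝ) ≤
        ((Finset.univ.filter fun v => y < (d n v : ℝ) ∧ (d n v : ℝ) ≤ z).card : ℝ) := by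
      rw [sub_le_iff_le_add]
      have : (Finset.univ.filter fun v => y < (d n v : ℝ)) ⊆
          (Finset.univ.filter fun v => y < (d n v : ℝ) ∧ (d n v : ℝ) ≤ z) ∪
          (Finset.univ.filter fun v => z < (d n v : ℝ)) := by
        intro v hv
        simp only [Finset.mem_filter, Finset.mem_univ, true_and, Finset.mem_union] at hv ⊢
        by_cases h : (d n v : ℝ) ≤ z
        · exact Or.inl ⟨hv, h⟩
        · exact Or.inr (not_le.1 h)
      exact_mod_cast (Finset.card_le_card this).trans (Finset.card_union_le _ _)
    have h6 : y * ((Finset.univ.filter fun v => y < (d n v : ℝ) ∧ (d n v : ℝ) ≤ z).card : ℝ) ≤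
        ((∑ v ∈ Finset.univ.filter (fun v => y < (evenDegrees (d n) v : ℝ) ∧
          (evenDegrees (d n) v : ℝ) ≤ 2 * z), evenDegrees (d n) v : ℕ) : ℝ) := by
      push_cast
      calc _ = ∑ v ∈ Finset.univ.filter fun v => y < (d n v : ℝ) ∧ (d n v : ℝ) ≤ z, y := by
            rw [Finset.sum_const, nsmul_eq_mul, mul_comm]
        _ ≤ ∑ v ∈ Finset.univ.filter fun v => y < (d n v : ℝ) ∧ (d n v : ℝ) ≤ z,
            (evenDegrees (d n) v : ℝ) := by
            refine Finset.sum_le_sum fun v hv => ?_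
            exact (Finset.mem_filter.1 hv).2.1.le.trans (hle n v)
        _ ≤ _ := by
            refine Finset.sum_le_sum_of_subset_of_nonneg ?_ fun v _ _ => Nat.cast_nonneg _
            intro v hv
            simp only [Finset.mem_filter, Finset.mem_univ, true_and] at hv ⊢
            exact ⟨hv.1.trans_le (hle n v), by linarith [hge n v, hv.2]⟩
    refine le_trans ?_ h6
    have hP : 0 < y ^ (-(τ - 1) - δ') := by positivity
    have h7 : y ^ (-(τ - 1) - δ') * y ^ (-δ') ≤ C⁻¹ * y ^ (-(τ - 1) - δ') - C * z ^ (-(τ - 1) + δ') := by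
      have h8 : C * z ^ (-(τ - 1) + δ') ≤ y ^ (-(τ - 1) - δ') * (C * y ^ (-(ζ / 2))) := by
        calc _ ≤ C * (y ^ (-(τ - 1) - δ') * y ^ (-(ζ / 2))) := by gcongr
          _ = _ := by ring
      nlinarith [mul_le_mul_of_nonneg_left hM1 hP.le, mul_le_mul_of_nonneg_left hM2 hP.le]
    calc n * y ^ (-(τ - 2) - δ) ≤ n * (y * (y ^ (-(τ - 1) - δ') * y ^ (-δ'))) := by gcongr
      _ ≤ n * (y * (C⁻¹ * y ^ (-(τ - 1) - δ') - C * z ^ (-(τ - 1) + δ'))) := by gcongr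
      _ = y * (n * (C⁻¹ * y ^ (-(τ - 1) - δ')) - n * (C * z ^ (-(τ - 1) + δ'))) := by ring
      _ ≤ y * ((Finset.univ.filter fun v => y < (d n v : ℝ) ∧ (d n v : ℝ) ≤ z).card : ℝ) := by
          gcongr; linarith

/-! ### Comparison of sums of a monotone function along different progressions -/

/-- Both sums are compared with the integral of `h`: the left one, with right end points, lies below
it and the right one, with left end points, above it. The factor is the ratio of the step lengths.
-/
lemma sum_le_mul_sum_of_antitone {h : ℝ → ℝ} (hh : Antitone h) (hpos : ∀ t, 0 ≤ h t) {a b : ℝ}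
    (ha : 0 < a) (hb : 0 < b) {N N' : ℕ} (hN : N * b ≤ N' * a) :
    ∑ i ∈ Finset.range N, h ((i + 1 : ℕ) * b) ≤ a / b * ∑ i ∈ Finset.range N', h (i * a) := by
  have hab : Antitone fun x => h (x * b) := fun x y hxy => hh (by gcongr)
  have haa : Antitone fun x => h (x * a) := fun x y hxy => hh (by gcongr)
  have h1 := AntitoneOn.sum_le_integral (f := fun x => h (x * b)) (x₀ := 0) (a := N)
    (hab.antitoneOn _)
  have h2 := AntitoneOn.integral_le_sum (f := fun x => h (x * a)) (x₀ := 0) (a := N')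
    (haa.antitoneOn _)
  simp only [zero_add] at h1 h2
  rw [intervalIntegral.integral_comp_mul_right _ hb.ne', zero_mul, smul_eq_mul] at h1
  rw [intervalIntegral.integral_comp_mul_right _ ha.ne', zero_mul, smul_eq_mul] at h2
  have h3 : ∫ x in (0 : ℝ)..N * b, h x ≤ ∫ x in (0 : ℝ)..N' * a, h x := by
    refine intervalIntegral.integral_mono_interval le_rfl (by positivity) hN
      (Filter.Eventually.of_forall hpos) ?_
    exact hh.intervalIntegrable
  have h4 : ∫ x in (0 : ℝ)..N' * a, h x ≤ a * ∑ i ∈ Finset.range N', h (i * a) := by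
    rwa [inv_mul_le_iff₀ ha] at h2
  refine h1.trans ?_
  rw [inv_mul_le_iff₀ hb, ← mul_assoc, mul_div_cancel₀ _ hb.ne']
  exact h3.trans h4

/-! ### The normalising sum in logarithmic scale and its divergence -/

section Normalizer

lemma sum_Icc_one_eq (f : ℕ → ℝ) (N : ℕ) :
    ∑ i ∈ Finset.Icc 1 N, f i = ∑ i ∈ Finset.range N, f (i + 1) := by
  induction N with
  | zero => simp
  | succ N ih => rw [Finset.sum_Icc_succ_top (by omega), ih, Finset.sum_range_succ]

/-- The quantile `F^{(-1)}(exp (-exp t))`. -/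
def levelInv (ν : Measure ℝ) (t : ℝ) : ℝ := genInv (cdf ν) (Real.exp (-Real.exp t))

variable {ν : Measure ℝ} [IsProbabilityMeasure ν]

lemma exp_neg_exp_lt_one (t : ℝ) : Real.exp (-Real.exp t) < 1 := by
  rw [Real.exp_lt_one_iff]; linarith [Real.exp_pos t]

lemma levelInv_nonneg (hν : ∀ᵐ x ∂ν, 0 ≤ x) (t : ℝ) : 0 ≤ levelInv ν t :=
  genInv_nonneg ν hν (Real.exp_pos _)

lemma levelInv_antitone (hν : ∀ᵐ x ∂ν, 0 ≤ x) : Antitone (levelInv ν) := fun s t hst =>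
  genInv_mono ν hν (Real.exp_pos _) (by gcongr) (exp_neg_exp_lt_one s)

omit [IsProbabilityMeasure ν] in
lemma normalizer_eq {τ : ℝ} (h2 : 2 < τ) (h3 : τ < 3) (n : ℕ) :
    normalizer ν τ n = 2 * ∑ i ∈ Finset.range ⌊logLogRatio τ n⌋₊,
      levelInv ν ((i + 1 : ℕ) * |Real.log (τ - 2)|) := by
  have hs : 0 < τ - 2 := by linarith
  have hlog : Real.log (τ - 2) < 0 := Real.log_neg hs (by linarith)
  have hexp : ∀ i : ℕ, (1 / (τ - 2)) ^ i = Real.exp (i * |Real.log (τ - 2)|) := by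
    intro i
    rw [abs_of_neg hlog, mul_comm, Real.exp_mul, Real.exp_neg, Real.exp_log hs, Real.rpow_natCast,
      one_div]
  rw [normalizer, sum_Icc_one_eq]
  simp only [levelInv, hexp]

/-- The hypothesis is divergence for step 1; the integral comparison transfers it to every step `a`,
at the cost of the term at 0. -/
lemma tendsto_sum_levelInv (hν : ∀ᵐ x ∂ν, 0 ≤ x)
    (hsum : Tendsto (fun N : ℕ => ∑ k ∈ Finset.Icc 1 N, genInv (cdf ν) (Real.exp (-Real.exp (k : ℝ))))
      atTop atTop) {a : ℝ} (ha : 0 < a) :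
    Tendsto (fun M : ℕ => ∑ i ∈ Finset.range M, levelInv ν ((i + 1 : ℕ) * a)) atTop atTop := by
  rw [tendsto_atTop]
  intro X
  obtain ⟨N, hN⟩ := (hsum.eventually_ge_atTop (a * (X + levelInv ν 0))).exists
  filter_upwards [eventually_ge_atTop ⌈N / a⌉₊] with M hM
  have h1 := sum_le_mul_sum_of_antitone (levelInv_antitone hν) (levelInv_nonneg hν) ha one_pos
    (N := N) (N' := M) (by
      rw [mul_one, ← div_le_iff₀ ha]
      exact (Nat.le_ceil _).trans (by exact_mod_cast hM))
  have h2 : ∑ k ∈ Finset.Icc 1 N, genInv (cdf ν) (Real.exp (-Real.exp (k : ℝ))) =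
      ∑ i ∈ Finset.range N, levelInv ν ((i + 1 : ℕ) * 1) := by
    rw [sum_Icc_one_eq]; simp [levelInv]
  rw [← h2, div_one] at h1
  have h3 : ∑ i ∈ Finset.range M, levelInv ν (i * a) ≤
      levelInv ν 0 + ∑ i ∈ Finset.range M, levelInv ν ((i + 1 : ℕ) * a) := by
    have e1 := Finset.sum_range_succ (fun i : ℕ => levelInv ν (i * a)) M
    have e2 := Finset.sum_range_succ' (fun i : ℕ => levelInv ν (i * a)) M
    simp only [Nat.cast_zero, zero_mul] at e2
    have := levelInv_nonneg hν (M * a)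
    linarith
  have h4 := hN.trans h1
  have h5 := le_of_mul_le_mul_left h4 ha
  linarith

lemma tendsto_logLogRatio {τ : ℝ} (h2 : 2 < τ) (h3 : τ < 3) :
    Tendsto (logLogRatio τ) atTop atTop := by
  have hlog : Real.log (τ - 2) < 0 := Real.log_neg (by linarith) (by linarith)
  exact ((Real.tendsto_log_atTop.comp (Real.tendsto_log_atTop.comp
    tendsto_natCast_atTop_atTop))).atTop_div_const (abs_pos.2 hlog.ne)

lemma tendsto_normalizer (hν : ∀ᵐ x ∂ν, 0 ≤ x)
    (hsum : Tendsto (fun N : ℕ => ∑ k ∈ Finset.Icc 1 N, genInv (cdf ν) (Real.exp (-Real.exp (k : ℝ))))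
      atTop atTop) {τ : ℝ} (h2 : 2 < τ) (h3 : τ < 3) :
    Tendsto (normalizer ν τ) atTop atTop := by
  have hlog : Real.log (τ - 2) < 0 := Real.log_neg (by linarith) (by linarith)
  have h1 := (tendsto_sum_levelInv hν hsum (abs_pos.2 hlog.ne)).comp
    (tendsto_nat_floor_atTop.comp (tendsto_logLogRatio h2 h3))
  refine (h1.const_mul_atTop (two_pos (α := ℝ))).congr fun n => ?_
  rw [normalizer_eq h2 h3]; rfl

end Normalizer

/-! ### The lower bounds -/

section LowerLimit

/-- Below a fixed fraction of `log log n / a` levels, the degrees are `n ^ o(1)`. -/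
lemma eventually_mul_pow_le {a x ε c : ℝ} (ha : 0 < a) (hx : 0 < x) (hε : ε < 1)
    (hxa : (1 - ε) * x < a) (hc : 0 < c) :
    ∀ᶠ n : ℕ in atTop, ((⌈(1 - ε) * (Real.log (Real.log n) / a)⌉₊ : ℝ) + 1) *
      (Real.exp x ^ ⌈(1 - ε) * (Real.log (Real.log n) / a)⌉₊ + 1) ≤ c * Real.log n := by
  -- The power of log n to which (exp x)^k amounts, up to a constant; `μ < 1` leaves room for the
  -- extra factor log log n.
  set μ : ℝ := (1 - ε) * x / a with hμ
  have hμ1 : 0 < 1 - μ := by rw [hμ, sub_pos, div_lt_one ha]; exact hxa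
  have hμ0 : 0 < μ := by have : 0 < 1 - ε := by linarith
                         positivity
  have h1ε : 0 < 1 - ε := by linarith
  have h1 : Tendsto (fun y : ℝ => ((1 - ε) / a * (Real.log y * y ^ (-(1 - μ))) + 2 * y ^ (-(1 - μ))) *
      (Real.exp x + 1)) atTop (𝓝 (((1 - ε) / a * 0 + 2 * 0) * (Real.exp x + 1))) := by
    have h2 : Tendsto (fun y : ℝ => Real.log y * y ^ (-(1 - μ))) atTop (𝓝 0) := by
      refine ((isLittleO_log_rpow_atTop hμ1).tendsto_div_nhds_zero).congr' ?_
      filter_upwards [eventually_gt_atTop 0] with y hy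
      rw [Real.rpow_neg hy.le, div_eq_mul_inv]
    exact ((h2.const_mul _).add ((tendsto_rpow_neg_atTop hμ1).const_mul 2)).mul_const _
  rw [mul_zero, mul_zero, add_zero, zero_mul] at h1
  have h2 : ∀ᶠ y : ℝ in atTop, ((⌈(1 - ε) * (Real.log y / a)⌉₊ : ℝ) + 1) *
      (Real.exp x ^ ⌈(1 - ε) * (Real.log y / a)⌉₊ + 1) ≤ c * y := by
    filter_upwards [h1.eventually (ge_mem_nhds hc), eventually_ge_atTop 1] with y hy hy1
    have hy0 : 0 < y := by linarith
    have hL : 0 ≤ Real.log y := Real.log_nonneg hy1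
    set k := ⌈(1 - ε) * (Real.log y / a)⌉₊ with hk
    have hk1 : (k : ℝ) ≤ (1 - ε) * (Real.log y / a) + 1 :=
      (Nat.ceil_lt_add_one (by positivity)).le
    have hb : Real.exp x ^ k ≤ Real.exp x * y ^ μ := by
      rw [← Real.exp_nat_mul, Real.rpow_def_of_pos hy0, ← Real.exp_add, Real.exp_le_exp]
      calc (k : ℝ) * x ≤ ((1 - ε) * (Real.log y / a) + 1) * x := by gcongr
        _ = _ := by rw [hμ]; field_simp; ring
    have hyμ : 1 ≤ y ^ μ := Real.one_le_rpow hy1 hμ0.le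
    have hyy : y ^ (-(1 - μ)) * y = y ^ μ := by
      nth_rewrite 2 [← Real.rpow_one y]
      rw [← Real.rpow_add hy0]; congr 1; ring
    have hA : (k : ℝ) + 1 ≤ (1 - ε) / a * Real.log y + 2 := by
      have e : (1 - ε) / a * Real.log y = (1 - ε) * (Real.log y / a) := by ring
      linarith
    have hB : Real.exp x ^ k + 1 ≤ (Real.exp x + 1) * y ^ μ := by rw [add_mul]; linarith
    calc ((k : ℝ) + 1) * (Real.exp x ^ k + 1) ≤
        ((1 - ε) / a * Real.log y + 2) * ((Real.exp x + 1) * y ^ μ) :=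
          mul_le_mul hA hB (by positivity) (by positivity)
      _ = ((1 - ε) / a * (Real.log y * y ^ (-(1 - μ))) + 2 * y ^ (-(1 - μ))) *
          (Real.exp x + 1) * y := by rw [← hyy]; ring
      _ ≤ c * y := by gcongr
  exact (Real.tendsto_log_atTop.comp tendsto_natCast_atTop_atTop).eventually h2

variable {D : ∀ n : ℕ, Fin n → ℕ} {ν : Measure ℝ} [IsProbabilityMeasure ν]

set_option maxHeartbeats 1000000 in
/-- With truncation levels `exp (K β^j)`, all exceptional events for the lower bounds are unlikely. -/
lemma DegreeBounds.eventually_long {s α : ℝ} (hD : DegreeBounds D s α) (hν : ∀ᵐ x ∂ν, 0 ≤ x)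
    {β : ℝ} (hβ1 : 1 < β) (hβ : 1 < β * s) {k : ℕ → ℕ}
    (hk : ∀ c : ℝ, 0 < c → ∀ᶠ n : ℕ in atTop, ((k n : ℝ) + 1) * (β ^ k n + 1) ≤ c * Real.log n)
    {η : ℝ} (hη : 0 < η) :
    ∃ K : ℝ, 0 < K ∧ ∀ᶠ n : ℕ in atTop, sampleMeasure (D n) ν {ω | ¬ ∀ l,
      IsPath ω.1 ω.2.2.1 l ω.2.2.2 → 2 * k n < l.length ∧
      2 * ∑ i ∈ Finset.range (k n), genInv (cdf ν) (Real.exp (-(K * β ^ (i + 1)))) ≤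
        pathWeight ω.1 ω.2.1 l} ≤ ENNReal.ofReal η := by
  have hβ0 : 0 < β := by linarith
  have hs1 : 1 / β < s := by rw [div_lt_iff₀ hβ0]; linarith
  -- Between 1/β and `s`: below `s` the moment bounds hold, and `q * β > 1` makes the exit recursion
  -- contract.
  set q : ℝ := (1 / β + s) / 2 with hq
  have hq0 : 0 < q := by have : 0 < 1 / β := by positivity
                         rw [hq]; linarith
  have hqs : q < s := by rw [hq]; linarith
  have hqβ : 0 < q * β - 1 := by
    have : 1 / β < q := by rw [hq]; linarith
    rw [div_lt_iff₀ hβ0] at this; linarith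
  obtain ⟨C, κ, hC, hκ, hup⟩ := hD.upper q hq0 hqs
  obtain ⟨Λ, hΛ, hlin⟩ := hD.linear
  -- Solves A β = A + 2, so that 2 b_i g_(i+1) ≤ g_i for g_i = exp(-KAβ^i).
  set A : ℝ := 2 / (β - 1) with hA
  have hA0 : 0 < A := by have : 0 < β - 1 := by linarith
                         positivity
  have hAβ : A * β = A + 2 := by
    have : β - 1 ≠ 0 := by linarith
    rw [hA]; field_simp; ring
  -- the choice of `K`
  have hlimK : ∀ c : ℝ, 0 < c → Tendsto (fun K : ℝ => Real.exp (-(K * c))) atTop (𝓝 0) := fun c hc =>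
    Real.tendsto_exp_neg_atTop_nhds_zero.comp (tendsto_id.atTop_mul_const hc)
  have hKex : ∀ᶠ K : ℝ in atTop, 1 ≤ K ∧ 6 * C * Real.exp (-(K * (q * β - 1))) ≤ 1 ∧
      2 * (Λ * Real.exp (-(K * 1))) + 2 * (6 * C * Real.exp (-(K * (q * β - 1)))) +
        2 * Real.exp (-(K * A)) ≤ η / 2 := by
    have h1 := ((hlimK (q * β - 1) hqβ).const_mul (6 * C))
    have h2 := (((hlimK 1 one_pos).const_mul Λ).const_mul 2).add (h1.const_mul 2) |>.add
      ((hlimK A hA0).const_mul 2)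
    simp only [mul_zero, add_zero] at h1 h2
    filter_upwards [eventually_ge_atTop 1, h1.eventually (ge_mem_nhds one_pos),
      h2.eventually (ge_mem_nhds (half_pos hη))] with K e1 e2 e3 using ⟨e1, e2, e3⟩
  obtain ⟨K, hK1, hρ1, hKη⟩ := hKex.exists
  set ρ : ℝ := 6 * C * Real.exp (-(K * (q * β - 1))) with hρ
  have hρ0 : 0 < ρ := by positivity
  have hK0 : 0 < K := by linarith
  refine ⟨K * A, by positivity, ?_⟩
  -- The three bounds ensure, in this order, that n^(-κ) is at most b_j^(-q), that b_j stays below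
  -- n^α, and that (1 + B)^(2k) is at most n^(1/2).
  set c : ℝ := min (κ / (q * K)) (min (α / (2 * K)) (1 / (4 * K))) with hc
  have hα := hD.half_lt
  have hc0 : 0 < c := by
    have : 0 < α := by linarith
    positivity
  have hhalf : Tendsto (fun n : ℕ => (n : ℝ) ^ (-(1 / 2 : ℝ))) atTop (𝓝 0) :=
    (tendsto_rpow_neg_atTop (by norm_num)).comp tendsto_natCast_atTop_atTop
  filter_upwards [hk c hc0, hlin, eventually_ge_atTop 3, hhalf.eventually (ge_mem_nhds (half_pos hη))]
    with n hkn hlinn hn3 hn12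
  have hn0 : (0 : ℝ) < n := by positivity
  have hlogn : 0 < Real.log n := Real.log_pos (by exact_mod_cast (by omega : 1 < n))
  set b : ℕ → ℝ := fun j => Real.exp (K * β ^ j) with hb
  set g : ℕ → ℝ := fun j => Real.exp (-(K * A * β ^ j)) with hg
  have hkn' : β ^ k n ≤ c * Real.log n := by
    refine le_trans ?_ hkn
    have h1 : (0 : ℝ) ≤ k n := Nat.cast_nonneg _
    have h2 : 0 < β ^ k n := by positivity
    exact (le_add_of_nonneg_right zero_le_one).trans
      (le_mul_of_one_le_left (by positivity) (by linarith))
  have hβmono : ∀ j ≤ k n, β ^ j ≤ β ^ k n := fun j hj => pow_le_pow_right₀ hβ1.le hj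
  have hβone : ∀ j, 1 ≤ β ^ j := fun j => one_le_pow₀ hβ1.le
  have hℓ := hD.le_sum n
  obtain ⟨σ₀⟩ := hD.nonempty_pairing n
  have hc1 : c ≤ κ / (q * K) := min_le_left _ _
  have hc2 : c ≤ α / (2 * K) := (min_le_right _ _).trans (min_le_left _ _)
  have hc3 : c ≤ 1 / (4 * K) := (min_le_right _ _).trans (min_le_right _ _)
  -- The product is exp(-Kβ^j(qβ - 1)), largest at j = 0. The 6 in `ρ` comes from three terms of
  -- size C b^(-q) ℓ against ℓ/2, the part of the total degree ℓ surely left after removing the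
  -- known half-edges.
  have hkey : ∀ j : ℕ, b j * (b (j + 1)) ^ (-q) ≤ ρ / (6 * C) := by
    intro j
    rw [hρ, mul_div_cancel_left₀ _ (by positivity : 6 * C ≠ 0)]
    simp only [hb]
    rw [← Real.exp_mul, ← Real.exp_add, Real.exp_le_exp, pow_succ]
    nlinarith [mul_le_mul_of_nonneg_left (hβone j) (mul_pos hK0 hqβ).le]
  have hmain := sampleMeasure_not_long_le (D := D n) ν σ₀ hν (b := b)
    (θ := fun i => genInv (cdf ν) (g i)) (g := g) (ρ := ρ) (B := b (k n)) (p := Λ * Real.exp (-(K * 1)))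
    (k := k n) hρ0.le (fun j => Real.exp_pos _) (fun j hj => by
      simp only [hb]; rw [Real.exp_le_exp]; have := hβmono j hj; gcongr) (fun j => (Real.exp_pos _).le)
    (by positivity) ?_ ?_ ?_
  · refine hmain.trans (ENNReal.ofReal_le_ofReal ?_)
    have hlast : (1 + b (k n)) ^ (2 * k n) / n ≤ η / 2 := by
      refine le_trans ?_ hn12
      have h1 : 1 + b (k n) ≤ Real.exp (K * β ^ k n + 1) := by
        rw [Real.exp_add]
        have h2 : 1 ≤ b (k n) := Real.one_le_exp (by positivity)
        have h3 : (2 : ℝ) ≤ Real.exp 1 := by linarith [Real.add_one_le_exp (1 : ℝ)]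
        have h4 : b (k n) * 2 ≤ b (k n) * Real.exp 1 := by gcongr
        simp only [hb] at h2 h4 ⊢
        linarith
      have h2 : (1 + b (k n)) ^ (2 * k n) ≤ Real.exp (1 / 2 * Real.log n) := by
        refine (pow_le_pow_left₀ (by have := Real.exp_pos (K * β ^ k n); simp only [hb]; linarith) h1 _).trans ?_
        rw [← Real.exp_nat_mul, Real.exp_le_exp]
        push_cast
        have h3 : (k n : ℝ) * (K * β ^ k n + 1) ≤ K * (((k n : ℝ) + 1) * (β ^ k n + 1)) := by
          have : (0 : ℝ) ≤ k n := Nat.cast_nonneg _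
          have h4 := hβone (k n)
          nlinarith [mul_nonneg this (sub_nonneg.2 hK1)]
        have h5 : K * (((k n : ℝ) + 1) * (β ^ k n + 1)) ≤ K * (1 / (4 * K) * Real.log n) := by
          refine mul_le_mul_of_nonneg_left (hkn.trans ?_) hK0.le
          gcongr
        have h6 : K * (1 / (4 * K) * Real.log n) = 1 / 4 * Real.log n := by field_simp
        linarith
      have h3 : Real.exp (1 / 2 * Real.log n) / n = (n : ℝ) ^ (-(1 / 2 : ℝ)) := by
        nth_rewrite 2 [← Real.exp_log hn0]
        rw [← Real.exp_sub, Real.rpow_def_of_pos hn0]; congr 1; ring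
      rw [← h3]; gcongr
    have hg0 : g 0 = Real.exp (-(K * A)) := by simp [hg]
    rw [hg0]; linarith
  · intro j hj
    have hbj : 0 < b j := Real.exp_pos _
    have hbj1 : 0 < b (j + 1) := Real.exp_pos _
    obtain ⟨hu1, hu2⟩ := hup n (by omega) (b (j + 1)) hbj1
    have hlog1 : K * β ^ (j + 1) ≤ K * (c * Real.log n) := by
      have := (hβmono (j + 1) hj).trans hkn'
      gcongr
    have hbα : b (j + 1) < (n : ℝ) ^ α := by
      simp only [hb]
      rw [Real.rpow_def_of_pos hn0, Real.exp_lt_exp]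
      have h1 : K * (c * Real.log n) ≤ K * (α / (2 * K) * Real.log n) := by gcongr
      have h2 : K * (α / (2 * K) * Real.log n) = α / 2 * Real.log n := by field_simp
      have h3 : 0 < α * Real.log n := mul_pos (by linarith) hlogn
      linarith
    have hbκ : (n : ℝ) ^ (-κ) ≤ b (j + 1) ^ (-q) := by
      simp only [hb]
      rw [Real.rpow_def_of_pos hn0, ← Real.exp_mul, Real.exp_le_exp]
      have h1 : K * (c * Real.log n) ≤ K * (κ / (q * K) * Real.log n) := by gcongr
      have h2 : q * (K * (κ / (q * K) * Real.log n)) = κ * Real.log n := by field_simp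
      have h3 := mul_le_mul_of_nonneg_left (hlog1.trans h1) hq0.le
      linarith
    have hu3 := hu2 hbα
    set ℓ : ℝ := ((∑ v, D n v : ℕ) : ℝ) with hℓdef
    have hℓ0 : 0 ≤ ℓ := by linarith
    have hk2 : ((2 * k n : ℕ) : ℝ) + 1 ≤ ℓ / 2 := by
      have h1 : (k n : ℝ) + 1 ≤ c * Real.log n := by
        refine le_trans (le_mul_of_one_le_right (by positivity) ?_) hkn
        linarith [hβone (k n)]
      have h2 : c * Real.log n ≤ 1 / 4 * Real.log n := by
        gcongr
        refine hc3.trans ?_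
        gcongr; linarith
      have h3 : Real.log n ≤ n := (Real.log_le_sub_one_of_pos hn0).trans (by linarith)
      push_cast; linarith
    have hb1 : ρ / b (j + 1) * (C * b (j + 1) ^ (1 - q) * n) ≤ C * b (j + 1) ^ (-q) * ℓ := by
      have e : b (j + 1) ^ (1 - q) = b (j + 1) * b (j + 1) ^ (-q) := by
        rw [sub_eq_add_neg, Real.rpow_add hbj1, Real.rpow_one]
      rw [e]
      have : ρ / b (j + 1) * (C * (b (j + 1) * b (j + 1) ^ (-q)) * n) =
          C * b (j + 1) ^ (-q) * (ρ * n) := by field_simp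
      rw [this]
      refine mul_le_mul_of_nonneg_left ?_ (by positivity)
      exact (mul_le_of_le_one_left hn0.le hρ1).trans (by linarith)
    have hP : 0 < b (j + 1) ^ (-q) := by positivity
    calc _ ≤ C * (b (j + 1) ^ (-q) + (n : ℝ) ^ (-κ)) * ℓ +
          ρ / b (j + 1) * (C * b (j + 1) ^ (1 - q) * n) := by
          gcongr
      _ ≤ C * (b (j + 1) ^ (-q) + b (j + 1) ^ (-q)) * ℓ + C * b (j + 1) ^ (-q) * ℓ := by
          gcongr
      _ = 6 * C * b (j + 1) ^ (-q) * (ℓ / 2) := by ring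
      _ ≤ ρ / b j * (ℓ / 2) := by
          gcongr
          rw [le_div_iff₀ hbj]
          have := hkey j
          rw [le_div_iff₀ (by positivity)] at this
          linarith
      _ ≤ ρ / b j * (ℓ - (2 * k n : ℕ) - 1) := by
          gcongr; linarith
  · intro i _
    have h1 : ν.real (Set.Iio (genInv (cdf ν) (g (i + 1)))) ≤ g (i + 1) :=
      real_Iio_genInv_le ν hν (Real.exp_pos _)
    have hbi : 0 < b i := Real.exp_pos _
    calc b i * (ν.real (Set.Iio (genInv (cdf ν) (g (i + 1)))) + g (i + 1)) ≤
        b i * (g (i + 1) + g (i + 1)) := by gcongr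
      _ = 2 * (b i * g (i + 1)) := by ring
      _ ≤ Real.exp 1 * (b i * g (i + 1)) := by
          have : (2 : ℝ) ≤ Real.exp 1 := by linarith [Real.add_one_le_exp (1 : ℝ)]
          have h3 : 0 ≤ b i * g (i + 1) := (mul_pos hbi (Real.exp_pos _)).le
          gcongr
      _ ≤ g i := by
          simp only [hb, hg]
          rw [← Real.exp_add, ← Real.exp_add, Real.exp_le_exp, pow_succ]
          have h4 : K * A * (β ^ i * β) = K * β ^ i * (A * β) := by ring
          have h5 : 1 ≤ K * β ^ i := one_le_mul_of_one_le_of_one_le hK1 (hβone i)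
          rw [h4, hAβ]
          linarith
  -- Markov's inequality for the degree of a uniform vertex.
  · have hb0 : b 0 = Real.exp K := by simp [hb]
    have h1 : b 0 * ((Finset.univ.filter fun v => b 0 < D n v).card : ℝ) ≤ Λ * n := by
      refine le_trans ?_ hlinn
      calc _ = ∑ v ∈ Finset.univ.filter fun v => b 0 < D n v, b 0 := by
            rw [Finset.sum_const, nsmul_eq_mul, mul_comm]
        _ ≤ ∑ v ∈ Finset.univ.filter fun v => b 0 < D n v, (D n v : ℝ) :=
            Finset.sum_le_sum fun v hv => (Finset.mem_filter.1 hv).2.le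
        _ ≤ ∑ v, (D n v : ℝ) := Finset.sum_le_sum_of_subset_of_nonneg (Finset.filter_subset _ _)
            fun _ _ _ => Nat.cast_nonneg _
        _ = _ := by push_cast; rfl
    rw [hb0] at h1 ⊢
    rw [mul_one, Real.exp_neg, mul_right_comm, ← div_eq_mul_inv, le_div_iff₀ (Real.exp_pos K)]
    linarith

end LowerLimit

section LowerLimit

variable {D : ∀ n : ℕ, Fin n → ℕ} {ν : Measure ℝ} [IsProbabilityMeasure ν]

/-- The quantiles of `eventually_long` are values of `levelInv` at (i + 1)x + log K with x slightly
above |log (τ - 2)|; a slightly larger step still absorbs log K for all but finitely many `i`. -/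
lemma DegreeBounds.eventually_lower {τ α : ℝ} (h2 : 2 < τ) (h3 : τ < 3)
    (hD : DegreeBounds D (τ - 2) α) (hν : ∀ᵐ x ∂ν, 0 ≤ x)
    (hsum : Tendsto (fun N : ℕ => ∑ k ∈ Finset.Icc 1 N, genInv (cdf ν) (Real.exp (-Real.exp (k : ℝ))))
      atTop atTop) {ε η : ℝ} (hε : 0 < ε) (hε1 : ε < 1) (hη : 0 < η) :
    ∀ᶠ n : ℕ in atTop, sampleMeasure (D n) ν {ω | ¬ ∀ l,
      IsPath ω.1 ω.2.2.1 l ω.2.2.2 → (1 - ε) * (2 * logLogRatio τ n) ≤ l.length ∧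
      (1 - ε) * normalizer ν τ n ≤ pathWeight ω.1 ω.2.1 l} ≤ ENNReal.ofReal η := by
  have hs : 0 < τ - 2 := by linarith
  have hlog : Real.log (τ - 2) < 0 := Real.log_neg hs (by linarith)
  set a : ℝ := |Real.log (τ - 2)| with ha
  have ha0 : 0 < a := abs_pos.2 hlog.ne
  set e : ℝ := ε / 2 with he
  have he1 : 0 < 1 - e := by linarith
  have he0 : 0 < e := by positivity
  -- The step whose ratio to `a` costs exactly the factor 1/(1 - e) in the integral comparison. The
  -- growth rate `x` is chosen strictly between `a` and `b`.
  set b : ℝ := a / (1 - e) with hb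
  have hab : a < b := by rw [hb, lt_div_iff₀ he1]; nlinarith
  set x : ℝ := (a + b) / 2 with hx
  have hxa : a < x := by rw [hx]; linarith
  have hxb : x < b := by rw [hx]; linarith
  have hx0 : 0 < x := by linarith
  have hx1 : (1 - e) * x < a := by rw [hb, lt_div_iff₀ he1] at hxb; linarith
  have hβs : 1 < Real.exp x * (τ - 2) := by
    have : τ - 2 = Real.exp (-a) := by rw [ha, abs_of_neg hlog, neg_neg, Real.exp_log hs]
    rw [this, ← Real.exp_add]; exact Real.one_lt_exp_iff.2 (by linarith)
  set k : ℕ → ℕ := fun n => ⌈(1 - e) * (Real.log (Real.log n) / a)⌉₊ with hk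
  obtain ⟨K, hK, hev⟩ := hD.eventually_long hν (Real.one_lt_exp_iff.2 hx0) hβs (k := k)
    (fun c hc => eventually_mul_pow_le ha0 hx0 (by linarith) hx1 hc) hη
  -- From index `i₀` on, the difference between the progressions with steps `b` and `x` exceeds log
  -- K; the earlier terms cost a constant, absorbed into e times the normalising sum.
  obtain ⟨i₀, hi₀⟩ := exists_nat_gt (Real.log K / (b - x))
  have hN := tendsto_normalizer hν hsum h2 h3
  have hR := tendsto_logLogRatio h2 h3
  filter_upwards [hev, hN.eventually_ge_atTop (2 * ((i₀ + 1) * levelInv ν 0) / e),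
    hR.eventually_ge_atTop 0] with n hn hNn hRn
  refine (measure_mono ?_).trans hn
  intro ω hω hcon
  refine hω fun l hl => ?_
  obtain ⟨hlen, hwt⟩ := hcon l hl
  have hkn : (1 - e) * logLogRatio τ n ≤ k n := Nat.le_ceil _
  constructor
  · have h4 : (2 * k n : ℝ) ≤ l.length := by exact_mod_cast hlen.le
    have h5 : (1 - ε) * (2 * logLogRatio τ n) ≤ (1 - e) * (2 * logLogRatio τ n) := by
      gcongr; linarith
    linarith
  · refine le_trans ?_ hwt
    have hanti := levelInv_antitone hν
    have hpos := levelInv_nonneg hν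
    have hθ : ∀ i : ℕ, genInv (cdf ν) (Real.exp (-(K * Real.exp x ^ (i + 1)))) =
        levelInv ν ((i + 1 : ℕ) * x + Real.log K) := by
      intro i
      rw [levelInv, Real.exp_add, Real.exp_log hK, Real.exp_nat_mul, mul_comm]
    simp only [hθ]
    set T : ℝ := ∑ i ∈ Finset.range (k n), levelInv ν ((i + 1 : ℕ) * x + Real.log K) with hT
    have h4 := sum_le_mul_sum_of_antitone hanti hpos (ha0.trans hab) ha0
      (N := ⌊logLogRatio τ n⌋₊) (N' := k n) (by
        have h5 : (⌊logLogRatio τ n⌋₊ : ℝ) ≤ logLogRatio τ n := Nat.floor_le hRn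
        calc (⌊logLogRatio τ n⌋₊ : ℝ) * a ≤ logLogRatio τ n * a := by gcongr
          _ = (1 - e) * logLogRatio τ n * b := by rw [hb]; field_simp
          _ ≤ k n * b := by gcongr)
    have hba : b / a = 1 / (1 - e) := by rw [hb]; field_simp
    have h5 : ∑ i ∈ Finset.range (k n), levelInv ν (i * b) ≤ (i₀ + 1) * levelInv ν 0 + T := by
      have e1 := Finset.sum_range_succ (fun i : ℕ => levelInv ν (i * b)) (k n)
      have e2 := Finset.sum_range_succ' (fun i : ℕ => levelInv ν (i * b)) (k n)
      simp only [Nat.cast_zero, zero_mul] at e2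
      have e3 := hpos (k n * b)
      have e4 : ∑ i ∈ Finset.range (k n), levelInv ν ((i + 1 : ℕ) * b) ≤
          ∑ i ∈ Finset.range (k n), ((if i < i₀ then levelInv ν 0 else 0) +
            levelInv ν ((i + 1 : ℕ) * x + Real.log K)) := by
        refine Finset.sum_le_sum fun i _ => ?_
        split_ifs with hi
        · have h6 : levelInv ν ((i + 1 : ℕ) * b) ≤ levelInv ν 0 := hanti (by positivity)
          linarith [hpos ((i + 1 : ℕ) * x + Real.log K)]
        · rw [zero_add]
          apply hanti
          rw [div_lt_iff₀ (by linarith)] at hi₀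
          have h7 : (i₀ : ℝ) ≤ (i + 1 : ℕ) := by exact_mod_cast (by omega : i₀ ≤ i + 1)
          have h8 : (i₀ : ℝ) * (b - x) ≤ (i + 1 : ℕ) * (b - x) :=
            mul_le_mul_of_nonneg_right h7 (by linarith)
          linarith
      rw [Finset.sum_add_distrib] at e4
      have e5 : ∑ i ∈ Finset.range (k n), (if i < i₀ then levelInv ν 0 else 0) ≤
          i₀ * levelInv ν 0 := by
        rw [← Finset.sum_filter, Finset.sum_const, nsmul_eq_mul]
        refine mul_le_mul_of_nonneg_right ?_ (hpos 0)
        have : ((Finset.range (k n)).filter fun i => i < i₀).card ≤ i₀ := by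
          refine (Finset.card_le_card fun i hi => ?_).trans_eq (Finset.card_range i₀)
          exact Finset.mem_range.2 (Finset.mem_filter.1 hi).2
        exact_mod_cast this
      linarith
    rw [div_le_iff₀ he0] at hNn
    have h6 : normalizer ν τ n ≤ 2 * (1 / (1 - e) * ((i₀ + 1) * levelInv ν 0 + T)) := by
      rw [normalizer_eq h2 h3, ← ha, ← hba]
      gcongr
      refine h4.trans ?_
      gcongr
    have h7 : (1 - e) * normalizer ν τ n ≤ 2 * ((i₀ + 1) * levelInv ν 0 + T) := by
      calc (1 - e) * normalizer ν τ n ≤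
          (1 - e) * (2 * (1 / (1 - e) * ((i₀ + 1) * levelInv ν 0 + T))) := by gcongr
        _ = _ := by field_simp
    have h8 : ε = e + e := by rw [he]; ring
    rw [h8]
    linarith

end LowerLimit

/-! ### The upper bounds -/

section UpperLimit

lemma one_sub_mul_div_pow_le {p p' T t ℓ A : ℝ} {m : ℕ} (hp0 : 0 ≤ p) (hp : p ≤ p') (hp1 : p' ≤ 1)
    (hT0 : 0 ≤ T) (hT : T ≤ t) (htℓ : t ≤ ℓ) (hℓ : 0 < ℓ) (hA : A ≤ m) :
    (1 - p' * t / ℓ) ^ m ≤ Real.exp (-(p * T * A / ℓ)) := by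
  have h0 : 0 ≤ 1 - p' * t / ℓ := by
    rw [sub_nonneg, div_le_one hℓ]
    calc p' * t ≤ 1 * t := mul_le_mul_of_nonneg_right hp1 (hT0.trans hT)
      _ ≤ ℓ := by linarith
  have h1 : 1 - p' * t / ℓ ≤ Real.exp (-(p * T / ℓ)) := by
    have h2 : p * T / ℓ ≤ p' * t / ℓ := by gcongr; exact hp0.trans hp
    linarith [Real.add_one_le_exp (-(p * T / ℓ))]
  refine (pow_le_pow_left₀ h0 h1 m).trans ?_
  rw [← Real.exp_nat_mul, Real.exp_le_exp]
  have h3 : 0 ≤ p * T / ℓ := by positivity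
  have h4 : p * T * A / ℓ = p * T / ℓ * A := by ring
  rw [h4]
  nlinarith [mul_le_mul_of_nonneg_left hA h3]

lemma div_eight_le_floor {y : ℝ} (hy : 8 ≤ y) : y / 8 ≤ (⌊y / 4⌋₊ : ℝ) := by
  have := Nat.lt_floor_add_one (y / 4)
  linarith

lemma div_four_le_floor {y : ℝ} (hy : 4 ≤ y) : y / 4 ≤ (⌊y / 2⌋₊ : ℝ) := by
  have := Nat.lt_floor_add_one (y / 2)
  linarith

/-- At most `y / 2` half-edges are known, so `y / 4` trials of two half-edges each are available at
`x`, and half of the `Y` half-edges of `V` remain free throughout. -/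
lemma avg_stuck_le_exp {n : ℕ} {D : Fin n → ℕ} (ν : Measure ℝ) [IsProbabilityMeasure ν]
    {σ₀ : Pairing (HalfEdge D)} {S : Finset (HalfEdge D)} (hS : ClosedUnder σ₀ S)
    (V : Finset (Fin n)) (θ : ℝ) (x : Fin n) {y Y p : ℝ} (hy : 8 ≤ y) (hyx : y ≤ D x)
    (hSy : (S.card : ℝ) ≤ y / 2) (hyY : y ≤ Y / 2) (hY : Y ≤ ((∑ v ∈ V, D v : ℕ) : ℝ))
    (hp0 : 0 ≤ p) (hp : p ≤ cdf ν θ) :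
    AvgLE σ₀ S (fun σ => lengthProb D ν {L | Stuck V θ σ L x})
      (Real.exp (-(p * (Y / 4) * (y / 8) / ((∑ v, D v : ℕ) : ℝ)))) := by
  have hm := Nat.floor_le (by linarith : 0 ≤ y / 4)
  have ht := Nat.floor_le (by linarith : 0 ≤ Y / 2)
  have hVℓ : ((∑ v ∈ V, D v : ℕ) : ℝ) ≤ ((∑ v, D v : ℕ) : ℝ) := by
    exact_mod_cast Finset.sum_le_sum_of_subset (Finset.subset_univ V)
  refine (avg_stuck_le ν hS V θ x ⌊y / 4⌋₊ ⌊Y / 2⌋₊ ?_ ?_).mono (fun _ _ => le_rfl) ?_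
  · have : ((2 * ⌊y / 4⌋₊ + S.card : ℕ) : ℝ) ≤ D x := by push_cast; linarith
    exact_mod_cast this
  · have : ((⌊Y / 2⌋₊ + S.card + 2 * ⌊y / 4⌋₊ : ℕ) : ℝ) ≤ ((∑ v ∈ V, D v : ℕ) : ℝ) := by
      push_cast at hY ⊢; linarith
    exact_mod_cast this
  · exact one_sub_mul_div_pow_le hp0 hp (cdf_le_one ν θ) (by linarith)
      (div_four_le_floor (by linarith)) (by linarith) (by linarith) (div_eight_le_floor hy)

/-- Requirements on the starting level `M`. -/
lemma eventually_start_level {β q r A ω c η : ℝ} (hβ : 1 < β) (hq : 0 < q) (hqr : q < r) (hr : r < 1)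
    (hA : 2 ≤ A) (hω : 0 < ω) (hc : 0 < c) (hη : 0 < η) :
    ∀ᶠ M : ℝ in atTop, 8 ≤ M ∧ 1 ≤ Real.log M ∧ 1 ≤ ω * Real.log M ∧
      (∀ i : ℕ, ((2 * ⌈M ^ r⌉₊ + 2 * i : ℕ) : ℝ) ≤ M ^ (β ^ i) / 2) ∧
      (∀ y : ℝ, M ≤ y → Real.exp (-(c * y ^ ω)) ≤ 1 / 2 * y ^ (-A)) ∧
      (1 - c * M ^ (-q)) ^ ⌈M ^ r⌉₊ ≤ η ∧ c * M ^ (-q) ≤ 1 ∧ 0 ≤ c * M ^ (-q) ∧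
      (⌈M ^ r⌉₊ : ℝ) * M ^ (-A) ≤ η := by
  have h1 : ∀ᶠ M : ℝ in atTop, M ^ (-(1 - r)) ≤ 1 / 8 :=
    (tendsto_rpow_neg_atTop (by linarith : 0 < 1 - r)).eventually (ge_mem_nhds (by norm_num))
  have h2 : ∀ᶠ y : ℝ in atTop, Real.exp (-(c * y ^ ω)) ≤ 1 / 2 * y ^ (-A) := by
    have h3 := (tendsto_rpow_mul_exp_neg_mul_atTop_nhds_zero (A / ω) c hc).comp
      (tendsto_rpow_atTop hω)
    filter_upwards [h3.eventually (ge_mem_nhds (by norm_num : (0 : ℝ) < 1 / 2)),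
      eventually_gt_atTop 0] with y hy hy0
    simp only [Function.comp_apply] at hy
    rw [← Real.rpow_mul hy0.le, mul_div_cancel₀ _ hω.ne', neg_mul] at hy
    rw [Real.rpow_neg hy0.le, ← div_eq_mul_inv, le_div_iff₀ (Real.rpow_pos_of_pos hy0 A)]
    linarith
  obtain ⟨y₀, hy₀⟩ := eventually_atTop.1 h2
  have h3 : ∀ᶠ M : ℝ in atTop, c * M ^ (-q) ≤ 1 := by
    have := (tendsto_rpow_neg_atTop hq).const_mul c
    rw [mul_zero] at this
    exact this.eventually (ge_mem_nhds one_pos)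
  have h4 : ∀ᶠ M : ℝ in atTop, Real.exp (-(c * M ^ (r - q))) ≤ η := by
    have : Tendsto (fun M : ℝ => c * M ^ (r - q)) atTop atTop :=
      (tendsto_rpow_atTop (by linarith)).const_mul_atTop hc
    exact (Real.tendsto_exp_neg_atTop_nhds_zero.comp this).eventually (ge_mem_nhds hη)
  filter_upwards [h1, h3, h4, eventually_ge_atTop 8, eventually_ge_atTop y₀,
    eventually_ge_atTop η⁻¹, Real.tendsto_log_atTop.eventually_ge_atTop (max 1 (max (1 / ω) (1 / (β - 1))))]
    with M e1 e3 e4 e5 e6 e7 e8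
  have hM0 : 0 < M := by linarith
  have hl1 : 1 ≤ Real.log M := (le_max_left _ _).trans e8
  have hl2 : 1 / ω ≤ Real.log M := ((le_max_left _ _).trans (le_max_right _ _)).trans e8
  have hl3 : 1 / (β - 1) ≤ Real.log M := ((le_max_right _ _).trans (le_max_right _ _)).trans e8
  have hMr : M ^ r ≤ M / 8 := by
    have : M ^ r = M * M ^ (-(1 - r)) := by
      nth_rewrite 2 [← Real.rpow_one M]
      rw [← Real.rpow_add hM0]; congr 1; ring
    rw [this]
    calc M * M ^ (-(1 - r)) ≤ M * (1 / 8) := by gcongr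
      _ = M / 8 := by ring
  have hR : (⌈M ^ r⌉₊ : ℝ) ≤ M / 4 := by
    have := (Nat.ceil_lt_add_one (by positivity : 0 ≤ M ^ r)).le
    linarith
  have hpos : 0 ≤ c * M ^ (-q) := by positivity
  refine ⟨e5, hl1, ?_, fun i => ?_, fun y hy => hy₀ y (e6.trans hy), ?_, e3, hpos, ?_⟩
  · rw [div_le_iff₀ hω] at hl2; linarith
  -- By Bernoulli's inequality the degrees at level `i` outgrow the number of known half-edges,
  -- which is only linear in `i`.
  · have hb : 1 + i * (β - 1) ≤ β ^ i := by
      have := one_add_mul_le_pow (by linarith : -2 ≤ β - 1) i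
      rwa [add_sub_cancel] at this
    have h5 : M * (1 + i) ≤ M ^ (β ^ i) := by
      calc M * (1 + i) ≤ M * M ^ (i * (β - 1)) := by
            gcongr
            rw [Real.rpow_def_of_pos hM0]
            have h6 : (1 : ℝ) ≤ (β - 1) * Real.log M := by
              rw [div_le_iff₀ (by linarith)] at hl3; linarith
            have h7 : (i : ℝ) * 1 ≤ i * ((β - 1) * Real.log M) := by gcongr
            have := Real.add_one_le_exp (Real.log M * (i * (β - 1)))
            linarith
        _ = M ^ (1 + i * (β - 1)) := by rw [Real.rpow_add hM0, Real.rpow_one]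
        _ ≤ M ^ (β ^ i) := Real.rpow_le_rpow_of_exponent_le (by linarith) hb
    have hi : (0 : ℝ) ≤ i := Nat.cast_nonneg i
    push_cast
    nlinarith
  · refine le_trans ?_ e4
    have h5 : 1 - c * M ^ (-q) ≤ Real.exp (-(c * M ^ (-q))) := by
      linarith [Real.add_one_le_exp (-(c * M ^ (-q)))]
    refine (pow_le_pow_left₀ (by linarith) h5 _).trans ?_
    rw [← Real.exp_nat_mul, Real.exp_le_exp, sub_eq_add_neg, Real.rpow_add hM0]
    have := mul_le_mul_of_nonneg_right (Nat.le_ceil (M ^ r)) hpos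
    linarith
  · have h5 : M ^ (-A) ≤ M ^ (-2 : ℝ) :=
      Real.rpow_le_rpow_of_exponent_le (by linarith) (by linarith)
    have h6 : M ^ (-2 : ℝ) = M⁻¹ * M⁻¹ := by
      rw [Real.rpow_neg hM0.le, Real.rpow_two, sq, mul_inv]
    calc (⌈M ^ r⌉₊ : ℝ) * M ^ (-A) ≤ M * (M⁻¹ * M⁻¹) := by
          rw [← h6]; gcongr; linarith
      _ = M⁻¹ := by field_simp
      _ ≤ η := inv_le_of_inv_le₀ hη e7

variable {D : ∀ n : ℕ, Fin n → ℕ} {ν : Measure ℝ} [IsProbabilityMeasure ν]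

set_option maxHeartbeats 1000000 in
-- The constants `R` and `W` do not depend on `n`: the search for a first vertex of large degree
-- costs a bounded amount, and `levelInv ν 0` pays for the edge joining the two climbs.
lemma DegreeBounds.eventually_short {s α : ℝ} (hD : DegreeBounds D s α) (hs0 : 0 < s) (hs1 : s < 1)
    (hν : ∀ᵐ x ∂ν, 0 ≤ x) {β : ℝ} (hβ1 : 1 < β) (hβs : β * s < 1) {η : ℝ} (hη : 0 < η) :
    ∃ (R : ℕ) (W : ℝ), 0 ≤ W ∧ ∀ᶠ n : ℕ in atTop, sampleMeasure (D n) ν {ω | ¬ ∃ l,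
      IsPath ω.1 ω.2.2.1 l ω.2.2.2 ∧ pathWeight ω.1 ω.2.1 l ≤ 2 * (R * W + ∑ j ∈ Finset.range
        ⌈Real.log (Real.log n) / Real.log β⌉₊, levelInv ν (j * Real.log β)) + levelInv ν 0 ∧
      l.length ≤ 2 * (R + ⌈Real.log (Real.log n) / Real.log β⌉₊) + 1} ≤ ENNReal.ofReal η := by
  have hβ0 : 0 < β := by linarith
  -- exponents
  set q : ℝ := (s + 1 / β) / 2 with hq
  have hsβ : s < 1 / β := by rw [lt_div_iff₀ hβ0]; linarith
  have hsq : s < q := by rw [hq]; linarith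
  have hqβ : q * β < 1 := by
    have : q < 1 / β := by rw [hq]; linarith
    rwa [lt_div_iff₀ hβ0] at this
  have hq0 : 0 < q := by linarith
  have hq1 : q < 1 := (lt_mul_of_one_lt_right hq0 hβ1).trans hqβ
  -- The initial walk has about M^r steps: `r > q` is enough to hit degree M, and `r < 1` keeps the
  -- known half-edges fewer than those of a vertex of degree M.
  set r : ℝ := (1 + q) / 2 with hr
  have hqr : q < r := by rw [hr]; linarith
  have hr1 : r < 1 := by rw [hr]; linarith
  -- Of about Y^(2ω₀) edges to the next layer, each is short with probability at least Y^(-ω₀),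
  -- which leaves about Y^(ω₀) short ones.
  set ω₀ : ℝ := (1 - q * β) / 2 with hω₀
  have hω : 0 < ω₀ := by rw [hω₀]; linarith
  -- Makes βA ≥ A + 3. The failure bound Y^(-A) then survives multiplication by the maximal degree
  -- 2Y^(1+ζ) of a layer, as ζ ≤ 1.
  set A : ℝ := 3 / (β - 1) + 2 with hA
  have hβ' : 0 < β - 1 := by linarith
  have hA2 : 2 ≤ A := by
    have : 0 ≤ 3 / (β - 1) := by positivity
    linarith
  have hAβ : A + 3 ≤ β * A := by
    have : (β - 1) * A = 3 + 2 * (β - 1) := by rw [hA]; field_simp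
    linarith
  have hαh := hD.half_lt
  have h1q : 1 / 2 < 1 / (1 + q) := by
    rw [div_lt_div_iff₀ (by norm_num) (by linarith)]; linarith
  -- Above 1/2, so that two top vertices share a positive power of n of edges; below 1/(1 + q), so
  -- that the top layer still has more half-edges, of order n^(1 - qα₁), than one of its vertices
  -- needs.
  set α₁ : ℝ := (1 / 2 + min α (1 / (1 + q))) / 2 with hα₁
  have hmin : 1 / 2 < min α (1 / (1 + q)) := lt_min hαh h1q
  have hα₁h : 1 / 2 < α₁ := by rw [hα₁]; linarith
  have hα₁α : α₁ < α := by
    have := min_le_left α (1 / (1 + q))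
    rw [hα₁]; linarith
  have hα₁q : α₁ * (1 + q) < 1 := by
    have h1 := min_le_right α (1 / (1 + q))
    have h2 : α₁ < 1 / (1 + q) := by rw [hα₁]; linarith
    rwa [lt_div_iff₀ (by linarith)] at h2
  have hα₁0 : 0 < α₁ := by linarith
  have hα₁1 : α₁ < 1 := (lt_mul_of_one_lt_right hα₁0 (by linarith)).trans hα₁q
  -- Keeps the upper end of the top layer within the range `n ^ α` of the tail bounds.
  set ζ : ℝ := min 1 ((α - α₁) / (2 * α₁)) with hζ
  have hζ0 : 0 < ζ := by
    have : 0 < α - α₁ := by linarith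
    positivity
  have hζ1 : ζ ≤ 1 := min_le_left _ _
  have hζα : α₁ * (1 + ζ) < α := by
    have h1 : ζ ≤ (α - α₁) / (2 * α₁) := min_le_right _ _
    have h2 : α₁ * ζ ≤ α₁ * ((α - α₁) / (2 * α₁)) := by gcongr
    have h3 : α₁ * ((α - α₁) / (2 * α₁)) = (α - α₁) / 2 := by field_simp
    linarith
  obtain ⟨Λ, hΛ, hlin⟩ := hD.linear
  obtain ⟨M₀, hM₀, hlow⟩ := hD.lower (q - s) ζ (by linarith) hζ0
  have hexp : -s - (q - s) = -q := by ring
  rw [hexp] at hlow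
  -- constants
  set c₀ : ℝ := min (1 / (32 * Λ)) (1 / (2 * Λ)) with hc₀
  have hc₀0 : 0 < c₀ := by positivity
  have hc₀1 : c₀ ≤ 1 / (32 * Λ) := min_le_left _ _
  have hc₀2 : c₀ ≤ 1 / (2 * Λ) := min_le_right _ _
  set η' : ℝ := η / 16 with hη'
  have hη'0 : 0 < η' := by positivity
  obtain ⟨M, ⟨hM8, hMl, hMω, hMR, hMexp, hMavoid, hMρ1, hMρ0, hMg⟩, hMM₀⟩ :=
    ((eventually_start_level hβ1 hq0 hqr hr1 hA2 hω hc₀0 hη'0).and (eventually_ge_atTop M₀)).exists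
  set R : ℕ := ⌈M ^ r⌉₊ with hR
  have hM0 : 0 < M := by linarith
  have hM1 : 1 ≤ M := by linarith
  obtain ⟨W, hW0, hW⟩ : ∃ W : ℝ, 0 ≤ W ∧ R * (1 - cdf ν W) ≤ η' := by
    have h1 : Tendsto (fun W => (R : ℝ) * (1 - cdf ν W)) atTop (𝓝 (R * (1 - 1))) :=
      ((tendsto_cdf_atTop ν).const_sub 1).const_mul _
    rw [sub_self, mul_zero] at h1
    obtain ⟨W, h2, h3⟩ := ((h1.eventually (ge_mem_nhds hη'0)).and (eventually_ge_atTop 0)).exists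
    exact ⟨W, h3, h2⟩
  refine ⟨R, W, hW0, ?_⟩
  set Y : ℕ → ℝ := fun i => M ^ (β ^ i) with hY
  have hβone : ∀ i : ℕ, 1 ≤ β ^ i := fun i => one_le_pow₀ hβ1.le
  have hYM : ∀ i, M ≤ Y i := fun i => by
    simp only [hY]; nth_rewrite 1 [← Real.rpow_one M]
    exact Real.rpow_le_rpow_of_exponent_le hM1 (hβone i)
  have hMM8 : ∀ i, 8 ≤ Y i := fun i => hM8.trans (hYM i)
  have hYsucc : ∀ i, Y (i + 1) = Y i ^ β := fun i => by
    simp only [hY]; rw [← Real.rpow_mul hM0.le, pow_succ]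
  set θ : ℕ → ℝ := fun i => genInv (cdf ν) (Real.exp (-(ω₀ * Real.log M * β ^ i))) with hθ
  have hlogβ : 0 < Real.log β := Real.log_pos hβ1
  have hθle : ∀ i, θ i ≤ levelInv ν (i * Real.log β) := fun i => by
    refine genInv_mono ν hν (Real.exp_pos _) ?_ (exp_neg_exp_lt_one _)
    rw [Real.exp_le_exp, neg_le_neg_iff, Real.exp_nat_mul, Real.exp_log hβ0]
    exact le_mul_of_one_le_left (by linarith [hβone i]) hMω
  have hθcdf : ∀ i, Y i ^ (-ω₀) ≤ cdf ν (θ i) := fun i => by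
    have h1 : Y i ^ (-ω₀) = Real.exp (-(ω₀ * Real.log M * β ^ i)) := by
      simp only [hY]
      rw [← Real.rpow_mul hM0.le, Real.rpow_def_of_pos hM0]; congr 1; ring
    rw [h1]
    refine le_cdf_genInv ν hν (Real.exp_pos _) ?_
    rw [Real.exp_lt_one_iff, neg_lt_zero]
    have := hβone i
    have h2 : 0 < ω₀ * Real.log M := by linarith
    positivity
  -- largeness of `n`
  have hpow : ∀ e : ℝ, 0 < e → Tendsto (fun n : ℕ => (n : ℝ) ^ e) atTop atTop := fun e he =>
    (tendsto_rpow_atTop he).comp tendsto_natCast_atTop_atTop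
  have hn1 := (hpow α₁ hα₁0).eventually_ge_atTop (max M 8)
  have hn2 := (hpow (1 - α₁ * (1 + q)) (by linarith)).eventually_ge_atTop 2
  have hn3 := tendsto_natCast_atTop_atTop.eventually_ge_atTop
    (2 * (2 * R + 1) * M ^ q + (2 * R + 1) * (R + 1) / η' + (2 * R + 1) : ℝ)
  have hn4 : ∀ᶠ n : ℕ in atTop, (n : ℝ) ^ 2 *
      Real.exp (-(Real.exp (-1) / (32 * Λ) * (n : ℝ) ^ (2 * α₁ - 1))) ≤ η' := by
    have h1 : 0 < 2 * α₁ - 1 := by linarith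
    have h2 := (tendsto_rpow_mul_exp_neg_mul_atTop_nhds_zero (2 / (2 * α₁ - 1))
      (Real.exp (-1) / (32 * Λ)) (by positivity)).comp (hpow (2 * α₁ - 1) h1)
    filter_upwards [h2.eventually (ge_mem_nhds hη'0)] with n hn
    simp only [Function.comp_apply] at hn
    rw [← Real.rpow_mul (Nat.cast_nonneg n), mul_div_cancel₀ _ h1.ne', Real.rpow_two, neg_mul] at hn
    exact hn
  filter_upwards [hn1, hn2, hn3, hn4, hlin, eventually_ge_atTop 3] with n hn1 hn2 hn3 hn4 hlinn hn5
  have hn0 : (0 : ℝ) < n := by positivity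
  have hlogn : 0 < Real.log n := Real.log_pos (by exact_mod_cast (by omega : 1 < n))
  have hnM : M ≤ (n : ℝ) ^ α₁ := (le_max_left _ _).trans hn1
  have hn8 : 8 ≤ (n : ℝ) ^ α₁ := (le_max_right _ _).trans hn1
  set ℓ : ℝ := ((∑ v, D n v : ℕ) : ℝ) with hℓ
  have h2ℓ : 2 * (n : ℝ) ≤ ℓ := hD.le_sum n
  have hℓ0 : 0 < ℓ := by linarith
  obtain ⟨σ₀⟩ := hD.nonempty_pairing n
  -- The first level with Y_N ≥ n^α₁.
  set N : ℕ := ⌈Real.log (α₁ * Real.log n / Real.log M) / Real.log β⌉₊ with hN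
  have hfrac : 0 < α₁ * Real.log n / Real.log M := by positivity
  have hNle : N ≤ ⌈Real.log (Real.log n) / Real.log β⌉₊ := by
    refine Nat.ceil_le_ceil ?_
    gcongr
    rw [div_le_iff₀ (by linarith)]
    calc α₁ * Real.log n ≤ 1 * Real.log n := by gcongr
      _ ≤ Real.log M * Real.log n := by gcongr
      _ = Real.log n * Real.log M := mul_comm _ _
  have hYlt : ∀ i < N, Y i < (n : ℝ) ^ α₁ := by
    intro i hi
    rw [hN, Nat.lt_ceil, lt_div_iff₀ hlogβ, ← Real.log_pow, Real.log_lt_log_iff (by positivity) hfrac,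
      lt_div_iff₀ (by linarith)] at hi
    simp only [hY]
    rw [Real.rpow_def_of_pos hM0, Real.rpow_def_of_pos hn0, Real.exp_lt_exp]
    linarith
  -- Truncation changes only levels from `N` on, and makes the last layer sit exactly at degree
  -- n^α₁.
  set y : ℕ → ℝ := fun i => min (Y i) ((n : ℝ) ^ α₁) with hy
  have hyY : ∀ i < N, y i = Y i := fun i hi => min_eq_left (hYlt i hi).le
  have hyM : ∀ i, M ≤ y i := fun i => le_min (hYM i) hnM
  have hyN : y N = (n : ℝ) ^ α₁ := by
    refine min_eq_right ?_
    have h1 : Real.log (α₁ * Real.log n / Real.log M) / Real.log β ≤ N := Nat.le_ceil _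
    rw [div_le_iff₀ hlogβ, ← Real.log_pow, Real.log_le_log_iff hfrac (by positivity),
      div_le_iff₀ (by linarith)] at h1
    simp only [hY]
    rw [Real.rpow_def_of_pos hM0, Real.rpow_def_of_pos hn0, Real.exp_le_exp]
    linarith
  set V : ℕ → Finset (Fin n) := fun i =>
    Finset.univ.filter fun v => y i < D n v ∧ (D n v : ℝ) ≤ 2 * y i ^ (1 + ζ) with hV
  have hVsum : ∀ i, n * y i ^ (-q) ≤ ((∑ v ∈ V i, D n v : ℕ) : ℝ) := by
    intro i
    refine hlow n (by omega) (y i) (hMM₀.trans (hyM i)) ?_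
    have hyi : 0 < y i := hM0.trans_le (hyM i)
    calc y i ^ (1 + ζ) ≤ ((n : ℝ) ^ α₁) ^ (1 + ζ) :=
          Real.rpow_le_rpow hyi.le (min_le_right _ _) (by linarith)
      _ = (n : ℝ) ^ (α₁ * (1 + ζ)) := by rw [← Real.rpow_mul hn0.le]
      _ < (n : ℝ) ^ α := Real.rpow_lt_rpow_of_exponent_lt (by exact_mod_cast (by omega : 1 < n)) hζα
  set g : ℕ → ℝ := fun i => if i < N then Y i ^ (-A) else 0 with hg
  have hYpos : ∀ i, 0 < Y i := fun i => hM0.trans_le (hYM i)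
  have hg0 : ∀ i, 0 ≤ g i := fun i => by
    have := hYpos i
    simp only [hg]; split_ifs <;> positivity
  set cc : ℝ := η' / (R + 1) with hcc
  have hcc0 : 0 < cc := by positivity
  have hR0 : (0 : ℝ) ≤ R := Nat.cast_nonneg R
  have hn3a : (0 : ℝ) ≤ 2 * (2 * R + 1) * M ^ q := by positivity
  have hn3b : (0 : ℝ) ≤ (2 * R + 1) * (R + 1) / η' := by positivity
  have hmain := sampleMeasure_not_short_le (D := D n) ν σ₀ hν (hD.two_le n) (V := V) (θ := θ) (g := g)
    (ε := fun i => Real.exp (-(c₀ * Y i ^ ω₀))) (z := fun i => 2 * Y i ^ (1 + ζ)) (N := N) (R := R)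
    (m := ⌊(n : ℝ) ^ α₁ / 4⌋₊) (t := ⌊(n : ℝ) ^ α₁ / 2⌋₊) (ρ := c₀ * M ^ (-q)) (c := cc) (W := W)
    (θ' := levelInv ν 0) hW0 (levelInv_nonneg hν 0) hg0 ?_ ?_ ?_ hMρ0 hMρ1 ?_ ?_ hcc0.le ?_ ?_
  · refine (measure_mono fun ω hω => ?_).trans (hmain.trans (ENNReal.ofReal_le_ofReal ?_))
    · rintro ⟨l, hl, hw, hlen⟩
      refine hω ⟨l, hl, hw.trans ?_, by omega⟩
      have h1 : ∑ j ∈ Finset.range N, θ j ≤ ∑ j ∈ Finset.range ⌈Real.log (Real.log n) / Real.log β⌉₊,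
          levelInv ν (j * Real.log β) :=
        (Finset.sum_le_sum fun j _ => hθle j).trans (Finset.sum_le_sum_of_subset_of_nonneg
          (Finset.range_subset_range.2 hNle) fun j _ _ => levelInv_nonneg hν _)
      linarith
    · have e1 : (R : ℝ) * cc ≤ η' := by
        rw [hcc, mul_div_assoc', div_le_iff₀ (by linarith)]; nlinarith
      have e2 : (R : ℝ) * g 0 ≤ η' := by
        refine le_trans ?_ hMg
        refine mul_le_mul_of_nonneg_left ?_ hR0
        simp only [hg, hY, pow_zero, Real.rpow_one]
        split_ifs
        · exact le_rfl
        · positivity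
      have e3 : (n : ℝ) ^ 2 * (1 - cdf ν (levelInv ν 0) * (⌊(n : ℝ) ^ α₁ / 2⌋₊ : ℝ) / ℓ) ^
          ⌊(n : ℝ) ^ α₁ / 4⌋₊ ≤ η' := by
        refine le_trans ?_ hn4
        refine mul_le_mul_of_nonneg_left ?_ (by positivity)
        have hcdf : Real.exp (-1) ≤ cdf ν (levelInv ν 0) := by
          have := le_cdf_genInv ν hν (Real.exp_pos (-Real.exp 0)) (exp_neg_exp_lt_one 0)
          rw [Real.exp_zero] at this
          rw [levelInv, Real.exp_zero]
          exact this
        have hfl := Nat.floor_le (by linarith : 0 ≤ (n : ℝ) ^ α₁ / 2)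
        have hnα : (n : ℝ) ^ α₁ ≤ n := by
          nth_rewrite 2 [← Real.rpow_one (n : ℝ)]
          exact Real.rpow_le_rpow_of_exponent_le (by exact_mod_cast (by omega : 1 ≤ n)) hα₁1.le
        refine (one_sub_mul_div_pow_le (Real.exp_pos (-1)).le hcdf (cdf_le_one _ _)
          (by linarith : 0 ≤ (n : ℝ) ^ α₁ / 4) (div_four_le_floor (by linarith)) (by linarith) hℓ0
          (div_eight_le_floor hn8)).trans ?_
        rw [Real.exp_le_exp, neg_le_neg_iff, le_div_iff₀ hℓ0]
        have e4 : (n : ℝ) ^ (2 * α₁ - 1) * n = (n : ℝ) ^ α₁ * (n : ℝ) ^ α₁ := by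
          nth_rewrite 2 [← Real.rpow_one (n : ℝ)]
          rw [← Real.rpow_add hn0, ← Real.rpow_add hn0]; congr 1; ring
        calc Real.exp (-1) / (32 * Λ) * (n : ℝ) ^ (2 * α₁ - 1) * ℓ ≤
            Real.exp (-1) / (32 * Λ) * (n : ℝ) ^ (2 * α₁ - 1) * (Λ * n) := by gcongr
          _ = Real.exp (-1) / 32 * ((n : ℝ) ^ (2 * α₁ - 1) * n) := by field_simp
          _ = _ := by rw [e4]; ring
      have e5 : 16 * η' = η := by rw [hη']; ring
      linarith
  · intro i hi x hx
    have := (Finset.mem_filter.1 hx).2.2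
    rwa [hyY i hi] at this
  · intro i hi x hx σ₁ S hS hcard
    have hDx := (Finset.mem_filter.1 hx).2.1
    rw [hyY i hi] at hDx
    have hYi := hYpos i
    have hy1 : 0 < y (i + 1) := hM0.trans_le (hyM (i + 1))
    have h1 : (n : ℝ) * ((n : ℝ) ^ α₁) ^ (-q) ≤ n * y (i + 1) ^ (-q) := by
      refine mul_le_mul_of_nonneg_left ?_ hn0.le
      exact Real.rpow_le_rpow_of_nonpos hy1 (min_le_right _ _) (by linarith)
    have h2 : 2 * (n : ℝ) ^ α₁ ≤ n * ((n : ℝ) ^ α₁) ^ (-q) := by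
      have e1 : (n : ℝ) * ((n : ℝ) ^ α₁) ^ (-q) =
          (n : ℝ) ^ (1 - α₁ * (1 + q)) * (n : ℝ) ^ α₁ := by
        nth_rewrite 1 [← Real.rpow_one (n : ℝ)]
        rw [← Real.rpow_mul hn0.le, ← Real.rpow_add hn0, ← Real.rpow_add hn0]; congr 1; ring
      rw [e1]; gcongr
    have hSc : (S.card : ℝ) ≤ Y i / 2 := le_trans (by exact_mod_cast hcard) (hMR i)
    refine (avg_stuck_le_exp ν hS (V (i + 1)) (θ i) x (y := Y i) (Y := n * y (i + 1) ^ (-q))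
      (p := Y i ^ (-ω₀)) (hMM8 i) hDx.le hSc (by linarith [hYlt i hi]) (hVsum (i + 1))
      (by positivity) (hθcdf i)).mono (fun _ _ => le_rfl) ?_
    rw [Real.exp_le_exp, neg_le_neg_iff, le_div_iff₀ hℓ0]
    have h3 : Y i ^ (-(β * q)) ≤ y (i + 1) ^ (-q) := by
      have e1 : Y i ^ (-(β * q)) = Y (i + 1) ^ (-q) := by
        rw [hYsucc, ← Real.rpow_mul hYi.le]; congr 1; ring
      rw [e1]
      exact Real.rpow_le_rpow_of_nonpos hy1 (min_le_left _ _) (by linarith)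
    -- Probability of a short edge, times density of the next layer, times degree: the exponents add
    -- up to 1 - qβ - ω₀ = ω₀.
    have h4 : Y i ^ (-ω₀) * Y i ^ (-(β * q)) * Y i = Y i ^ ω₀ := by
      nth_rewrite 3 [← Real.rpow_one (Y i)]
      rw [← Real.rpow_add hYi, ← Real.rpow_add hYi]; congr 1; rw [hω₀]; ring
    have h5 : c₀ * ℓ ≤ n / 32 := by
      calc c₀ * ℓ ≤ 1 / (32 * Λ) * (Λ * n) := by gcongr
        _ = n / 32 := by field_simp
    calc c₀ * Y i ^ ω₀ * ℓ = c₀ * ℓ * Y i ^ ω₀ := by ring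
      _ ≤ n / 32 * Y i ^ ω₀ := by gcongr
      _ = Y i ^ (-ω₀) * (n * Y i ^ (-(β * q)) / 4) * (Y i / 8) := by rw [← h4]; ring
      _ ≤ Y i ^ (-ω₀) * (n * y (i + 1) ^ (-q) / 4) * (Y i / 8) := by gcongr
  · intro i hi
    have hYi := hYpos i
    have hY1 : 1 ≤ Y i := hM1.trans (hYM i)
    have h1 := hMexp (Y i) (hYM i)
    have h2 : g i = Y i ^ (-A) := by simp only [hg]; rw [if_pos hi]
    have h3 : g (i + 1) ≤ Y i ^ (-(β * A)) := by
      have e1 : Y (i + 1) ^ (-A) = Y i ^ (-(β * A)) := by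
        rw [hYsucc, ← Real.rpow_mul hYi.le]; congr 1; ring
      simp only [hg]
      split_ifs
      · exact e1.le
      · positivity
    have h4 : 2 * Y i ^ (1 + ζ) * g (i + 1) ≤ 1 / 2 * Y i ^ (-A) := by
      calc 2 * Y i ^ (1 + ζ) * g (i + 1) ≤ 2 * Y i ^ (1 + ζ) * Y i ^ (-(β * A)) := by gcongr
        _ = 2 * Y i ^ (1 + ζ - β * A) := by rw [mul_assoc, ← Real.rpow_add hYi]; congr 2
        _ ≤ 2 * Y i ^ (-A - 1) :=
            mul_le_mul_of_nonneg_left (Real.rpow_le_rpow_of_exponent_le hY1 (by linarith))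
              (by norm_num)
        _ = 2 * (Y i)⁻¹ * Y i ^ (-A) := by
            rw [Real.rpow_sub hYi, Real.rpow_one]; ring
        _ ≤ 1 / 2 * Y i ^ (-A) := by
            gcongr
            rw [← div_eq_mul_inv, div_le_iff₀ hYi]
            linarith [hMM8 i]
    rw [h2]; linarith
  · have hy0 : y 0 = M := by simp only [hy, hY, pow_zero, Real.rpow_one]; exact min_eq_left hnM
    refine le_trans ?_ (hVsum 0)
    rw [hy0]
    have hMq : 0 < M ^ (-q) := Real.rpow_pos_of_pos hM0 _
    have h1 : c₀ * M ^ (-q) * ℓ ≤ n * M ^ (-q) / 2 := by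
      calc c₀ * M ^ (-q) * ℓ ≤ 1 / (2 * Λ) * M ^ (-q) * (Λ * n) := by gcongr
        _ = n * M ^ (-q) / 2 := by field_simp
    have h2 : 2 * (2 * R + 1) * M ^ q ≤ (n : ℝ) := by linarith
    have h3 : 2 * (2 * (R : ℝ) + 1) ≤ n * M ^ (-q) := by
      rw [Real.rpow_neg hM0.le, ← div_eq_mul_inv, le_div_iff₀ (Real.rpow_pos_of_pos hM0 q)]
      exact h2
    push_cast [-Nat.cast_sum]; linarith
  · rw [hcc, div_mul_eq_mul_div, le_div_iff₀ (by positivity)]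
    have h1 : (2 * R + 1) * (R + 1) / η' ≤ ℓ - (2 * R + 1) := by linarith
    rw [div_le_iff₀ hη'0] at h1
    push_cast [-Nat.cast_sum]; linarith
  · intro x hx
    have hDx := (Finset.mem_filter.1 hx).2.1
    rw [hyN] at hDx
    have hm := Nat.floor_le (by linarith : 0 ≤ (n : ℝ) ^ α₁ / 4)
    have ht := Nat.floor_le (by linarith : 0 ≤ (n : ℝ) ^ α₁ / 2)
    constructor
    · have : ((2 * ⌊(n : ℝ) ^ α₁ / 4⌋₊ : ℕ) : ℝ) ≤ D n x := by push_cast; linarith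
      exact_mod_cast this
    · have : ((⌊(n : ℝ) ^ α₁ / 2⌋₊ + 2 * ⌊(n : ℝ) ^ α₁ / 4⌋₊ : ℕ) : ℝ) ≤ D n x := by
        push_cast; linarith
      exact_mod_cast this
  · have ht := Nat.floor_le (by linarith : 0 ≤ (n : ℝ) ^ α₁ / 2)
    have hnα : (n : ℝ) ^ α₁ ≤ n := by
      nth_rewrite 2 [← Real.rpow_one (n : ℝ)]
      exact Real.rpow_le_rpow_of_exponent_le (by exact_mod_cast (by omega : 1 ≤ n)) hα₁1.le
    have : ((⌊(n : ℝ) ^ α₁ / 2⌋₊ : ℕ) : ℝ) ≤ ℓ := by linarith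
    exact Nat.cast_le.1 this

end UpperLimit

/-! ### From finite estimates to limits in probability -/

section Limits

variable {D : ∀ n : ℕ, Fin n → ℕ} {ν : Measure ℝ} [IsProbabilityMeasure ν]

/-- The finer step |log (τ - 2)|/r costs the factor `r`; rounding adds a bounded number of terms,
each at most `levelInv ν 0`. -/
lemma sum_levelInv_le (hν : ∀ᵐ x ∂ν, 0 ≤ x) {τ r : ℝ} (h2 : 2 < τ) (h3 : τ < 3) (hr : 1 < r)
    {n N : ℕ}
    (hN : N * (|Real.log (τ - 2)| / r) ≤ (⌊logLogRatio τ n⌋₊ + 2 : ℕ) * |Real.log (τ - 2)|) :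
    ∑ j ∈ Finset.range N, levelInv ν (j * (|Real.log (τ - 2)| / r)) ≤
      levelInv ν 0 + r * (2 * levelInv ν 0 + normalizer ν τ n / 2) := by
  have hlog : Real.log (τ - 2) < 0 := Real.log_neg (by linarith) (by linarith)
  rw [normalizer_eq h2 h3]
  set a : ℝ := |Real.log (τ - 2)| with ha
  have ha0 : 0 < a := abs_pos.2 hlog.ne
  have hanti := levelInv_antitone hν
  have hpos := levelInv_nonneg hν
  have hx0 : 0 < a / r := by positivity
  have h4 := sum_le_mul_sum_of_antitone hanti hpos ha0 hx0 hN
  rw [div_div_cancel₀ ha0.ne'] at h4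
  set m := ⌊logLogRatio τ n⌋₊ with hm
  have e1 := Finset.sum_range_succ (fun i : ℕ => levelInv ν (i * (a / r))) N
  have e2 := Finset.sum_range_succ' (fun i : ℕ => levelInv ν (i * (a / r))) N
  have e3 := Finset.sum_range_succ' (fun i : ℕ => levelInv ν (i * a)) (m + 1)
  have e4 := Finset.sum_range_succ (fun i : ℕ => levelInv ν ((i + 1 : ℕ) * a)) m
  simp only [Nat.cast_zero, zero_mul] at e2 e3
  have e5 := hpos (N * (a / r))
  have e6 : levelInv ν ((m + 1 : ℕ) * a) ≤ levelInv ν 0 := hanti (by positivity)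
  have h5 : ∑ i ∈ Finset.range (m + 2), levelInv ν (i * a) ≤ 2 * levelInv ν 0 +
      2 * (∑ i ∈ Finset.range m, levelInv ν ((i + 1 : ℕ) * a)) / 2 := by linarith
  have h6 := mul_le_mul_of_nonneg_left h5 (by linarith : 0 ≤ r)
  linarith

lemma DegreeBounds.eventually_upper {τ α : ℝ} (h2 : 2 < τ) (h3 : τ < 3)
    (hD : DegreeBounds D (τ - 2) α) (hν : ∀ᵐ x ∂ν, 0 ≤ x)
    (hsum : Tendsto (fun N : ℕ => ∑ k ∈ Finset.Icc 1 N, genInv (cdf ν) (Real.exp (-Real.exp (k : ℝ))))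
      atTop atTop) {ε η : ℝ} (hε : 0 < ε) (hη : 0 < η) :
    ∀ᶠ n : ℕ in atTop, sampleMeasure (D n) ν {ω | ¬ ∃ l,
      IsPath ω.1 ω.2.2.1 l ω.2.2.2 ∧ pathWeight ω.1 ω.2.1 l ≤ (1 + ε) * normalizer ν τ n ∧
      (l.length : ℝ) ≤ (1 + ε) * (2 * logLogRatio τ n)} ≤ ENNReal.ofReal η := by
  have hs : 0 < τ - 2 := by linarith
  have hlog : Real.log (τ - 2) < 0 := Real.log_neg hs (by linarith)
  set a : ℝ := |Real.log (τ - 2)| with ha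
  have ha0 : 0 < a := abs_pos.2 hlog.ne
  -- The remaining 3ε/4 absorbs the constant costs, in the total length as in the number of edges.
  set r : ℝ := 1 + ε / 4 with hr
  have hr1 : 1 < r := by linarith
  have hx0 : 0 < a / r := by positivity
  have hxa : a / r < a := div_lt_self ha0 hr1
  have hβs : Real.exp (a / r) * (τ - 2) < 1 := by
    have : τ - 2 = Real.exp (-a) := by rw [ha, abs_of_neg hlog, neg_neg, Real.exp_log hs]
    rw [this, ← Real.exp_add]; exact Real.exp_lt_one_iff.2 (by linarith)
  obtain ⟨R, W, hW, hev⟩ :=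
    hD.eventually_short hs (by linarith) hν (Real.one_lt_exp_iff.2 hx0) hβs hη
  simp only [Real.log_exp] at hev
  filter_upwards [hev, (tendsto_normalizer hν hsum h2 h3).eventually_ge_atTop
      ((2 * (R * W) + 3 * levelInv ν 0 + 4 * r * levelInv ν 0) / (3 * ε / 4)),
    (tendsto_logLogRatio h2 h3).eventually_ge_atTop ((2 * R + 3) / (3 * ε / 2))] with n hn hNn hRn
  refine (measure_mono ?_).trans hn
  rintro ω hω ⟨l, hl, hw, hlen⟩
  have hR0 : 0 ≤ logLogRatio τ n := le_trans (by positivity) hRn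
  rw [div_le_iff₀ (by positivity)] at hNn hRn
  set N := ⌈Real.log (Real.log n) / (a / r)⌉₊ with hN
  have hll : Real.log (Real.log n) / (a / r) = r * logLogRatio τ n := by
    rw [logLogRatio, ← ha]; field_simp
  have hNlt : (N : ℝ) < r * logLogRatio τ n + 1 := by
    rw [hN, hll]; exact Nat.ceil_lt_add_one (by positivity)
  have hfl := Nat.lt_floor_add_one (logLogRatio τ n)
  have hNx : N * (a / r) ≤ (⌊logLogRatio τ n⌋₊ + 2 : ℕ) * a := by
    calc N * (a / r) ≤ (r * logLogRatio τ n + 1) * (a / r) := by gcongr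
      _ = logLogRatio τ n * a + a / r := by field_simp
      _ ≤ (⌊logLogRatio τ n⌋₊ + 1) * a + a := by gcongr
      _ = _ := by push_cast; ring
  have hsumle := sum_levelInv_le hν h2 h3 hr1 hNx
  refine hω ⟨l, hl, hw.trans ?_, ?_⟩
  · rw [← ha] at hsumle
    rw [hr] at hsumle hNn
    linarith
  · have h4 : (l.length : ℝ) ≤ 2 * (R + N) + 1 := by exact_mod_cast hlen
    rw [hr] at hNlt
    linarith

lemma isProbabilityMeasure_sampleMeasure {n : ℕ} (hn : 0 < n) {D : Fin n → ℕ}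
    (h : Nonempty (Pairing (HalfEdge D))) : IsProbabilityMeasure (sampleMeasure D ν) := by
  have : Nonempty (Fin n) := ⟨⟨0, hn⟩⟩
  have h1 : IsProbabilityMeasure (uniformOn (Set.univ : Set (Pairing (HalfEdge D)))) :=
    isProbabilityMeasure_uniformOn Set.finite_univ Set.univ_nonempty
  have h2 : IsProbabilityMeasure (uniformOn (Set.univ : Set (Fin n × Fin n))) :=
    isProbabilityMeasure_uniformOn Set.finite_univ Set.univ_nonempty
  unfold sampleMeasure
  infer_instance

omit [IsProbabilityMeasure ν] in
lemma tendsto_measure_zero {S : ∀ n, Set (Sample (D n))}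
    (h : ∀ η : ℝ, 0 < η → ∀ᶠ n in atTop, sampleMeasure (D n) ν (S n) ≤ ENNReal.ofReal η) :
    Tendsto (fun n => sampleMeasure (D n) ν (S n)) atTop (𝓝 0) := by
  rw [ENNReal.tendsto_nhds_zero]
  intro η hη
  rcases eq_or_ne η ⊤ with rfl | hη'
  · exact Eventually.of_forall fun _ => le_top
  · filter_upwards [h η.toReal (ENNReal.toReal_pos hη.ne' hη')] with n hn
    rwa [ENNReal.ofReal_toReal hη'] at hn

/-- Only subadditivity relates `S n` to its complement, so these events need not be measurable. -/
lemma tendsto_measure_one (hD : ∀ n, Nonempty (Pairing (HalfEdge (D n))))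
    {S : ∀ n, Set (Sample (D n))}
    (h : ∀ η : ℝ, 0 < η → ∀ᶠ n in atTop, sampleMeasure (D n) ν (S n)ᶜ ≤ ENNReal.ofReal η) :
    Tendsto (fun n => sampleMeasure (D n) ν (S n)) atTop (𝓝 1) := by
  have h1 : Tendsto (fun n => 1 - sampleMeasure (D n) ν (S n)ᶜ) atTop (𝓝 (1 - 0)) :=
    ENNReal.Tendsto.sub tendsto_const_nhds (tendsto_measure_zero h) (Or.inl ENNReal.one_ne_top)
  rw [tsub_zero] at h1
  refine tendsto_of_tendsto_of_tendsto_of_le_of_le' h1 tendsto_const_nhds ?_ ?_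
  all_goals
    filter_upwards [eventually_gt_atTop 0] with n hn
    have := isProbabilityMeasure_sampleMeasure (ν := ν) hn (hD n)
  · rw [tsub_le_iff_right, ← measure_univ (μ := sampleMeasure (D n) ν), ← Set.union_compl_self (S n)]
    exact measure_union_le _ _
  · exact prob_le_one

end Limits

/-! ### Passing from bounds on all paths to distance and hopcount -/

section Distances

variable {n : ℕ} {d : Fin n → ℕ} {σ : Pairing (HalfEdge d)} {L : Sym2 (HalfEdge d) → ℝ}
  {u v : Fin n}

/-- A bound on all paths applies in particular to the minimising ones; if there are none the
hopcount is infinite. -/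
lemma le_hopcount {c : ℝ} (h : ∀ l, IsPath σ u l v → c ≤ l.length) :
    ENNReal.ofReal c ≤ (hopcount σ L u v : ℝ≥0∞) := by
  have h1 : ((⌈c⌉₊ : ℕ) : ℕ∞) ≤ hopcount σ L u v :=
    le_iInf fun l => le_iInf fun hl => le_iInf fun _ => by exact_mod_cast Nat.ceil_le.2 (h l hl)
  calc ENNReal.ofReal c ≤ ENNReal.ofReal (⌈c⌉₊ : ℝ) := ENNReal.ofReal_le_ofReal (Nat.le_ceil c)
    _ = (((⌈c⌉₊ : ℕ) : ℕ∞) : ℝ≥0∞) := by simp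
    _ ≤ _ := ENat.toENNReal_le.2 h1

lemma weightedDist_div_close {N ε : ℝ} (hN : 0 < N)
    (hlow : ∀ l, IsPath σ u l v → (1 - ε) * N ≤ pathWeight σ L l)
    (hup : ∃ l, IsPath σ u l v ∧ pathWeight σ L l ≤ (1 + ε) * N) :
    weightedDist σ L u v ≠ ⊤ ∧ |(weightedDist σ L u v).toReal / N - 1| ≤ ε := by
  obtain ⟨l, hl, hlw⟩ := hup
  have h1 : weightedDist σ L u v ≤ ((1 + ε) * N : ℝ) :=
    (iInf₂_le l hl).trans (EReal.coe_le_coe_iff.2 hlw)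
  have h2 : (((1 - ε) * N : ℝ) : EReal) ≤ weightedDist σ L u v :=
    le_iInf₂ fun l hl => EReal.coe_le_coe_iff.2 (hlow l hl)
  have htop : weightedDist σ L u v ≠ ⊤ := (h1.trans_lt (EReal.coe_lt_top _)).ne
  have hbot : weightedDist σ L u v ≠ ⊥ := ((EReal.bot_lt_coe _).trans_le h2).ne'
  refine ⟨htop, ?_⟩
  rw [← EReal.coe_toReal htop hbot, EReal.coe_le_coe_iff] at h1 h2
  rw [abs_le, neg_le_sub_iff_le_add, sub_le_iff_le_add, div_le_iff₀ hN, ← sub_le_iff_le_add,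
    le_div_iff₀ hN]
  exact ⟨h2, by linarith⟩

end Distances

end ConfigModel
end

/-! ### The main theorem -/

theorem theorem2p3 (d : ∀ n : ℕ, Fin n → ℕ) (τ : ℝ)
    (hd : ConfigModel.PowerLawTail d τ) (hlim : ConfigModel.LimitingDistributions d)
    (ν : Measure ℝ) [IsProbabilityMeasure ν] (hν : ∀ᵐ x ∂ν, 0 ≤ x)
    (hsum : Tendsto
      (fun N : ℕ => ∑ k ∈ Finset.Icc 1 N,
        ConfigModel.genInv (cdf ν) (Real.exp (-Real.exp (k : ℝ)))) atTop atTop) :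
    -- the weighted distance, divided by the normalising sum, tends to 1 in probability
    (∀ ε : ℝ, 0 < ε → Tendsto
      (fun n : ℕ => ConfigModel.sampleMeasure (ConfigModel.evenDegrees (d n)) ν
        {ω | ConfigModel.weightedDist ω.1 ω.2.1 ω.2.2.1 ω.2.2.2 = ⊤ ∨
          ε < |(ConfigModel.weightedDist ω.1 ω.2.1 ω.2.2.1 ω.2.2.2).toReal
                / ConfigModel.normalizer ν τ n - 1|}) atTop (𝓝 0)) ∧
    -- lower bound on the hopcount
    (∀ ε : ℝ, 0 < ε → Tendsto
      (fun n : ℕ => ConfigModel.sampleMeasure (ConfigModel.evenDegrees (d n)) ν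
        {ω | ENNReal.ofReal ((1 - ε) * (2 * ConfigModel.logLogRatio τ n)) ≤
          (ConfigModel.hopcount ω.1 ω.2.1 ω.2.2.1 ω.2.2.2 : ℝ≥0∞)}) atTop (𝓝 1)) ∧
    -- a path that is short both in total length and in number of edges
    (∀ ε : ℝ, 0 < ε → Tendsto
      (fun n : ℕ => ConfigModel.sampleMeasure (ConfigModel.evenDegrees (d n)) ν
        {ω | ∃ l : List (ConfigModel.HalfEdge (ConfigModel.evenDegrees (d n))),
          ConfigModel.IsPath ω.1 ω.2.2.1 l ω.2.2.2 ∧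
          ConfigModel.pathWeight ω.1 ω.2.1 l ≤ (1 + ε) * ConfigModel.normalizer ν τ n ∧
          (l.length : ℝ) ≤ (1 + ε) * (2 * ConfigModel.logLogRatio τ n)}) atTop (𝓝 1)) := by
  obtain ⟨h2, h3, -⟩ := id hd
  obtain ⟨α, hD⟩ := ConfigModel.exists_degreeBounds hd hlim
  refine ⟨fun ε hε => ConfigModel.tendsto_measure_zero fun η hη => ?_, fun ε hε =>
    ConfigModel.tendsto_measure_one hD.nonempty_pairing fun η hη => ?_, fun ε hε =>
    ConfigModel.tendsto_measure_one hD.nonempty_pairing fun η hη =>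
      hD.eventually_upper h2 h3 hν hsum hε hη⟩
  -- The lower bounds are proved for ε < 1 only; shrinking ε strengthens the conclusion.
  · have he : 0 < min ε (1 / 2) := by positivity
    filter_upwards [hD.eventually_lower h2 h3 hν hsum he
        ((min_le_right _ _).trans_lt (by norm_num)) (half_pos hη),
      hD.eventually_upper h2 h3 hν hsum he (half_pos hη),
      (ConfigModel.tendsto_normalizer hν hsum h2 h3).eventually_gt_atTop 0] with n hlow hup hN
    rw [← add_halves η, ENNReal.ofReal_add (half_pos hη).le (half_pos hη).le]
    refine (measure_mono fun ω hω => ?_).trans ((measure_union_le _ _).trans (add_le_add hlow hup))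
    by_contra hcon
    simp only [Set.mem_union, Set.mem_ofPred_eq, not_or, not_not] at hcon
    obtain ⟨hlow', l, hl, hw, -⟩ := hcon
    obtain ⟨h4, h5⟩ := ConfigModel.weightedDist_div_close hN (fun l hl => (hlow' l hl).2) ⟨l, hl, hw⟩
    exact hω.elim h4 fun h6 => (h5.trans (min_le_left _ _)).not_gt h6
  · have he : 0 < min ε (1 / 2) := by positivity
    filter_upwards [hD.eventually_lower h2 h3 hν hsum he
        ((min_le_right _ _).trans_lt (by norm_num)) hη,
      (ConfigModel.tendsto_logLogRatio h2 h3).eventually_ge_atTop 0] with n hlow hn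
    refine (measure_mono ?_).trans hlow
    intro ω hω hcon
    refine hω ?_
    refine ConfigModel.le_hopcount fun l hl => le_trans ?_ (hcon l hl).1
    gcongr
    exact min_le_left _ _
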